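/- Let $k$ be a field. A twist oriented quantum algebra $(A,\rho,t_{\sf d},t_{\sf u},G)$ over $k$ consists of an associative unital $k$-algebra $A$, an invertible $\rho\in A\otimes A$, commuting algebra automorphisms $t_{\sf d},t_{\sf u}$ of $A$ and an invertible $G\in A$ such that - $(1_A\otimes t_{\sf u})(\rho)$ and $(t_{\sf d}\otimes 1_A)(\rho^{-1})$ are inverses in $A\otimes A^{op}$; - $\rho=(t_{\sf d}\otimes t_{\sf d})(\rho)=(t_{\sf u}\otimes t_{\sf u})(\rho)$; - $\rho_{12}\rho_{13}\rho_{23}=\rho_{23}\rho_{13}\rho_{12}$; - $t_{\sf d}(G)=t_{\sf u}(G)=G$ and $t_{\sf d}\circ t_{\sf u}(x)=GxG^{-1}$ for all $x\in A$. Its associated standard twist oriented quantum algebra is $A_s=(A,\rho,1_A,t_{\sf d}\circ t_{\sf u},G)$. Diagrams. Oriented link diagrams are taken in the plane with respect to a fixed vertical; up to vertical lines they are composed of finitely many oriented crossings and oriented local extrema, at distinct heights. At a crossing the rising line runs from lower left to upper right and the falling line from lower right to upper left. Regular isotopy is the equivalence relation generated by the following local moves, with all compatible orientations: exchange of the heights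 of two horizontally separated pieces; cancellation of a local maximum with an adjacent local minimum in an S-shaped arc; the second and the third Reidemeister moves for crossings with vertically running lines; and moving a line over or under a local maximum or minimum. Decorations. Write $\rho=\sum_i e_i\otimes e_i'$ and $\rho^{-1}=\sum_j E_j\otimes E_j'$. Each crossing receives its own copy of $\rho$ or $\rho^{-1}$, the first factor on the overcrossing line, the second on the undercrossing line, as follows. If the rising line is over: $e\otimes e'$ when both lines point up or both point down, $t_{\sf u}(E)\otimes E'$ when both point to the right, $t_{\sf d}(E)\otimes E'$ when both point to the left. If the falling line is over: $E\otimes E'$ when both lines point up or both point down, $e\otimes t_{\sf u}(e')$ when both point to the right, $e\otimes t_{\sf d}(e')$ when both point to the left. Local extrema have type $({\sf u}_-)$ (clockwise maximum), $({\sf u}_+)$ (counterclockwise minimum), $({\sf d}_+)$ (counterclockwise maximum) or $({\sf d}_-)$ (clockwise minimum). The invariant. Let ${\bf L}$ be an oriented link diagram with components ${\bf L}_1,\dots,{\bf L}_r$. The Whitney degree $d_\ell$ of ${\bf L}_\ell$ is half of the difference (number of its clockwise extrema) $-$ (number of its counterclockwise extrema). Choose a starting point $P_\ell$ on a vertical line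 of each ${\bf L}_\ell$, traverse ${\bf L}_\ell$ from $P_\ell$ back to $P_\ell$ in the direction of the orientation, and let $x_1,\dots,x_m$ be the decorations of the crossing lines met, in this order. Let $u_{\sf d}(i)$ be the number of extrema of type $({\sf d}_+)$ minus the number of type $({\sf d}_-)$ met after the $i$-th crossing line, let $u_{\sf u}(i)$ be defined likewise with $({\sf u}_\pm)$, and put $$w({\bf L}_\ell)=t_{\sf d}^{u_{\sf d}(1)}t_{\sf u}^{u_{\sf u}(1)}(x_1)\cdots t_{\sf d}^{u_{\sf d}(m)}t_{\sf u}^{u_{\sf u}(m)}(x_m)$$ (so $w({\bf L}_\ell)=1$ if $m=0$). For a linear functional ${\sf tr}:A\to k$ put $${\bf Inv}_{A,{\sf tr}}({\bf L})=\sum\prod_{\ell=1}^r{\sf tr}\bigl(G^{d_\ell}w({\bf L}_\ell)\bigr),$$ where the sum is over all choices of a summand of $\rho$ or $\rho^{-1}$ at every crossing. Theorem. Let $(A,\rho,t_{\sf d},t_{\sf u},G)$ be a twist oriented quantum algebra over $k$ and let ${\sf tr}:A\to k$ be linear with ${\sf tr}(ab)={\sf tr}(ba)$ for all $a,b\in A$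 and ${\sf tr}\circ t_{\sf d}={\sf tr}\circ t_{\sf u}={\sf tr}$. Then: 0. ${\bf Inv}_{A,{\sf tr}}({\bf L})$ does not depend on the starting points $P_1,\dots,P_r$, nor on the expressions of $\rho$ and $\rho^{-1}$ as sums of pure tensors. a) If ${\bf L}$ and ${\bf L}'$ are regularly isotopic oriented link diagrams, then ${\bf Inv}_{A,{\sf tr}}({\bf L})={\bf Inv}_{A,{\sf tr}}({\bf L}')$. b) ${\bf Inv}_{A_s,{\sf tr}}({\bf L})={\bf Inv}_{A,{\sf tr}}({\bf L})$ for all oriented link diagrams ${\bf L}$. -/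

import Mathlib

open scoped TensorProduct

/-! ### Twist oriented quantum algebras -/

section Algebra

variable (k : Type*) (A : Type*) [Field k] [Ring A] [Algebra k A]

/-- The linear map `(f ⊗ g) : A ⊗ A → A ⊗ Aᵒᵖ`, the second factor being read in the opposite
algebra. -/
noncomputable def toTensorOp {k A : Type*} [Field k] [Ring A] [Algebra k A]
    (f g : A ≃ₐ[k] A) : A ⊗[k] A →ₗ[k] A ⊗[k] Aᵐᵒᵖ :=
  TensorProduct.map f.toLinearMap ((MulOpposite.opLinearEquiv k).toLinearMap ∘ₗ g.toLinearMap)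

/-- `a ⊗ b ↦ a ⊗ b ⊗ 1`. -/
noncomputable def leg12 : A ⊗[k] A →ₐ[k] A ⊗[k] (A ⊗[k] A) :=
  Algebra.TensorProduct.map (AlgHom.id k A) Algebra.TensorProduct.includeLeft

/-- `a ⊗ b ↦ a ⊗ 1 ⊗ b`. -/
noncomputable def leg13 : A ⊗[k] A →ₐ[k] A ⊗[k] (A ⊗[k] A) :=
  Algebra.TensorProduct.map (AlgHom.id k A) Algebra.TensorProduct.includeRight

/-- `a ⊗ b ↦ 1 ⊗ a ⊗ b`. -/
noncomputable def leg23 : A ⊗[k] A →ₐ[k] A ⊗[k] (A ⊗[k] A) :=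
  Algebra.TensorProduct.includeRight

/-- An oriented quantum algebra `(A, ρ, t_d, t_u)` over the field `k`. -/
structure OrientedQuantumAlgebra where
  ρ : (A ⊗[k] A)ˣ
  td : A ≃ₐ[k] A
  tu : A ≃ₐ[k] A
  comm : ∀ x, td (tu x) = tu (td x)
  /-- `(1 ⊗ t_u)(ρ)` and `(t_d ⊗ 1)(ρ⁻¹)` are inverses in `A ⊗ Aᵒᵖ`. -/
  inv_left :
    toTensorOp AlgEquiv.refl tu (ρ : A ⊗[k] A) *
      toTensorOp td AlgEquiv.refl ((ρ⁻¹ : (A ⊗[k] A)ˣ) : A ⊗[k] A) = 1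
  inv_right :
    toTensorOp td AlgEquiv.refl ((ρ⁻¹ : (A ⊗[k] A)ˣ) : A ⊗[k] A) *
      toTensorOp AlgEquiv.refl tu (ρ : A ⊗[k] A) = 1
  map_td : TensorProduct.map td.toLinearMap td.toLinearMap (ρ : A ⊗[k] A) = ρ
  map_tu : TensorProduct.map tu.toLinearMap tu.toLinearMap (ρ : A ⊗[k] A) = ρ
  /-- The quantum Yang--Baxter equation. -/
  yang_baxter :
    leg12 k A ρ * leg13 k A ρ * leg23 k A ρ = leg23 k A ρ * leg13 k A ρ * leg12 k A ρ

/-- A twist oriented quantum algebra `(A, ρ, t_d, t_u, G)` over the field `k`. -/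
structure TwistOrientedQuantumAlgebra extends OrientedQuantumAlgebra k A where
  G : Aˣ
  td_G : td (G : A) = G
  tu_G : tu (G : A) = G
  conj_G : ∀ x, td (tu x) = (G : A) * x * ((G⁻¹ : Aˣ) : A)

variable {k A}

theorem toTensorOp_comp_right (g h : A ≃ₐ[k] A) (f : A ≃ₐ[k] A) (x : A ⊗[k] A) :
    Algebra.TensorProduct.map (AlgHom.id k A) (AlgHom.op (g : A →ₐ[k] A))
      (toTensorOp f h x) = toTensorOp f (h.trans g) x := by
  induction x with
  | zero => simp
  | tmul a b => simp [toTensorOp]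
  | add x y hx hy => simp only [map_add, hx, hy]

theorem toTensorOp_map (g f h : A ≃ₐ[k] A) (x : A ⊗[k] A) :
    toTensorOp f h (TensorProduct.map g.toLinearMap g.toLinearMap x) =
      toTensorOp (g.trans f) (g.trans h) x := by
  induction x with
  | zero => simp
  | tmul a b => simp [toTensorOp]
  | add x y hx hy => simp only [map_add, hx, hy]

theorem map_inv_of_map (g : A ≃ₐ[k] A) (ρ : (A ⊗[k] A)ˣ)
    (h : TensorProduct.map g.toLinearMap g.toLinearMap (ρ : A ⊗[k] A) = ρ) :
    TensorProduct.map g.toLinearMap g.toLinearMap ((ρ⁻¹ : (A ⊗[k] A)ˣ) : A ⊗[k] A) =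
      ((ρ⁻¹ : (A ⊗[k] A)ˣ) : A ⊗[k] A) := by
  let φ : A ⊗[k] A →ₐ[k] A ⊗[k] A :=
    Algebra.TensorProduct.map (g : A →ₐ[k] A) (g : A →ₐ[k] A)
  have e : ∀ x, TensorProduct.map g.toLinearMap g.toLinearMap x = φ x := fun x => rfl
  rw [e] at h ⊢
  have h1 : φ (ρ⁻¹ : (A ⊗[k] A)ˣ) * (ρ : A ⊗[k] A) = 1 := by
    calc φ (ρ⁻¹ : (A ⊗[k] A)ˣ) * (ρ : A ⊗[k] A)
        = φ (ρ⁻¹ : (A ⊗[k] A)ˣ) * φ (ρ : A ⊗[k] A) := by rw [h]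
      _ = 1 := by rw [← map_mul, Units.inv_mul, map_one]
  calc φ (ρ⁻¹ : (A ⊗[k] A)ˣ)
      = φ (ρ⁻¹ : (A ⊗[k] A)ˣ) * (ρ : A ⊗[k] A) * ((ρ⁻¹ : (A ⊗[k] A)ˣ) : A ⊗[k] A) := by
        rw [mul_assoc, Units.mul_inv, mul_one]
    _ = _ := by rw [h1, one_mul]

/-- The standard twist oriented quantum algebra `(A, ρ, 1, t_d ∘ t_u, G)` associated with
`(A, ρ, t_d, t_u, G)`. -/
noncomputable def TwistOrientedQuantumAlgebra.standard (Q : TwistOrientedQuantumAlgebra k A) :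
    TwistOrientedQuantumAlgebra k A where
  ρ := Q.ρ
  td := AlgEquiv.refl
  tu := Q.tu.trans Q.td
  comm _ := rfl
  inv_left := by
    have h := congrArg (Algebra.TensorProduct.map (AlgHom.id k A)
      (AlgHom.op (Q.td : A →ₐ[k] A))) Q.inv_left
    rw [map_mul, map_one, toTensorOp_comp_right, toTensorOp_comp_right] at h
    have h2 := toTensorOp_map Q.td AlgEquiv.refl AlgEquiv.refl
      ((Q.ρ⁻¹ : (A ⊗[k] A)ˣ) : A ⊗[k] A)
    rw [map_inv_of_map Q.td Q.ρ Q.map_td] at h2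
    rw [h2]
    exact h
  inv_right := by
    have h := congrArg (Algebra.TensorProduct.map (AlgHom.id k A)
      (AlgHom.op (Q.td : A →ₐ[k] A))) Q.inv_right
    rw [map_mul, map_one, toTensorOp_comp_right, toTensorOp_comp_right] at h
    have h2 := toTensorOp_map Q.td AlgEquiv.refl AlgEquiv.refl
      ((Q.ρ⁻¹ : (A ⊗[k] A)ˣ) : A ⊗[k] A)
    rw [map_inv_of_map Q.td Q.ρ Q.map_td] at h2
    rw [h2]
    exact h
  map_td := by
    have : (AlgEquiv.refl : A ≃ₐ[k] A).toLinearMap = LinearMap.id := rfl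
    rw [this, TensorProduct.map_id]; rfl
  map_tu := by
    have : (Q.tu.trans Q.td).toLinearMap = Q.td.toLinearMap ∘ₗ Q.tu.toLinearMap := rfl
    rw [this, TensorProduct.map_comp, LinearMap.comp_apply, Q.map_tu, Q.map_td]
  yang_baxter := Q.yang_baxter
  G := Q.G
  td_G := rfl
  tu_G := by simp [Q.td_G, Q.tu_G]
  conj_G x := Q.conj_G x

end Algebra

/-! ### Oriented link diagrams with respect to a fixed vertical

A diagram is read from bottom to top as a finite sequence of slices. Each slice contains one
crossing or one local extremum, with vertical lines to its left and to its right. -/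

/-- Direction of a strand where it meets a horizontal line. -/
inductive Dir where
  | up
  | down

/-- The opposite direction. -/
def Dir.flip : Dir → Dir
  | .up => .down
  | .down => .up

/-- Oriented crossings and local extrema.
* `crossing s x y`: the line from lower left to upper right (the rising line) has direction `x`,
  the line from lower right to upper left (the falling line) has direction `y`; the rising line is
  the overcrossing line if `s = true`, the falling line is it if `s = false`.
* `max x`: a local maximum whose left end has direction `x`.
* `min x`: a local minimum whose left end has direction `x`. -/
inductive Piece where
  | crossing (s : Bool) (x y : Dir)
  | max (x : Dir)
  | min (x : Dir)

/-- Directions of the strands below the piece, from left to right. -/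
def Piece.dom : Piece → List Dir
  | .crossing _ x y => [x, y]
  | .max x => [x, x.flip]
  | .min _ => []

/-- Directions of the strands above the piece, from left to right. -/
def Piece.cod : Piece → List Dir
  | .crossing _ x y => [y, x]
  | .max _ => []
  | .min x => [x, x.flip]

/-- A piece together with the directions of the vertical lines on both sides of it. -/
structure Slice where
  left : List Dir
  piece : Piece
  right : List Dir

/-- Directions along the bottom of a slice. -/
def Slice.dom (x : Slice) : List Dir := x.left ++ x.piece.dom ++ x.right

/-- Directions along the top of a slice. -/
def Slice.cod (x : Slice) : List Dir := x.left ++ x.piece.cod ++ x.right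

/-- The slices fit together, starting from the strands `a` at the bottom and ending with the
strands `b` at the top. -/
def Fits : List Dir → List Slice → List Dir → Prop
  | a, [], b => a = b
  | a, x :: xs, b => a = x.dom ∧ Fits x.cod xs b

/-- An oriented link diagram: slices that fit together, with no strand at the bottom or the top. -/
structure LinkDiagram where
  slices : List Slice
  fits : Fits [] slices []

/-- Replacement of a local portion of a diagram. The lists `l`, `r` are the strands to the left and
right of the portion. -/
inductive LocalMove : List Slice → List Slice → Prop
  /-- pieces that are horizontally apart may change their relative height -/
  | heights (l m r : List Dir) (g h : Piece) :
      LocalMove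
        [⟨l, g, m ++ h.dom ++ r⟩, ⟨l ++ g.cod ++ m, h, r⟩]
        [⟨l ++ g.dom ++ m, h, r⟩, ⟨l, g, m ++ h.cod ++ r⟩]
  /-- cancellation of a maximum and a minimum, maximum on the left -/
  | zigzag_left (l r : List Dir) (x : Dir) :
      LocalMove [⟨l ++ [x], .min x.flip, r⟩, ⟨l, .max x, x :: r⟩] []
  /-- cancellation of a maximum and a minimum, maximum on the right -/
  | zigzag_right (l r : List Dir) (x : Dir) :
      LocalMove [⟨l, .min x, x :: r⟩, ⟨l ++ [x], .max x.flip, r⟩] []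
  /-- second Reidemeister move -/
  | reidemeister_two (l r : List Dir) (s : Bool) (x y : Dir) :
      LocalMove [⟨l, .crossing s x y, r⟩, ⟨l, .crossing (!s) y x, r⟩] []
  /-- third Reidemeister move -/
  | reidemeister_three (l r : List Dir) (s : Bool) (x y z : Dir) :
      LocalMove
        [⟨l, .crossing s x y, z :: r⟩, ⟨l ++ [y], .crossing s x z, r⟩,
          ⟨l, .crossing s y z, x :: r⟩]
        [⟨l ++ [x], .crossing s y z, r⟩, ⟨l, .crossing s x z, y :: r⟩,
          ⟨l ++ [z], .crossing s x y, r⟩]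
  /-- a line is moved under (`s = true`) or over (`s = false`) a local maximum -/
  | slide_max (l r : List Dir) (s : Bool) (x y : Dir) :
      LocalMove
        [⟨l, .crossing s x y, x.flip :: r⟩, ⟨l ++ [y], .max x, r⟩]
        [⟨l ++ [x], .crossing (!s) y x.flip, r⟩, ⟨l, .max x, y :: r⟩]
  /-- a line is moved under (`s = false`) or over (`s = true`) a local minimum -/
  | slide_min (l r : List Dir) (s : Bool) (x y : Dir) :
      LocalMove
        [⟨l ++ [y], .min x, r⟩, ⟨l, .crossing s y x, x.flip :: r⟩]
        [⟨l, .min x, y :: r⟩, ⟨l ++ [x], .crossing (!s) x.flip y, r⟩]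

/-- One diagram arises from the other by one local move. -/
def LinkDiagram.Move (L L' : LinkDiagram) : Prop :=
  ∃ below M M' above, LocalMove M M' ∧
    L.slices = below ++ M ++ above ∧ L'.slices = below ++ M' ++ above

/-- Regular isotopy of oriented link diagrams: the equivalence relation generated by the moves. -/
def LinkDiagram.RegularlyIsotopic : LinkDiagram → LinkDiagram → Prop :=
  Relation.EqvGen LinkDiagram.Move

/-! ### Traversal of the components -/

/-- What is met on the way through one slice: nothing (a vertical line), a crossing line, or a local
extremum of one of the four types. In `line i isOver`, `i` is the index of the slice that contains
the crossing, and `isOver` says whether the line is the overcrossing line. -/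
inductive Event where
  | vertical
  | line (i : ℕ) (isOver : Bool)
  | uPlus
  | uMinus
  | dPlus
  | dMinus

/-- The type of a local extremum: clockwise maximum `u₋`, counterclockwise maximum `d₊`, clockwise
minimum `d₋`, counterclockwise minimum `u₊`. -/
def Piece.extremum : Piece → Event
  | .max .up => .uMinus
  | .max .down => .dPlus
  | .min .up => .dMinus
  | .min .down => .uPlus
  | .crossing _ _ _ => .vertical

/-- A strand enters the slice `x`, which has index `i`, at position `j` (counted from the left,
starting with `0`) through its top (`top = true`) or its bottom (`top = false`). The result is the
side and position where it leaves, and what it meets. -/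
def Slice.pass (x : Slice) (i : ℕ) (top : Bool) (j : ℕ) : Bool × ℕ × Event :=
  let p := x.left.length
  let enter := if top then x.piece.cod.length else x.piece.dom.length
  let exit := if top then x.piece.dom.length else x.piece.cod.length
  if j < p then (!top, j, .vertical)
  else if p + enter ≤ j then (!top, j - enter + exit, .vertical)
  else
    match x.piece with
    | .crossing s _ _ =>
        -- the rising line joins bottom `p` to top `p + 1`, the falling line joins the others
        let rising : Bool := if top then j == p + 1 else j == p
        (!top, 2 * p + 1 - j, .line i (rising == s))
    | g => (top, 2 * p + 1 - j, g.extremum)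

namespace LinkDiagram

/-- Directions of the strands on the horizontal line just below the slice with index `i`. -/
def level (L : LinkDiagram) (i : ℕ) : List Dir :=
  match L.slices[i]? with
  | some x => x.dom
  | none => []

/-- The pieces of vertical line between the slices: `(i, j)` is the one at position `j` on the
horizontal line below the slice with index `i`. -/
def Point (L : LinkDiagram) : Type :=
  (i : Fin L.slices.length) × Fin (L.level i).length

/-- The height and position of a point. -/
def Point.coords {L : LinkDiagram} (P : L.Point) : ℕ × ℕ := (P.1, P.2)

/-- Moving in the direction of the orientation through one slice: the next point, and what is met
on the way. -/
def step (L : LinkDiagram) (P : ℕ × ℕ) : (ℕ × ℕ) × Event :=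
  match (L.level P.1)[P.2]? with
  | none => (P, .vertical)
  | some d =>
    let top : Bool := match d with
      | .up => false
      | .down => true
    let i := if top then P.1 - 1 else P.1
    match L.slices[i]? with
    | none => (P, .vertical)
    | some x =>
      let q := x.pass i top P.2
      ((if q.1 then i + 1 else i, q.2.1), q.2.2)

/-- The next point in the direction of the orientation. -/
def next (L : LinkDiagram) (P : ℕ × ℕ) : ℕ × ℕ := (L.step P).1

/-- The number of points met when traversing the component of `P` once. -/
noncomputable def period (L : LinkDiagram) (P : L.Point) : ℕ :=
  Function.minimalPeriod L.next P.coords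

/-- What is met, in this order, when the component of `P` is traversed from `P` back to `P` in the
direction of the orientation. -/
noncomputable def traversal (L : LinkDiagram) (P : L.Point) : List Event :=
  (List.range (L.period P)).map fun n => (L.step (L.next^[n] P.coords)).2

/-- Two points are on the same component of the link. -/
def sameComponent (L : LinkDiagram) : Setoid L.Point :=
  Relation.EqvGen.setoid fun P P' => L.next P.coords = P'.coords

/-- The components of a link diagram. -/
def Component (L : LinkDiagram) : Type := Quotient L.sameComponent

instance (L : LinkDiagram) : Finite L.Point :=
  inferInstanceAs (Finite ((i : Fin L.slices.length) × Fin (L.level i).length))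

noncomputable instance (L : LinkDiagram) : Fintype L.Component :=
  haveI : Finite L.Component := inferInstanceAs (Finite (Quotient L.sameComponent))
  Fintype.ofFinite _

/-- A choice of a starting point on each component. -/
def StartingPoints (L : LinkDiagram) : Type :=
  {P : L.Component → L.Point // ∀ c, Quotient.mk L.sameComponent (P c) = c}

theorem nonempty_startingPoints (L : LinkDiagram) : Nonempty L.StartingPoints :=
  ⟨⟨fun c => Quotient.out c, fun c => Quotient.out_eq c⟩⟩

end LinkDiagram

/-- Number of clockwise extrema minus number of counterclockwise extrema. -/
def rotationCount : List Event → ℤ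
  | [] => 0
  | .uMinus :: es => rotationCount es + 1
  | .dMinus :: es => rotationCount es + 1
  | .uPlus :: es => rotationCount es - 1
  | .dPlus :: es => rotationCount es - 1
  | .vertical :: es => rotationCount es
  | .line _ _ :: es => rotationCount es

/-- The Whitney degree of the component of `P`: half the difference between the number of
clockwise and the number of counterclockwise extrema (the difference is even). -/
noncomputable def LinkDiagram.whitneyDegree (L : LinkDiagram) (P : L.Point) : ℤ :=
  rotationCount (L.traversal P) / 2

/-- Number of extrema of type `d₊` minus the number of type `d₋`. -/
def countD : List Event → ℤ
  | [] => 0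
  | .dPlus :: es => countD es + 1
  | .dMinus :: es => countD es - 1
  | .uPlus :: es => countD es
  | .uMinus :: es => countD es
  | .vertical :: es => countD es
  | .line _ _ :: es => countD es

/-- Number of extrema of type `u₊` minus the number of type `u₋`. -/
def countU : List Event → ℤ
  | [] => 0
  | .uPlus :: es => countU es + 1
  | .uMinus :: es => countU es - 1
  | .dPlus :: es => countU es
  | .dMinus :: es => countU es
  | .vertical :: es => countU es
  | .line _ _ :: es => countU es

/-! ### Decorations and the bead sliding invariant -/

/-- Whether a crossing is decorated with a copy of `ρ` (`true`) or of `ρ⁻¹` (`false`). -/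
def Piece.sign : Piece → Bool
  | .crossing s .up .up => s
  | .crossing s .down .down => s
  | .crossing s .up .down => !s
  | .crossing s .down .up => !s
  | _ => true

/-- The piece of the slice with index `i`. -/
def LinkDiagram.piece (L : LinkDiagram) (i : Fin L.slices.length) : Piece :=
  (L.slices.get i).piece

/-- The indices of the slices that contain a crossing. -/
def LinkDiagram.Crossing (L : LinkDiagram) : Type :=
  {i : Fin L.slices.length // ∃ s x y, L.piece i = .crossing s x y}

noncomputable instance (L : LinkDiagram) : Fintype L.Crossing :=
  haveI : Finite L.Crossing :=
    inferInstanceAs (Finite {i : Fin L.slices.length // ∃ s x y, L.piece i = .crossing s x y})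
  Fintype.ofFinite _

noncomputable instance (L : LinkDiagram) : DecidableEq L.Crossing := Classical.decEq _

/-- A way to write an element of `A ⊗ A` as a finite sum of pure tensors. -/
structure Expansion {k A : Type*} [Field k] [Ring A] [Algebra k A] (x : A ⊗[k] A) where
  n : ℕ
  fst : Fin n → A
  snd : Fin n → A
  sum_eq : x = ∑ i, fst i ⊗ₜ[k] snd i

theorem nonempty_expansion {k A : Type*} [Field k] [Ring A] [Algebra k A] (x : A ⊗[k] A) :
    Nonempty (Expansion x) := by
  obtain ⟨n, f, g, h⟩ := TensorProduct.exists_sum_tmul_eq x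
  exact ⟨⟨n, f, g, h⟩⟩

namespace TwistOrientedQuantumAlgebra

variable {k A : Type*} [Field k] [Ring A] [Algebra k A] (Q : TwistOrientedQuantumAlgebra k A)

/-- The automorphism in the decoration of the overcrossing line: `t_u` resp. `t_d` when the rising
line is over and both lines are directed to the right resp. left. -/
def overTwist : Piece → (A ≃ₐ[k] A)
  | .crossing true .up .down => Q.tu
  | .crossing true .down .up => Q.td
  | _ => 1

/-- The automorphism in the decoration of the undercrossing line: `t_u` resp. `t_d` when the falling
line is over and both lines are directed to the right resp. left. -/
def underTwist : Piece → (A ≃ₐ[k] A)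
  | .crossing false .up .down => Q.tu
  | .crossing false .down .up => Q.td
  | _ => 1

/-- `ρ` or `ρ⁻¹`. -/
def rhoPow : Bool → A ⊗[k] A
  | true => Q.ρ
  | false => ((Q.ρ⁻¹ : (A ⊗[k] A)ˣ) : A ⊗[k] A)

/-- Expansions `ρ = ∑ aᵢ ⊗ bᵢ` and `ρ⁻¹ = ∑ αⱼ ⊗ βⱼ`. -/
abbrev Expansions : Type _ := (s : Bool) → Expansion (Q.rhoPow s)

theorem nonempty_expansions : Nonempty Q.Expansions :=
  ⟨fun s => (nonempty_expansion (Q.rhoPow s)).some⟩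

/-- A choice, for each crossing, of a summand of the copy of `ρ` or `ρ⁻¹` placed there. -/
abbrev State (E : Q.Expansions) (L : LinkDiagram) : Type :=
  (c : L.Crossing) → Fin (E (L.piece c.1).sign).n

open Classical in
/-- The decoration of a crossing line of the crossing in the slice with index `i`, in a given state:
the first tensor factor is on the overcrossing line, the second on the undercrossing line. -/
noncomputable def decoration (E : Q.Expansions) (L : LinkDiagram) (σ : Q.State E L)
    (i : ℕ) (isOver : Bool) : A :=
  if h : ∃ hi : i < L.slices.length, ∃ s x y, L.piece ⟨i, hi⟩ = .crossing s x y then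
    let c : L.Crossing := ⟨⟨i, h.fst⟩, h.snd⟩
    if isOver then Q.overTwist (L.piece c.1) ((E (L.piece c.1).sign).fst (σ c))
    else Q.underTwist (L.piece c.1) ((E (L.piece c.1).sign).snd (σ c))
  else 1

/-- The product of the beads `t_d ^ u_d (t_u ^ u_u (x))`, where `x` runs over the decorations of the
crossing lines in the order encountered, and `u_d`, `u_u` count the extrema met after that line. -/
noncomputable def word (x : ℕ → Bool → A) : List Event → A
  | [] => 1
  | .line i isOver :: es =>
      (Q.td ^ countD es) ((Q.tu ^ countU es) (x i isOver)) * word x es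
  | .vertical :: es => word x es
  | .uPlus :: es => word x es
  | .uMinus :: es => word x es
  | .dPlus :: es => word x es
  | .dMinus :: es => word x es

/-- `tr (G ^ d₁ w(L₁)) ⋯ tr (G ^ dᵣ w(Lᵣ))`, calculated with the starting points `P` and the
expansions `E` of `ρ` and `ρ⁻¹`. The sum over all states is the substitution of the copies of `ρ`
and `ρ⁻¹` into the formal tensor `W(L₁) ⊗ ⋯ ⊗ W(Lᵣ)`. -/
noncomputable def beadSum (tr : A →ₗ[k] k) (L : LinkDiagram) (P : L.StartingPoints)
    (E : Q.Expansions) : k :=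
  ∑ σ : Q.State E L, ∏ c : L.Component,
    tr (((Q.G ^ L.whitneyDegree (P.1 c) : Aˣ) : A) *
      Q.word (Q.decoration E L σ) (L.traversal (P.1 c)))

/-- The function `Inv_{A, tr}` on oriented link diagrams, calculated with some starting points and
some expansions. -/
noncomputable def Inv (tr : A →ₗ[k] k) (L : LinkDiagram) : k :=
  Q.beadSum tr L L.nonempty_startingPoints.some Q.nonempty_expansions.some

end TwistOrientedQuantumAlgebra

/-! Reduction to local data. Every extremum turns a strand from up to down or back, and `countU -
countD` records these turns. Put ε(up) = 1 and ε(down) = 0. If a crossing line has direction x and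
the traversal ends with direction y, then the exponents attached to that line satisfy u_u - u_d =
ε(y) - ε(x). Since t_d and t_u commute and t_d t_u is conjugation with G, t_d^ε(y) t_d^u_d t_u^u_u
(a) = G^u_u t_d^ε(x)(a) G^(-u_u). Along a component the powers of G telescope (`word_cons`). Up to
one application of t_d, which fixes G and is invisible to the trace, G^d w becomes the plain
product, in the order of travel, of the beads t_d^ε(x)(a) on the crossing lines, G on the extrema
u₋, G⁻¹ on u₊ and 1 on d₊ and d₋. The prefix G^d is the right one because countU = countD around a
closed component. The beads at a crossing now expand a tensor that involves ρ and G only, and the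
invariant is a sum of products of traces of cyclic words (`beadSum_eq_diagramValue`). Starting
points drop out because the trace is cyclic. Expansions drop out because the value is linear in the
tensor of each crossing (`diagramValue_expansions`). Part b) follows because A and A_s share ρ and
G.

Regular isotopy. A diagram is a stack of slabs, and its components are the cycles of a permutation
of the places where strands enter slabs. A permutation and its first return map to a set that meets
every cycle have the same cycles and, with accumulated labels, the same words
(`cycleProd_firstReturn`). Hence a portion without closed components may be merged into one slab
that remembers only which ends are joined and the products of the beads (`slabValue_merge`). The two
sides of a local move merge into slabs with the same connections, and the value of the diagram is a
linear form in the tensor of their beads. What remains is one tensor identity for each move. For the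
second Reidemeister move this is invertibility in A ⊗ A for parallel strands and in A ⊗ Aᵒᵖ for
antiparallel ones. For lines sliding past an extremum it is the commutation of G with conjugation.
For the third Reidemeister move it is the Yang--Baxter equation: a strand directed down multiplies
in the opposite algebra, and each of the eight orientations is obtained by carrying factors to the
other side as inverses (`BraidTensor.braid`). The other kind of crossing is covered by the symmetry
that exchanges the two tensor factors and inverts ρ (`BraidTensor.symm`). -/

/-! ### Products over the cycles of a map -/

section Cycles

open Function

variable {X Y α β A K : Type*}

/-- The points `x` and `y` lie on the same cycle of `f`, where `e` gives the coordinates. -/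
def cycleSetoid (e : X → α) (f : α → α) : Setoid X :=
  Relation.EqvGen.setoid fun x y => f (e x) = e y

/-- The product of the labels of the first `n` points of the trajectory of `x`. -/
def segmentWord [Monoid A] (f : α → α) (lab : α → A) (x : α) (n : ℕ) : A :=
  ((List.range n).map fun i => lab (f^[i] x)).prod

/-- The product of the labels along the cycle of `x`. -/
noncomputable def cycleWord [Monoid A] (f : α → α) (lab : α → A) (x : α) : A :=
  segmentWord f lab x (minimalPeriod f x)

/-- The product, over all cycles of `f`, of the values of `T` at the words of the cycles. -/
noncomputable def cycleProd [Monoid A] [CommMonoid K] (T : A → K) (e : X → α) (f : α → α)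
    (lab : α → A) : K :=
  ∏ᶠ c : Quotient (cycleSetoid e f), T (cycleWord f lab (e c.out))

/-- The map `f` permutes the finitely many points with coordinates `e`. -/
structure Permutes (e : X → α) (f : α → α) : Prop where
  finite : Finite X
  inj : Injective e
  maps : ∀ x, ∃ y, f (e x) = e y
  inj_map : ∀ x y, f (e x) = f (e y) → x = y

theorem segmentWord_zero [Monoid A] (f : α → α) (lab : α → A) (x : α) :
    segmentWord f lab x 0 = 1 := by
  simp [segmentWord]

theorem segmentWord_succ [Monoid A] (f : α → α) (lab : α → A) (x : α) (n : ℕ) :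
    segmentWord f lab x (n + 1) = segmentWord f lab x n * lab (f^[n] x) := by
  simp [segmentWord, List.range_succ]

theorem segmentWord_add [Monoid A] (f : α → α) (lab : α → A) (x : α) (n m : ℕ) :
    segmentWord f lab x (n + m) = segmentWord f lab x n * segmentWord f lab (f^[n] x) m := by
  induction m with
  | zero => simp [segmentWord_zero]
  | succ m ih =>
    rw [← add_assoc, segmentWord_succ, ih, segmentWord_succ, mul_assoc, ← iterate_add_apply,
      add_comm m n]

theorem segmentWord_one [Monoid A] (f : α → α) (lab : α → A) (x : α) :
    segmentWord f lab x 1 = lab x := by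
  simp [segmentWord]

theorem segmentWord_succ' [Monoid A] (f : α → α) (lab : α → A) (x : α) (n : ℕ) :
    segmentWord f lab x (n + 1) = lab x * segmentWord f lab (f x) n := by
  rw [add_comm, segmentWord_add, segmentWord_one, iterate_one]

theorem segmentWord_congr [Monoid A] {f : α → α} {lab lab' : α → A} {x : α} {n : ℕ}
    (h : ∀ i < n, lab (f^[i] x) = lab' (f^[i] x)) :
    segmentWord f lab x n = segmentWord f lab' x n := by
  unfold segmentWord
  congr 1
  apply List.map_congr_left
  intro i hi
  exact h i (List.mem_range.1 hi)

namespace Permutes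

variable {e : X → α} {f : α → α}

theorem exists_iterate (h : Permutes e f) (x : X) (n : ℕ) : ∃ y, f^[n] (e x) = e y := by
  induction n with
  | zero => exact ⟨x, rfl⟩
  | succ n ih =>
    obtain ⟨y, hy⟩ := ih
    rw [iterate_succ_apply', hy]
    exact h.maps y

/-- In coordinates `f` is an injective self-map of a finite set, and all points of such a map are
periodic. -/
theorem mem_periodicPts (h : Permutes e f) (x : X) : e x ∈ periodicPts f := by
  choose g hg using h.maps
  have hi : Injective g := fun x y hxy => h.inj_map x y (by rw [hg, hg, hxy])
  have := h.finite
  obtain ⟨n, hn, hp⟩ := Function.mem_periodicPts.1 (hi.mem_periodicPts x)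
  refine Function.mem_periodicPts.2 ⟨n, hn, ?_⟩
  have : ∀ m y, f^[m] (e y) = e (g^[m] y) := by
    intro m
    induction m with
    | zero => intro y; rfl
    | succ m ih => intro y; rw [iterate_succ_apply, hg, ih, iterate_succ_apply]
  rw [IsPeriodicPt, IsFixedPt, this, hp]

theorem minimalPeriod_pos (h : Permutes e f) (x : X) : 0 < minimalPeriod f (e x) :=
  minimalPeriod_pos_of_mem_periodicPts (h.mem_periodicPts x)

theorem exists_iterate_eq (h : Permutes e f) {x y : X} {n : ℕ} (hn : f^[n] (e x) = e y) :
    ∃ m, f^[m] (e y) = e x := by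
  have hp := h.minimalPeriod_pos x
  -- Together with the `n` steps already made this is a multiple of the period.
  refine ⟨(minimalPeriod f (e x) * n - n), ?_⟩
  rw [← hn, ← iterate_add_apply, Nat.sub_add_cancel (Nat.le_mul_of_pos_left n hp)]
  exact (isPeriodicPt_minimalPeriod f (e x)).mul_const n

/-- By periodicity a backward step is a number of forward steps, so the symmetric closure adds
nothing to forward reachability. -/
theorem rel_iff (h : Permutes e f) {x y : X} :
    (cycleSetoid e f).r x y ↔ ∃ n, f^[n] (e x) = e y := by
  constructor
  · intro hxy
    induction hxy with
    | rel x y hxy => exact ⟨1, hxy⟩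
    | refl x => exact ⟨0, rfl⟩
    | symm x y _ ih => exact h.exists_iterate_eq ih.choose_spec
    | trans x y z _ _ ih1 ih2 =>
      obtain ⟨n, hn⟩ := ih1
      obtain ⟨m, hm⟩ := ih2
      exact ⟨m + n, by rw [iterate_add_apply, hn, hm]⟩
  · rintro ⟨n, hn⟩
    induction n generalizing x with
    | zero => rw [h.inj hn]
    | succ n ih =>
      obtain ⟨z, hz⟩ := h.maps x
      rw [iterate_succ_apply, hz] at hn
      exact .trans _ z _ (.rel _ _ hz) (ih hn)

/-- Advancing the starting point by one step carries the first letter of the word to its end, which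
`T` does not notice. This is the source of the independence of the starting points. -/
theorem trace_cycleWord_apply [Monoid A] {T : A → K} (hT : ∀ a b, T (a * b) = T (b * a))
    (h : Permutes e f) (lab : α → A) (x : X) :
    T (cycleWord f lab (f (e x))) = T (cycleWord f lab (e x)) := by
  unfold cycleWord
  rw [minimalPeriod_apply (h.mem_periodicPts x)]
  obtain ⟨m, hm⟩ := Nat.exists_eq_succ_of_ne_zero (h.minimalPeriod_pos x).ne'
  have hp : f^[minimalPeriod f (e x)] (e x) = e x := iterate_minimalPeriod
  rw [hm] at hp ⊢
  rw [Nat.succ_eq_add_one, segmentWord_succ' f lab (e x), segmentWord_succ, hT,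
    ← iterate_succ_apply, hp]

theorem trace_cycleWord_of_rel [Monoid A] {T : A → K} (hT : ∀ a b, T (a * b) = T (b * a))
    (h : Permutes e f) (lab : α → A) {x y : X} (hxy : (cycleSetoid e f).r x y) :
    T (cycleWord f lab (e x)) = T (cycleWord f lab (e y)) := by
  induction hxy with
  | rel x y hxy => rw [← hxy, h.trace_cycleWord_apply hT]
  | refl x => rfl
  | symm x y _ ih => exact ih.symm
  | trans x y z _ _ ih1 ih2 => exact ih1.trans ih2

theorem trace_cycleWord_out [Monoid A] {T : A → K} (hT : ∀ a b, T (a * b) = T (b * a))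
    (h : Permutes e f) (lab : α → A) (x : X) :
    T (cycleWord f lab (e (Quotient.mk (cycleSetoid e f) x).out)) = T (cycleWord f lab (e x)) :=
  h.trace_cycleWord_of_rel hT lab (Quotient.exact (Quotient.out_eq _))

end Permutes

/-- From the point `x`, the map `f` leads in `n` steps back to the set `R`, for the first time. -/
structure FirstReturn [Monoid A] (f : α → α) (lab : α → A) (R : Set α) (x : α) (n : ℕ) (w : A)
    (y : α) : Prop where
  pos : 0 < n
  iterate_eq : f^[n] x = y
  notMem : ∀ i, 0 < i → i < n → f^[i] x ∉ R
  word : segmentWord f lab x n = w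

theorem FirstReturn.single [Monoid A] {f : α → α} {lab : α → A} {R : Set α} {x y : α}
    (h : f x = y) : FirstReturn f lab R x 1 (lab x) y :=
  ⟨one_pos, h, fun i h0 h1 => by omega, segmentWord_one _ _ _⟩

theorem FirstReturn.cons [Monoid A] {f : α → α} {lab : α → A} {R : Set α} {x y z : α} {n : ℕ}
    {w : A} (h : f x = z) (hz : z ∉ R) (hn : FirstReturn f lab R z n w y) :
    FirstReturn f lab R x (n + 1) (lab x * w) y := by
  refine ⟨n.succ_pos, by rw [iterate_succ_apply, h, hn.iterate_eq], fun i h0 h1 => ?_,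
    by rw [segmentWord_succ', h, hn.word]⟩
  obtain ⟨i, rfl⟩ := Nat.exists_eq_succ_of_ne_zero h0.ne'
  rw [iterate_succ_apply, h]
  rcases Nat.eq_zero_or_pos i with rfl | hi
  · exact hz
  · exact hn.notMem i hi (by omega)

/-- Here `g` is the first return map of `f` to the image of `ι`, and its labels accumulate the
labels of `f` along each excursion. As every cycle of `f` meets this image, passing to `g` loses no
cycle and only groups the letters of the words. All simplifications of a diagram are instances of
this lemma. -/
theorem cycleProd_firstReturn [Monoid A] [CommMonoid K] {T : A → K}
    (hT : ∀ a b, T (a * b) = T (b * a)) {e : X → α} {f : α → α} {lab : α → A}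
    (hX : Permutes e f) {d : Y → β} {g : β → β} {lab' : β → A} (hY : Permutes d g)
    (ι : Y → X) (hι : Injective ι)
    (hret : ∀ y z, g (d y) = d z →
      ∃ n, FirstReturn f lab (Set.range (e ∘ ι)) (e (ι y)) n (lab' (d y)) (e (ι z)))
    (hmeet : ∀ x, ∃ n y, f^[n] (e x) = e (ι y)) :
    cycleProd T e f lab = cycleProd T d g lab' := by
  choose s hs using hY.maps
  have hret' : ∀ y, ∃ n,
      FirstReturn f lab (Set.range (e ∘ ι)) (e (ι y)) n (lab' (d y)) (e (ι (s y))) :=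
    fun y => hret y (s y) (hs y)
  choose n hn using hret'
  have hd : ∀ m y, g^[m] (d y) = d (s^[m] y) := by
    intro m
    induction m with
    | zero => intro y; rfl
    | succ m ih => intro y; rw [iterate_succ_apply, hs, ih, iterate_succ_apply]
  -- `N y m` is the time at which the trajectory of `y` comes back for the `m`-th time.
  let N : Y → ℕ → ℕ := fun y m => ∑ i ∈ Finset.range m, n (s^[i] y)
  have hN : ∀ y m, N y (m + 1) = N y m + n (s^[m] y) := fun y m => Finset.sum_range_succ _ _
  have hiter : ∀ y m, f^[N y m] (e (ι y)) = e (ι (s^[m] y)) := by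
    intro y m
    induction m with
    | zero => rfl
    | succ m ih =>
      rw [hN, add_comm, iterate_add_apply, ih, (hn _).iterate_eq, iterate_succ_apply']
  have hword : ∀ y m, segmentWord f lab (e (ι y)) (N y m) = segmentWord g lab' (d y) m := by
    intro y m
    induction m with
    | zero => simp [N, segmentWord_zero]
    | succ m ih => rw [hN, segmentWord_add, hiter, (hn _).word, ih, segmentWord_succ, hd]
  -- the times of return
  have htimes : ∀ t y z, f^[t] (e (ι y)) = e (ι z) → ∃ m, t = N y m := by
    intro t
    induction t using Nat.strong_induction_on with
    | _ t ih =>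
      intro y z h
      rcases Nat.eq_zero_or_pos t with rfl | ht
      · exact ⟨0, rfl⟩
      · have hle : n y ≤ t := by
          by_contra hlt
          exact (hn y).notMem t ht (not_le.1 hlt) ⟨z, h.symm⟩
        have hpos := (hn y).pos
        obtain ⟨m, hm⟩ := ih (t - n y) (by omega) (s y) z (by
          rw [← (hn y).iterate_eq, ← iterate_add_apply, Nat.sub_add_cancel hle, h])
        refine ⟨m + 1, ?_⟩
        have : N y (m + 1) = N (s y) m + n y := by
          simp only [N, Finset.sum_range_succ']
          rfl
        omega
  have hmono : ∀ y, StrictMono (N y) := fun y => strictMono_nat_of_lt_succ fun m => by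
    rw [hN]; have := (hn (s^[m] y)).pos; omega
  -- One bound holds because a period of `g` yields a period of `f`; the other because a period of
  -- `f` is itself a time of return.
  have hperiod : ∀ y, minimalPeriod f (e (ι y)) = N y (minimalPeriod g (d y)) := by
    intro y
    apply le_antisymm
    · apply IsPeriodicPt.minimalPeriod_le
      · exact (hmono y) (hY.minimalPeriod_pos y)
      · rw [IsPeriodicPt, IsFixedPt, hiter]
        congr 2
        apply hY.inj
        rw [← hd, iterate_minimalPeriod]
    · obtain ⟨m, hm⟩ := htimes _ y y (iterate_minimalPeriod (f := f) (x := e (ι y)))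
      rw [hm]
      apply (hmono y).monotone
      apply IsPeriodicPt.minimalPeriod_le
      · rcases Nat.eq_zero_or_pos m with rfl | h
        · exact absurd hm (hX.minimalPeriod_pos _).ne'
        · exact h
      · rw [IsPeriodicPt, IsFixedPt, hd]
        have h1 := hiter y m
        rw [← hm, iterate_minimalPeriod] at h1
        rw [← hι (hX.inj h1)]
  have hcycle : ∀ y, cycleWord f lab (e (ι y)) = cycleWord g lab' (d y) := fun y => by
    rw [cycleWord, cycleWord, hperiod, hword]
  have hrel : ∀ y z, (cycleSetoid d g).r y z ↔ (cycleSetoid e f).r (ι y) (ι z) := by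
    intro y z
    rw [hX.rel_iff, hY.rel_iff]
    constructor
    · rintro ⟨m, hm⟩
      rw [hd] at hm
      exact ⟨N y m, by rw [hiter, hY.inj hm]⟩
    · rintro ⟨t, ht⟩
      obtain ⟨m, rfl⟩ := htimes t y z ht
      rw [hiter] at ht
      exact ⟨m, by rw [hd, hι (hX.inj ht)]⟩
  symm
  refine finprod_eq_of_bijective
    (Quotient.map' (s₁ := cycleSetoid d g) (s₂ := cycleSetoid e f) ι
      fun y z h => (hrel y z).1 h) ⟨?_, ?_⟩ ?_
  · intro c c'
    induction c using Quotient.inductionOn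
    induction c' using Quotient.inductionOn
    intro h
    exact Quotient.sound ((hrel _ _).2 (Quotient.exact h))
  · intro c
    induction c using Quotient.inductionOn with
    | h x =>
      obtain ⟨m, y, hm⟩ := hmeet x
      exact ⟨Quotient.mk _ y, Quotient.sound ((cycleSetoid e f).iseqv.symm (hX.rel_iff.2 ⟨m, hm⟩))⟩
  · intro c
    induction c using Quotient.inductionOn with
    | h y =>
      rw [hY.trace_cycleWord_out hT]
      change _ = T (cycleWord f lab (e (Quotient.mk (cycleSetoid e f) (ι y)).out))
      rw [hX.trace_cycleWord_out hT, hcycle]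

/-- The product over the cycles does not change under a bijection that respects the maps and the
labels. -/
theorem cycleProd_congr [Monoid A] [CommMonoid K] {T : A → K}
    (hT : ∀ a b, T (a * b) = T (b * a)) {e : X → α} {f : α → α} {lab : α → A}
    (hX : Permutes e f) {d : Y → β} {g : β → β} {lab' : β → A} (hY : Permutes d g)
    (ι : Y → X) (hι : Bijective ι) (hmap : ∀ y z, g (d y) = d z → f (e (ι y)) = e (ι z))
    (hlab : ∀ y, lab (e (ι y)) = lab' (d y)) :
    cycleProd T e f lab = cycleProd T d g lab' := by
  refine cycleProd_firstReturn hT hX hY ι hι.1 (fun y z h => ⟨1, ?_⟩) fun x => ?_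
  · rw [← hlab]
    exact .single (hmap y z h)
  · obtain ⟨y, rfl⟩ := hι.2 x
    exact ⟨0, y, rfl⟩

end Cycles

/-! ### Linearity of the cycle product in one label -/

section Linear

open Function

variable {X α A K : Type*} [CommRing K] [Ring A] [Algebra K A]

/-- The product over the cycles is linear in each label. -/
theorem exists_linear_cycleProd (T : A →ₗ[K] K) (hT : ∀ a b, T (a * b) = T (b * a)) {e : X → α}
    {f : α → α} (hX : Permutes e f) (x : X) (lab : α → A) :
    ∃ B : A →ₗ[K] K, ∀ lab' : α → A, (∀ y, y ≠ x → lab' (e y) = lab (e y)) →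
      cycleProd T e f lab' = B (lab' (e x)) := by
  classical
  have hfin := hX.finite
  let _ : Fintype (Quotient (cycleSetoid e f)) := Fintype.ofFinite _
  let c₀ := Quotient.mk (cycleSetoid e f) x
  obtain ⟨m, hm⟩ := Nat.exists_eq_succ_of_ne_zero (hX.minimalPeriod_pos x).ne'
  -- Within one minimal period `x` occurs only once, so its cycle word is its own label times a word
  -- `w` that does not involve this label. No other cycle involves it either.
  let w := segmentWord f lab (f (e x)) m
  let P := ∏ c ∈ Finset.univ.erase c₀, T (cycleWord f lab (e c.out))
  refine ⟨P • (T ∘ₗ LinearMap.mulRight K w), fun lab' h => ?_⟩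
  rw [cycleProd, finprod_eq_prod_of_fintype, ← Finset.mul_prod_erase _ _ (Finset.mem_univ c₀),
    hX.trace_cycleWord_out hT, mul_comm]
  have h1 : cycleWord f lab' (e x) = lab' (e x) * w := by
    rw [cycleWord, hm, Nat.succ_eq_add_one, segmentWord_succ']
    congr 1
    apply segmentWord_congr
    intro i hi
    rw [← iterate_succ_apply]
    obtain ⟨y, hy⟩ := hX.exists_iterate x (i + 1)
    rw [Nat.succ_eq_add_one, hy]
    apply h
    rintro rfl
    exact not_isPeriodicPt_of_pos_of_lt_minimalPeriod (Nat.succ_ne_zero i) (by omega) hy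
  have h2 : ∏ c ∈ Finset.univ.erase c₀, T (cycleWord f lab' (e c.out)) = P := by
    refine Finset.prod_congr rfl fun c hc => ?_
    rw [cycleWord, segmentWord_congr (lab' := lab) (fun i _ => ?_), ← cycleWord]
    obtain ⟨y, hy⟩ := hX.exists_iterate c.out i
    rw [hy]
    apply h
    rintro rfl
    apply Finset.ne_of_mem_erase hc
    rw [← Quotient.out_eq c]
    exact Quotient.sound (hX.rel_iff.2 ⟨i, hy⟩)
  rw [h1, h2]
  rfl

end Linear

/-! ### Slabs -/

/-- The direction of a strand that enters a slab through its top (`true`) or bottom (`false`). -/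
def Dir.into : Bool → Dir
  | true => .down
  | false => .up

/-- A horizontal slab of a diagram with beads. A strand is specified by the place `(top, j)` where
it enters; `pass` is the place where it leaves, and `bead` the product of the beads on it. -/
structure Slab (A : Type*) where
  dom : List Dir
  cod : List Dir
  pass : Bool × ℕ → Bool × ℕ
  bead : Bool × ℕ → A

namespace Slab

variable {A : Type*}

/-- The directions of the strands along the top or the bottom. -/
def side (x : Slab A) (t : Bool) : List Dir := if t then x.cod else x.dom

@[simp] theorem side_true (x : Slab A) : x.side true = x.cod := rfl
@[simp] theorem side_false (x : Slab A) : x.side false = x.dom := rfl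

/-- A strand enters the slab at the place `q`. -/
def Enters (x : Slab A) (q : Bool × ℕ) : Prop := (x.side q.1)[q.2]? = some (Dir.into q.1)

/-- A strand leaves the slab at the place `q`. -/
def Leaves (x : Slab A) (q : Bool × ℕ) : Prop := (x.side q.1)[q.2]? = some (Dir.into (!q.1))

/-- Strands that enter the slab leave it, at different places. -/
structure Valid (x : Slab A) : Prop where
  leaves : ∀ q, x.Enters q → x.Leaves (x.pass q)
  inj : ∀ q q', x.Enters q → x.Enters q' → x.pass q = x.pass q' → q = q'

theorem Enters.lt {x : Slab A} {q : Bool × ℕ} (h : x.Enters q) : q.2 < (x.side q.1).length :=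
  (List.getElem?_eq_some_iff.1 h).1

theorem Leaves.lt {x : Slab A} {q : Bool × ℕ} (h : x.Leaves q) : q.2 < (x.side q.1).length :=
  (List.getElem?_eq_some_iff.1 h).1

end Slab

/-- The slabs fit together, starting from the strands `a` at the bottom and ending with the
strands `b` at the top. -/
def SlabsFit {A : Type*} : List Dir → List (Slab A) → List Dir → Prop
  | a, [], b => a = b
  | a, x :: xs, b => a = x.dom ∧ SlabsFit x.cod xs b

namespace SlabsFit

variable {A : Type*}

theorem append {xs ys : List (Slab A)} {a c : List Dir} :
    SlabsFit a (xs ++ ys) c ↔ ∃ b, SlabsFit a xs b ∧ SlabsFit b ys c := by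
  induction xs generalizing a with
  | nil => simp [SlabsFit]
  | cons x xs ih => simp [SlabsFit, ih, and_assoc]

theorem dom_eq {xs : List (Slab A)} {a b : List Dir} (h : SlabsFit a xs b) {x : Slab A}
    (hx : xs[0]? = some x) : x.dom = a := by
  cases xs with
  | nil => simp at hx
  | cons y ys => simp at hx; subst hx; exact h.1.symm

theorem cod_eq_dom {xs : List (Slab A)} {a b : List Dir} (h : SlabsFit a xs b) {i : ℕ}
    {x y : Slab A} (hx : xs[i]? = some x) (hy : xs[i + 1]? = some y) : x.cod = y.dom := by
  induction xs generalizing a i with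
  | nil => simp at hx
  | cons z zs ih =>
    cases i with
    | zero =>
      simp at hx hy
      subst hx
      exact (h.2.dom_eq hy).symm
    | succ i => exact ih h.2 (by simpa using hx) (by simpa using hy)

theorem cod_eq {xs : List (Slab A)} {a b : List Dir} (h : SlabsFit a xs b) {i : ℕ}
    {x : Slab A} (hx : xs[i]? = some x) (hi : i + 1 = xs.length) : x.cod = b := by
  induction xs generalizing a i with
  | nil => simp at hx
  | cons z zs ih =>
    cases i with
    | zero =>
      simp at hx hi
      subst hi hx
      exact h.2
    | succ i => exact ih h.2 (by simpa using hx) (by simpa using hi)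

end SlabsFit

/-- The slabs form a closed diagram. -/
structure SlabsClosed {A : Type*} (xs : List (Slab A)) : Prop where
  fits : SlabsFit [] xs []
  valid : ∀ x ∈ xs, x.Valid

/-- The place where a strand enters the next slab after it has left the slab with index `i` at the
place `q`. -/
def leaveSlab (i : ℕ) (q : Bool × ℕ) : ℕ × Bool × ℕ :=
  (if q.1 then i + 1 else i - 1, !q.1, q.2)

/-! ### The permutation of the entry places of a closed stack -/

section Ports

variable {A : Type*}

/-- The places where strands enter the slabs of a diagram. -/
def Port (xs : List (Slab A)) : Type :=
  {P : ℕ × Bool × ℕ // ∃ x, xs[P.1]? = some x ∧ x.Enters P.2}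

/-- The coordinates of a port. -/
def Port.coords {xs : List (Slab A)} (P : Port xs) : ℕ × Bool × ℕ := P.1

/-- Passing through one slab. -/
def portNext (xs : List (Slab A)) (P : ℕ × Bool × ℕ) : ℕ × Bool × ℕ :=
  match xs[P.1]? with
  | none => P
  | some x => leaveSlab P.1 (x.pass P.2)

/-- The bead met when passing through one slab. -/
def portBead [One A] (xs : List (Slab A)) (P : ℕ × Bool × ℕ) : A :=
  match xs[P.1]? with
  | none => 1
  | some x => x.bead P.2

theorem portNext_eq {xs : List (Slab A)} {i : ℕ} {q : Bool × ℕ} {x : Slab A}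
    (h : xs[i]? = some x) : portNext xs (i, q) = leaveSlab i (x.pass q) := by
  simp [portNext, h]

theorem portBead_eq [One A] {xs : List (Slab A)} {i : ℕ} {q : Bool × ℕ} {x : Slab A}
    (h : xs[i]? = some x) : portBead xs (i, q) = x.bead q := by
  simp [portBead, h]

/-- The product of the values of `T` at the words of the components. -/
noncomputable def slabValue [Monoid A] {K : Type*} [CommMonoid K] (T : A → K)
    (xs : List (Slab A)) : K :=
  cycleProd T (Port.coords (xs := xs)) (portNext xs) (portBead xs)

theorem finite_port (xs : List (Slab A)) : Finite (Port xs) := by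
  let f : Port xs → Σ i : Fin xs.length, (Fin (xs.get i).dom.length ⊕ Fin (xs.get i).cod.length) :=
    fun P =>
      have h : P.1.1 < xs.length := by
        obtain ⟨x, hx, -⟩ := P.2
        exact (List.getElem?_eq_some_iff.1 hx).1
      ⟨⟨P.1.1, h⟩,
        if ht : P.1.2.1 then Sum.inr ⟨P.1.2.2, by
          obtain ⟨x, hx, hq⟩ := P.2
          obtain ⟨_, rfl⟩ := List.getElem?_eq_some_iff.1 hx
          have := hq.lt
          rw [ht] at this
          exact this⟩
        else Sum.inl ⟨P.1.2.2, by
          obtain ⟨x, hx, hq⟩ := P.2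
          obtain ⟨_, rfl⟩ := List.getElem?_eq_some_iff.1 hx
          have := hq.lt
          simp only [Bool.not_eq_true] at ht
          rw [ht] at this
          exact this⟩⟩
  apply Finite.of_injective f
  rintro ⟨⟨i, t, j⟩, h⟩ ⟨⟨i', t', j'⟩, h'⟩ he
  simp only [f, Sigma.mk.injEq, Fin.mk.injEq] at he
  obtain ⟨rfl, he⟩ := he
  cases t <;> cases t' <;> simp at he <;> subst he <;> rfl

/-- Adjacent slabs agree on their common line, so a strand that leaves one slab enters a neighbour.
Since the outermost lines carry no strand, none leaves the stack. -/
theorem SlabsClosed.permutes {xs : List (Slab A)} (h : SlabsClosed xs) :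
    Permutes (Port.coords (xs := xs)) (portNext xs) := by
  refine ⟨finite_port xs, Subtype.val_injective, ?_, ?_⟩
  · rintro ⟨⟨i, q⟩, x, hx, hq⟩
    have hl := (h.valid x (List.mem_of_getElem? hx)).leaves q hq
    change ∃ y : Port xs, portNext xs (i, q) = y.1
    rw [portNext_eq hx]
    rcases hp : x.pass q with ⟨t, j⟩
    rw [hp] at hl
    have hi := (List.getElem?_eq_some_iff.1 hx).1
    cases t with
    | true =>
      have hlt : i + 1 < xs.length := by
        by_contra hlt
        have := h.fits.cod_eq hx (by omega)
        simp [Slab.Leaves, this] at hl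
      refine ⟨⟨(i + 1, false, j), xs[i + 1], by simp [hlt], ?_⟩, by simp [leaveSlab]⟩
      have := h.fits.cod_eq_dom hx (List.getElem?_eq_getElem hlt)
      simpa [Slab.Enters, Slab.Leaves, this] using hl
    | false =>
      obtain ⟨i, rfl⟩ : ∃ i', i = i' + 1 := by
        apply Nat.exists_eq_succ_of_ne_zero
        rintro rfl
        have := h.fits.dom_eq hx
        simp [Slab.Leaves, this] at hl
      have hlt : i < xs.length := by omega
      refine ⟨⟨(i, true, j), xs[i], by simp [hlt], ?_⟩, by simp [leaveSlab]⟩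
      have := h.fits.cod_eq_dom (List.getElem?_eq_getElem hlt) hx
      simpa [Slab.Enters, Slab.Leaves, this] using hl
  · rintro ⟨⟨i, q⟩, x, hx, hq⟩ ⟨⟨i', q'⟩, x', hx', hq'⟩ he
    change portNext xs (i, q) = portNext xs (i', q') at he
    rw [portNext_eq hx, portNext_eq hx'] at he
    have hv := h.valid x (List.mem_of_getElem? hx)
    have hl := hv.leaves q hq
    have hl' := (h.valid x' (List.mem_of_getElem? hx')).leaves q' hq'
    simp only [leaveSlab, Prod.mk.injEq, Bool.not_eq_eq_eq_not, Bool.not_not] at he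
    obtain ⟨hi, ht, hj⟩ := he
    have hpass : x.pass q = x'.pass q' := Prod.ext ht hj
    have hii : i = i' := by
      rw [hpass] at hi
      rcases hp : x'.pass q' with ⟨t, j⟩
      rw [hp] at hi hl'
      rw [hpass, hp] at hl
      cases t with
      | true => simpa using hi
      | false =>
        -- The truncated `i - 1` does not separate the indices 0 and 1, so it must be known that
        -- nothing leaves the lowest slab downwards.
        have h0 : i ≠ 0 := by
          rintro rfl
          have := h.fits.dom_eq hx
          simp [Slab.Leaves, this] at hl
        have h0' : i' ≠ 0 := by
          rintro rfl
          have := h.fits.dom_eq hx'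
          simp [Slab.Leaves, this] at hl'
        simp at hi
        omega
    subst hii
    obtain rfl : x = x' := by simpa [hx] using hx'
    obtain rfl := hv.inj q q' hq hq' hpass
    rfl

end Ports

/-- A strand that enters the slab of index `i` of the stack `M` at the place `q` leaves the stack at
the place `e`, the product of the beads on the way being `w`. -/
inductive Transit {A : Type*} [Monoid A] (M : List (Slab A)) :
    ℕ → Bool × ℕ → A → Bool × ℕ → Prop
  | last {i x q j} : M[i]? = some x → x.pass q = (true, j) → i + 1 = M.length →
      Transit M i q (x.bead q) (true, j)
  | first {x q j} : M[0]? = some x → x.pass q = (false, j) → Transit M 0 q (x.bead q) (false, j)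
  | up {i x q j w e} : M[i]? = some x → x.pass q = (true, j) → i + 1 < M.length →
      Transit M (i + 1) (false, j) w e → Transit M i q (x.bead q * w) e
  | down {i x q j w e} : M[i + 1]? = some x → x.pass q = (false, j) →
      Transit M i (true, j) w e → Transit M (i + 1) q (x.bead q * w) e

/-- The slab `N` results when the slabs of the stack `M`, which has no closed components, are merged
into one. -/
structure Slab.Represents {A : Type*} [Monoid A] (N : Slab A) (M : List (Slab A)) : Prop where
  ne_nil : M ≠ []
  fits : SlabsFit N.dom M N.cod
  valid : ∀ x ∈ M, x.Valid
  bottom : ∀ j, N.Enters (false, j) → Transit M 0 (false, j) (N.bead (false, j)) (N.pass (false, j))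
  top : ∀ j, N.Enters (true, j) →
    Transit M (M.length - 1) (true, j) (N.bead (true, j)) (N.pass (true, j))
  exits : ∀ i x q, M[i]? = some x → x.Enters q → ∃ w e, Transit M i q w e

/-! ### Merging a stack of slabs into one slab -/

section Merge

variable {A : Type*}

theorem getElem?_stack_left {b M a : List (Slab A)} {i : ℕ} (h : i < b.length) :
    (b ++ M ++ a)[i]? = b[i]? := by
  rw [List.append_assoc, List.getElem?_append_left h]

theorem getElem?_stack_mid {b M a : List (Slab A)} {i : ℕ} (h : i < M.length) :
    (b ++ M ++ a)[b.length + i]? = M[i]? := by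
  rw [List.append_assoc, List.getElem?_append_right (by omega), Nat.add_sub_cancel_left,
    List.getElem?_append_left h]

theorem getElem?_stack_right {b M a : List (Slab A)} {i : ℕ} :
    (b ++ M ++ a)[b.length + M.length + i]? = a[i]? := by
  rw [List.getElem?_append_right (by simp), List.length_append, Nat.add_sub_cancel_left]

/-- The place where a strand enters the diagram `b ++ a` or `b ++ M ++ a` after it has left the stack
`M` at the place `q`. -/
def leaveStack (m p : ℕ) (q : Bool × ℕ) : ℕ × Bool × ℕ :=
  (if q.1 then m + p else m - 1, !q.1, q.2)

/-- The hypotheses `hup` and `hdown` keep the interior lines of the stack out of `R`, so a transit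
through the stack is a single excursion from `R`. -/
theorem Transit.firstReturn [Monoid A] {b M a : List (Slab A)} {R : Set (ℕ × Bool × ℕ)}
    (hup : ∀ i j, 0 < i → i < M.length → (b.length + i, false, j) ∉ R)
    (hdown : ∀ i j, i + 1 < M.length → (b.length + i, true, j) ∉ R)
    {i : ℕ} {q e : Bool × ℕ} {w : A} (h : Transit M i q w e) :
    ∃ n, FirstReturn (portNext (b ++ M ++ a)) (portBead (b ++ M ++ a)) R (b.length + i, q) n w
      (leaveStack b.length M.length e) := by
  have hget : ∀ {i x}, M[i]? = some x → (b ++ M ++ a)[b.length + i]? = some x := fun {i x} hx => by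
    rw [getElem?_stack_mid (List.getElem?_eq_some_iff.1 hx).1, hx]
  induction h with
  | last hx hp hi =>
    refine ⟨1, ?_⟩
    rw [← portBead_eq (hget hx)]
    apply FirstReturn.single
    rw [portNext_eq (hget hx), hp]
    simp [leaveSlab, leaveStack]
    omega
  | first hx hp =>
    refine ⟨1, ?_⟩
    rw [← portBead_eq (hget hx)]
    apply FirstReturn.single
    rw [portNext_eq (hget hx), hp]
    simp [leaveSlab, leaveStack]
  | up hx hp hi _ ih =>
    obtain ⟨n, hn⟩ := ih
    refine ⟨n + 1, ?_⟩
    rw [← portBead_eq (hget hx)]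
    refine FirstReturn.cons ?_ (hup _ _ (Nat.succ_pos _) hi) hn
    rw [portNext_eq (hget hx), hp]
    simp [leaveSlab]
    omega
  | @down i x q j w e hx hp _ ih =>
    obtain ⟨n, hn⟩ := ih
    refine ⟨n + 1, ?_⟩
    rw [← portBead_eq (hget hx)]
    refine FirstReturn.cons ?_ (hdown i j (List.getElem?_eq_some_iff.1 hx).1) hn
    rw [portNext_eq (hget hx), hp]
    simp [leaveSlab]

/-- The first and the last slab determine the two boundaries, whereas an empty stack fits between
any two equal ones. -/
theorem SlabsFit.eq_of_ne_nil {M : List (Slab A)} (hM : M ≠ []) {c d c' d' : List Dir}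
    (h : SlabsFit c M d) (h' : SlabsFit c' M d') : c = c' ∧ d = d' := by
  obtain ⟨x, xs, rfl⟩ := List.exists_cons_of_ne_nil hM
  refine ⟨h.1.trans h'.1.symm, ?_⟩
  have hy : (x :: xs)[xs.length]? = some ((x :: xs)[xs.length]) := by simp
  rw [← h.cod_eq hy (by simp), ← h'.cod_eq hy (by simp)]

theorem SlabsClosed.replace {b M M' a : List (Slab A)} {c d : List Dir}
    (h : SlabsClosed (b ++ M ++ a)) (hM : M ≠ []) (hf : SlabsFit c M d)
    (hf' : SlabsFit c M' d) (hv' : ∀ x ∈ M', x.Valid) : SlabsClosed (b ++ M' ++ a) := by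
  obtain ⟨hfit, hv⟩ := h
  rw [List.append_assoc, SlabsFit.append] at hfit
  obtain ⟨c', hb, hfit⟩ := hfit
  rw [SlabsFit.append] at hfit
  obtain ⟨d', hM', ha⟩ := hfit
  obtain ⟨rfl, rfl⟩ := hf.eq_of_ne_nil hM hM'
  refine ⟨?_, ?_⟩
  · rw [List.append_assoc, SlabsFit.append]
    exact ⟨c, hb, SlabsFit.append.2 ⟨d, hf', ha⟩⟩
  · intro x hx
    simp only [List.mem_append] at hx hv
    rcases hx with (hx | hx) | hx
    · exact hv x (.inl (.inl hx))
    · exact hv' x hx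
    · exact hv x (.inr hx)

theorem Transit.leaves [Monoid A] {M : List (Slab A)} {c d : List Dir} (hf : SlabsFit c M d)
    (hv : ∀ x ∈ M, x.Valid) {i : ℕ} {q e : Bool × ℕ} {w : A} (h : Transit M i q w e)
    (hq : ∀ x, M[i]? = some x → x.Enters q) :
    (if e.1 then d else c)[e.2]? = some (Dir.into (!e.1)) := by
  induction h with
  | last hx hp hi =>
    have := (hv _ (List.mem_of_getElem? hx)).leaves _ (hq _ hx)
    rw [hp] at this
    simpa [Slab.Leaves, hf.cod_eq hx hi] using this
  | first hx hp =>
    have := (hv _ (List.mem_of_getElem? hx)).leaves _ (hq _ hx)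
    rw [hp] at this
    simpa [Slab.Leaves, hf.dom_eq hx] using this
  | up hx hp hi _ ih =>
    refine ih fun y hy => ?_
    have := (hv _ (List.mem_of_getElem? hx)).leaves _ (hq _ hx)
    rw [hp] at this
    simpa [Slab.Leaves, Slab.Enters, hf.cod_eq_dom hx hy] using this
  | down hx hp _ ih =>
    refine ih fun y hy => ?_
    have := (hv _ (List.mem_of_getElem? hx)).leaves _ (hq _ hx)
    rw [hp] at this
    simpa [Slab.Leaves, Slab.Enters, hf.cod_eq_dom hy hx] using this

/-- The place in `b ++ M ++ a` that corresponds to a place in `b ++ [N] ++ a`, where `m` and `p` are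
the lengths of `b` and `M`. -/
def unmerge (m p : ℕ) (P : ℕ × Bool × ℕ) : ℕ × Bool × ℕ :=
  (if P.1 < m then P.1 else if P.1 = m then (if P.2.1 then m + p - 1 else m) else P.1 + p - 1, P.2)

theorem unmerge_of_lt {m p i : ℕ} {q : Bool × ℕ} (h : i < m) : unmerge m p (i, q) = (i, q) := by
  simp [unmerge, h]

theorem unmerge_true {m p j : ℕ} : unmerge m p (m, true, j) = (m + p - 1, true, j) := by
  simp [unmerge]

theorem unmerge_false {m p j : ℕ} : unmerge m p (m, false, j) = (m, false, j) := by
  simp [unmerge]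

theorem unmerge_add {m p t : ℕ} {q : Bool × ℕ} :
    unmerge m p (m + 1 + t, q) = (m + p + t, q) := by
  simp only [unmerge, if_neg (show ¬ m + 1 + t < m by omega),
    if_neg (show ¬ m + 1 + t = m by omega)]
  congr 1
  omega

theorem unmerge_cases (m p : ℕ) (P : ℕ × Bool × ℕ) :
    (P.1 < m ∧ unmerge m p P = P) ∨
      (∃ j, P = (m, true, j) ∧ unmerge m p P = (m + p - 1, true, j)) ∨
      (∃ j, P = (m, false, j) ∧ unmerge m p P = (m, false, j)) ∨
      ∃ t q, P = (m + 1 + t, q) ∧ unmerge m p P = (m + p + t, q) := by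
  obtain ⟨i, q⟩ := P
  rcases lt_trichotomy i m with hi | rfl | hi
  · exact .inl ⟨hi, unmerge_of_lt hi⟩
  · obtain ⟨t, j⟩ := q
    cases t with
    | true => exact .inr (.inl ⟨j, rfl, unmerge_true⟩)
    | false => exact .inr (.inr (.inl ⟨j, rfl, unmerge_false⟩))
  · obtain ⟨t, rfl⟩ : ∃ t, i = m + 1 + t := ⟨i - m - 1, by omega⟩
    exact .inr (.inr (.inr ⟨t, q, rfl, unmerge_add⟩))

/-- With `p = 0` an entry through the top of the merged slab would collide with a place outside the
stack. -/
theorem unmerge_injective {m p : ℕ} (hp : 0 < p) : Function.Injective (unmerge m p) := by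
  intro P Q h
  rcases unmerge_cases m p P with ⟨h1, h2⟩ | ⟨j, rfl, h2⟩ | ⟨j, rfl, h2⟩ | ⟨t, q, rfl, h2⟩ <;>
  rcases unmerge_cases m p Q with ⟨h3, h4⟩ | ⟨j', rfl, h4⟩ | ⟨j', rfl, h4⟩ | ⟨t', q', rfl, h4⟩ <;>
  rw [h2, h4] at h <;> simp only [Prod.ext_iff] at h ⊢ <;> grind

theorem SlabsClosed.bottom_ne_nil {b M a : List (Slab A)} (h : SlabsClosed (b ++ M ++ a))
    {c d : List Dir} (hf : SlabsFit c M d) (hM : M ≠ []) (hc : c ≠ []) : b.length ≠ 0 := by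
  intro hb
  obtain rfl := List.eq_nil_of_length_eq_zero hb
  have h1 := h.fits
  rw [List.nil_append, SlabsFit.append] at h1
  obtain ⟨d', h1, -⟩ := h1
  exact hc (hf.eq_of_ne_nil hM h1).1

/-- The ports of the merged diagram sit in the original one as the ports outside `M` and those on
the outer boundary of `M`, and the merged diagram is the first return to them. The field `exits`
guarantees that no closed component is hidden inside `M`, where merging would lose it. -/
theorem slabValue_merge [Monoid A] {K : Type*} [CommMonoid K] {T : A → K}
    (hT : ∀ a b, T (a * b) = T (b * a)) {b M a : List (Slab A)} {N : Slab A}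
    (h : SlabsClosed (b ++ M ++ a)) (hN : N.Valid) (hM : N.Represents M) :
    slabValue T (b ++ M ++ a) = slabValue T (b ++ [N] ++ a) := by
  have h' : SlabsClosed (b ++ [N] ++ a) :=
    h.replace hM.ne_nil hM.fits ⟨rfl, rfl⟩ (by simpa using hN)
  have hp : 0 < M.length := List.length_pos_of_ne_nil hM.ne_nil
  obtain ⟨M0, hM0⟩ : ∃ x, M[0]? = some x := ⟨M[0], by simp⟩
  obtain ⟨M1, hM1⟩ : ∃ x, M[M.length - 1]? = some x := ⟨M[M.length - 1], by simp [hp]⟩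
  have hdom := hM.fits.dom_eq hM0
  have hcod := hM.fits.cod_eq hM1 (by omega)
  have hleft : ∀ {i}, i < b.length → (b ++ M ++ a)[i]? = (b ++ [N] ++ a)[i]? := fun hi => by
    rw [getElem?_stack_left hi, getElem?_stack_left hi]
  have hright : ∀ t, (b ++ M ++ a)[b.length + M.length + t]? =
      (b ++ [N] ++ a)[b.length + 1 + t]? := fun t => by
    rw [getElem?_stack_right, ← getElem?_stack_right (b := b) (M := [N]), List.length_singleton]
  have hmid : (b ++ [N] ++ a)[b.length]? = some N := by
    simp
  have hιmem : ∀ P : Port (b ++ [N] ++ a), ∃ x,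
      (b ++ M ++ a)[(unmerge b.length M.length P.1).1]? = some x ∧
        x.Enters (unmerge b.length M.length P.1).2 := by
    rintro ⟨⟨i, q⟩, x, hx, hq⟩
    rcases lt_trichotomy i b.length with hi | rfl | hi
    · refine ⟨x, ?_, hq⟩
      simpa only [unmerge, if_pos hi, hleft hi] using hx
    · obtain rfl : N = x := by simpa [hmid] using hx
      obtain ⟨t, j⟩ := q
      cases t with
      | true =>
        refine ⟨M1, ?_, by simpa [unmerge, Slab.Enters, hcod] using hq⟩
        simp only [unmerge, lt_irrefl, if_true, if_false]
        rw [Nat.add_sub_assoc hp, getElem?_stack_mid (by omega), hM1]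
      | false =>
        refine ⟨M0, ?_, by simpa [unmerge, Slab.Enters, hdom] using hq⟩
        simp only [unmerge, lt_irrefl, if_true, if_false, Bool.false_eq_true]
        have := getElem?_stack_mid (b := b) (M := M) (a := a) (i := 0) hp
        rwa [add_zero, hM0] at this
    · obtain ⟨t, rfl⟩ : ∃ t, i = b.length + 1 + t := ⟨i - b.length - 1, by omega⟩
      refine ⟨x, ?_, hq⟩
      simp only [unmerge, if_neg (show ¬ b.length + 1 + t < b.length by omega),
        if_neg (show ¬ b.length + 1 + t = b.length by omega)]
      rw [show b.length + 1 + t + M.length - 1 = b.length + M.length + t by omega, hright, hx]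
  let ι : Port (b ++ [N] ++ a) → Port (b ++ M ++ a) :=
    fun P => ⟨unmerge b.length M.length P.1, hιmem P⟩
  have hι : ∀ P, (ι P).coords = unmerge b.length M.length P.coords := fun P => rfl
  have hrange : ∀ P : ℕ × Bool × ℕ, P ∈ Set.range (Port.coords ∘ ι) →
      ∃ Q : ℕ × Bool × ℕ, unmerge b.length M.length Q = P := by
    rintro _ ⟨Q, rfl⟩
    exact ⟨Q.1, rfl⟩
  have hup : ∀ i j, 0 < i → i < M.length →
      (b.length + i, false, j) ∉ Set.range (Port.coords ∘ ι) := by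
    intro i j h0 h1 hmem
    obtain ⟨Q, hQ⟩ := hrange _ hmem
    rcases unmerge_cases b.length M.length Q with
      ⟨h1, h2⟩ | ⟨j, -, h2⟩ | ⟨j, -, h2⟩ | ⟨t, q, -, h2⟩ <;>
    rw [h2] at hQ <;> simp only [Prod.ext_iff] at hQ <;> grind
  have hdown : ∀ i j, i + 1 < M.length →
      (b.length + i, true, j) ∉ Set.range (Port.coords ∘ ι) := by
    intro i j h1 hmem
    obtain ⟨Q, hQ⟩ := hrange _ hmem
    rcases unmerge_cases b.length M.length Q with
      ⟨h1, h2⟩ | ⟨j, -, h2⟩ | ⟨j, -, h2⟩ | ⟨t, q, -, h2⟩ <;>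
    rw [h2] at hQ <;> simp only [Prod.ext_iff] at hQ <;> grind
  have hpre : ∀ i q x, (b ++ M ++ a)[i]? = some x → x.Enters q →
      (i < b.length ∨ b.length + M.length ≤ i) → ∃ Q, (ι Q).coords = (i, q) := by
    rintro i q x hx hq (hi | hi)
    · refine ⟨⟨(i, q), x, by rw [← hleft hi, hx], hq⟩, ?_⟩
      exact unmerge_of_lt hi
    · obtain ⟨t, rfl⟩ := Nat.exists_eq_add_of_le hi
      refine ⟨⟨(b.length + 1 + t, q), x, by rw [← hright, hx], hq⟩, ?_⟩
      exact unmerge_add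
  refine cycleProd_firstReturn hT h.permutes h'.permutes ι ?_ ?_ ?_
  · intro P Q he
    exact Subtype.ext (unmerge_injective hp (congrArg Port.coords he))
  · intro y z hyz
    have hz : (ι z).coords = unmerge b.length M.length z.coords := rfl
    rw [hz, hι, ← hyz]
    obtain ⟨⟨i, q⟩, x, hx, hq⟩ := y
    change ∃ n, FirstReturn _ _ _ (unmerge _ _ (i, q)) n (portBead (b ++ [N] ++ a) (i, q))
      (unmerge _ _ (portNext (b ++ [N] ++ a) (i, q)))
    rw [portNext_eq hx, portBead_eq hx]
    rcases lt_trichotomy i b.length with hi | rfl | hi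
    · have hx' : (b ++ M ++ a)[i]? = some x := by rw [hleft hi, hx]
      refine ⟨1, ?_⟩
      rw [unmerge_of_lt hi, ← portBead_eq hx']
      apply FirstReturn.single
      rw [portNext_eq hx']
      rcases x.pass q with ⟨t, j⟩
      cases t <;> simp [leaveSlab, unmerge] <;> split_ifs <;> omega
    · obtain rfl : N = x := by simpa [hmid] using hx
      -- Leaving `N` and leaving the stack lead to the same port. On the way down the truncated
      -- `b.length - 1` is harmless because some slab lies below.
      have hend : unmerge b.length M.length (leaveSlab b.length (N.pass q)) =
          leaveStack b.length M.length (N.pass q) := by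
        have hl := hN.leaves q hq
        rcases hpq : N.pass q with ⟨t, j⟩
        cases t with
        | true => simp [leaveSlab, unmerge, leaveStack]
        | false =>
          have hb : b.length ≠ 0 := by
            apply h.bottom_ne_nil hM.fits hM.ne_nil
            rw [hpq] at hl
            intro h0
            simp [Slab.Leaves, h0] at hl
          exact unmerge_of_lt (by simp; omega)
      rw [hend]
      obtain ⟨t, j⟩ := q
      cases t with
      | true =>
        have := (hM.top j hq).firstReturn (a := a) hup hdown
        simpa [unmerge, Nat.add_sub_assoc hp] using this
      | false =>
        have := (hM.bottom j hq).firstReturn (a := a) hup hdown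
        simpa [unmerge] using this
    · obtain ⟨t, rfl⟩ : ∃ t, i = b.length + 1 + t := ⟨i - b.length - 1, by omega⟩
      have hx' : (b ++ M ++ a)[b.length + M.length + t]? = some x := by rw [hright, hx]
      refine ⟨1, ?_⟩
      rw [unmerge_add, ← portBead_eq hx']
      apply FirstReturn.single
      rw [portNext_eq hx']
      rcases x.pass q with ⟨s, j⟩
      cases s <;> simp [leaveSlab, unmerge] <;> split_ifs <;> omega
  · rintro ⟨⟨i, q⟩, x, hx, hq⟩
    by_cases hi : i < b.length ∨ b.length + M.length ≤ i
    · obtain ⟨Q, hQ⟩ := hpre i q x hx hq hi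
      exact ⟨0, Q, hQ.symm⟩
    -- A port inside the stack is followed until its strand leaves the stack, where it reaches a
    -- port of the merged diagram.
    · push Not at hi
      obtain ⟨s, rfl⟩ := Nat.exists_eq_add_of_le hi.1
      have hxs : M[s]? = some x := by rw [← hx, getElem?_stack_mid (by omega)]
      obtain ⟨w, e, ht⟩ := hM.exits s x q hxs hq
      have hl := ht.leaves hM.fits hM.valid fun y hy => by
        obtain rfl : x = y := by simpa [hxs] using hy
        exact hq
      obtain ⟨n, hn⟩ := ht.firstReturn (a := a) hup hdown
      obtain ⟨⟨⟨i', q'⟩, x', hx', hq'⟩, hy⟩ :=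
        h.permutes.exists_iterate ⟨(b.length + s, q), x, hx, hq⟩ n
      change _ = (i', q') at hy
      have hy' := hn.iterate_eq
      change _ = _ at hy'
      have he : leaveStack b.length M.length e = (i', q') := by rw [← hy', ← hy]; rfl
      have hi' : i' < b.length ∨ b.length + M.length ≤ i' := by
        obtain ⟨t, j⟩ := e
        simp only [leaveStack, Prod.mk.injEq] at he
        cases t with
        | true => right; simp at he; omega
        | false =>
          left
          have hb : b.length ≠ 0 := by
            apply h.bottom_ne_nil hM.fits hM.ne_nil
            intro h0
            simp [h0] at hl
          simp at he
          omega
      obtain ⟨Q, hQ⟩ := hpre i' q' x' hx' hq' hi'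
      exact ⟨n, Q, by rw [hQ, ← hy]⟩

end Merge

/-! ### Straight slabs, linearity and whiskering -/

section Straight

variable {A : Type*}

/-- All strands of the slab are vertical lines without beads. -/
structure Slab.Straight [One A] (N : Slab A) : Prop where
  dom_eq : N.dom = N.cod
  pass : ∀ q, N.Enters q → N.pass q = (!q.1, q.2)
  bead : ∀ q, N.Enters q → N.bead q = 1

theorem SlabsClosed.remove {b a : List (Slab A)} {N : Slab A} (h : SlabsClosed (b ++ [N] ++ a))
    (hN : N.dom = N.cod) : SlabsClosed (b ++ a) := by
  obtain ⟨hfit, hv⟩ := h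
  rw [List.append_assoc, SlabsFit.append] at hfit
  obtain ⟨c, hb, rfl, ha⟩ := hfit
  refine ⟨SlabsFit.append.2 ⟨_, hb, hN ▸ ha⟩, fun x hx => hv x ?_⟩
  simp only [List.mem_append] at hx ⊢
  exact hx.imp .inl id

/-- This complements `slabValue_merge`, which always leaves one slab behind. The first return to the
ports outside `N` takes one step, or two when the strand runs through `N`, and there it collects the
bead 1. -/
theorem slabValue_straight [Monoid A] {K : Type*} [CommMonoid K] {T : A → K}
    (hT : ∀ a b, T (a * b) = T (b * a)) {b a : List (Slab A)} {N : Slab A}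
    (h : SlabsClosed (b ++ [N] ++ a)) (hN : N.Straight) :
    slabValue T (b ++ [N] ++ a) = slabValue T (b ++ a) := by
  have h' := h.remove hN.dom_eq
  have hleft : ∀ {i}, i < b.length → (b ++ [N] ++ a)[i]? = (b ++ a)[i]? := fun hi => by
    rw [getElem?_stack_left hi, List.getElem?_append_left hi]
  have hright : ∀ t, (b ++ [N] ++ a)[b.length + 1 + t]? = (b ++ a)[b.length + t]? := fun t => by
    have := getElem?_stack_right (b := b) (M := [N]) (a := a) (i := t)
    rw [List.length_singleton] at this
    rw [this, List.getElem?_append_right (by omega), Nat.add_sub_cancel_left]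
  have hmid : (b ++ [N] ++ a)[b.length]? = some N := by simp
  let c : ℕ × Bool × ℕ → ℕ × Bool × ℕ := fun P => (if P.1 < b.length then P.1 else P.1 + 1, P.2)
  have hclt : ∀ {i q}, i < b.length → c (i, q) = (i, q) := fun hi => by simp [c, hi]
  have hcge : ∀ {t q}, c (b.length + t, q) = (b.length + 1 + t, q) := by
    intro t q
    simp [c]
    omega
  have hcinj : Function.Injective c := by
    rintro ⟨i, q⟩ ⟨i', q'⟩ he
    simp only [c, Prod.mk.injEq] at he ⊢
    obtain ⟨hi, rfl⟩ := he
    refine ⟨?_, rfl⟩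
    split_ifs at hi <;> omega
  let ι : Port (b ++ a) → Port (b ++ [N] ++ a) := fun P => ⟨c P.1, by
    obtain ⟨⟨i, q⟩, x, hx, hq⟩ := P
    rcases lt_or_ge i b.length with hi | hi
    · exact ⟨x, by simpa only [hclt hi, hleft hi] using hx, hq⟩
    · obtain ⟨t, rfl⟩ := Nat.exists_eq_add_of_le hi
      exact ⟨x, by simpa only [hcge, hright] using hx, hq⟩⟩
  have hnot : ∀ q, (b.length, q) ∉ Set.range (Port.coords ∘ ι) := by
    rintro q ⟨⟨⟨i, q'⟩, hP⟩, hQ⟩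
    have := congrArg Prod.fst hQ
    simp only [Function.comp, ι, Port.coords, c] at this
    split_ifs at this <;> omega
  have hpre : ∀ i q x, (b ++ [N] ++ a)[i]? = some x → x.Enters q → i ≠ b.length →
      ∃ Q, (ι Q).coords = (i, q) := by
    intro i q x hx hq hi
    rcases lt_or_gt_of_ne hi with hi | hi
    · exact ⟨⟨(i, q), x, by rw [← hleft hi, hx], hq⟩, hclt hi⟩
    · obtain ⟨t, rfl⟩ : ∃ t, i = b.length + 1 + t := ⟨i - b.length - 1, by omega⟩
      exact ⟨⟨(b.length + t, q), x, by rw [← hright, hx], hq⟩, hcge⟩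
  have hpos : ∀ {q}, N.Enters q → q.1 = true → b.length ≠ 0 := by
    intro q hq ht
    apply h.bottom_ne_nil (M := [N]) ⟨rfl, rfl⟩ (by simp)
    rw [hN.dom_eq]
    intro h0
    simp [Slab.Enters, ht, h0] at hq
  refine cycleProd_firstReturn hT h.permutes h'.permutes ι
    (fun P Q he => Subtype.ext (hcinj (congrArg Port.coords he))) ?_ ?_
  · intro y z hyz
    have hz : (ι z).coords = c z.coords := rfl
    obtain ⟨⟨⟨i', q'⟩, x', hx', hq'⟩, hyz'⟩ : ∃ z' : Port (b ++ [N] ++ a),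
      portNext (b ++ [N] ++ a) (ι y).coords = z'.coords := h.permutes.maps (ι y)
    obtain ⟨⟨i, q⟩, x, hx, hq⟩ := y
    have hyc : (ι ⟨(i, q), x, hx, hq⟩).coords = c (i, q) := rfl
    rw [hyc] at hyz' ⊢
    rw [hz, ← hyz]
    change ∃ n, FirstReturn _ _ _ _ n (portBead (b ++ a) (i, q)) (c (portNext (b ++ a) (i, q)))
    change _ = (i', q') at hyz'
    rw [portNext_eq hx, portBead_eq hx]
    have hx1 : (b ++ [N] ++ a)[(c (i, q)).1]? = some x := by
      rcases lt_or_ge i b.length with hi | hi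
      · rw [hclt hi, hleft hi, hx]
      · obtain ⟨t, rfl⟩ := Nat.exists_eq_add_of_le hi
        rw [hcge, hright, hx]
    have hbead : portBead (b ++ [N] ++ a) (c (i, q)) = x.bead q := portBead_eq hx1
    have hnext : portNext (b ++ [N] ++ a) (c (i, q)) = leaveSlab (c (i, q)).1 (x.pass q) :=
      portNext_eq hx1
    by_cases hi' : i' = b.length
    · subst hi'
      obtain rfl : N = x' := by simpa using hx'
      have hN1 : portNext (b ++ [N] ++ a) (b.length, q') = leaveSlab b.length (!q'.1, q'.2) := by
        rw [portNext_eq hmid, hN.pass q' hq']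
      have hN2 : portBead (b ++ [N] ++ a) (b.length, q') = 1 := by
        rw [portBead_eq hmid, hN.bead q' hq']
      -- The strand enters `N` after the first step and leaves it, without turning, after the
      -- second.
      refine ⟨1 + 1, ?_⟩
      rw [← hbead, ← mul_one (portBead _ _)]
      refine FirstReturn.cons hyz' (hnot q') ?_
      rw [← hN2]
      apply FirstReturn.single
      rw [hN1]
      have hp := hpos hq'
      rw [hnext] at hyz'
      rcases hpq : x.pass q with ⟨t, j⟩
      rw [hpq] at hyz'
      obtain ⟨t', j'⟩ := q'
      simp only [leaveSlab, Prod.mk.injEq, c] at hyz' ⊢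
      obtain ⟨h1, rfl, rfl⟩ := hyz'
      refine ⟨?_, Bool.not_not _, rfl⟩
      clear hx1 hnext hbead
      cases t <;> simp only [Bool.not_true, Bool.not_false, if_true, if_false, Bool.false_eq_true,
        true_imp_iff] at h1 hp ⊢ <;> split_ifs at h1 ⊢ <;> omega
    · refine ⟨1, ?_⟩
      rw [← hbead]
      apply FirstReturn.single
      rw [hnext] at hyz' ⊢
      rcases hpq : x.pass q with ⟨t, j⟩
      rw [hpq] at hyz'
      simp only [leaveSlab, Prod.mk.injEq, c] at hyz' ⊢
      refine ⟨?_, trivial⟩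
      obtain ⟨h1, -⟩ := hyz'
      clear hx1 hnext hbead
      cases t <;> simp only [if_true, if_false, Bool.false_eq_true] at h1 ⊢ <;>
        split_ifs at h1 ⊢ <;> omega
  · rintro ⟨⟨i, q⟩, x, hx, hq⟩
    by_cases hi : i = b.length
    · subst hi
      obtain rfl : N = x := by simpa using hx
      obtain ⟨⟨⟨i', q'⟩, x', hx', hq'⟩, hy⟩ := h.permutes.maps ⟨(b.length, q), N, hx, hq⟩
      obtain ⟨Q, hQ⟩ := hpre i' q' x' hx' hq' (by
        change portNext _ (b.length, q) = (i', q') at hy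
        rw [portNext_eq hmid, hN.pass q hq] at hy
        have hp := hpos hq
        simp only [leaveSlab, Prod.mk.injEq] at hy
        obtain ⟨h1, -⟩ := hy
        rcases q with ⟨t, j⟩
        cases t <;> simp only [Bool.not_true, Bool.not_false, if_true, if_false,
          Bool.false_eq_true, true_imp_iff] at h1 hp <;> omega)
      exact ⟨1, Q, by rw [hQ]; exact hy⟩
    · obtain ⟨Q, hQ⟩ := hpre i q x hx hq hi
      exact ⟨0, Q, hQ.symm⟩

end Straight

/-! ### Multilinearity in the beads of one slab -/

section LinearSlab

variable {A : Type*}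

/-- Replacement of the beads of a slab. -/
def Slab.withBead (N : Slab A) (β : Bool × ℕ → A) : Slab A := { N with bead := β }

theorem Slab.Valid.withBead {N : Slab A} (h : N.Valid) (β : Bool × ℕ → A) :
    (N.withBead β).Valid := ⟨h.leaves, h.inj⟩

theorem SlabsClosed.withBead {b a : List (Slab A)} {N : Slab A}
    (h : SlabsClosed (b ++ [N] ++ a)) (β : Bool × ℕ → A) :
    SlabsClosed (b ++ [N.withBead β] ++ a) := by
  refine h.replace (by simp) ⟨rfl, rfl⟩ (M' := [N.withBead β]) ⟨rfl, rfl⟩ fun x hx => ?_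
  rw [List.mem_singleton.1 hx]
  exact (h.valid N (by simp)).withBead β

/-- Changing beads does not change how strands are joined, so all these diagrams share one
permutation of ports and differ only in the label at one port. -/
theorem isLinearMap_slabValue {K : Type*} [CommRing K] [Ring A] [Algebra K A] {T : A →ₗ[K] K}
    (hT : ∀ a b, T (a * b) = T (b * a)) {b c : List (Slab A)} {N : Slab A}
    (h : SlabsClosed (b ++ [N] ++ c)) {q : Bool × ℕ} (hq : N.Enters q) (β : A → Bool × ℕ → A)
    (hβ : ∀ a, β a q = a) (hβ' : ∀ a q', q' ≠ q → N.Enters q' → β a q' = β 0 q') :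
    IsLinearMap K fun a => slabValue T (b ++ [N.withBead (β a)] ++ c) := by
  have hmid : ∀ M : Slab A, (b ++ [M] ++ c)[b.length]? = some M := fun M => by simp
  have hne : ∀ (M : Slab A) {i}, i ≠ b.length → (b ++ [M] ++ c)[i]? = (b ++ [N] ++ c)[i]? := by
    intro M i hi
    rcases lt_or_gt_of_ne hi with hi | hi
    · rw [getElem?_stack_left hi, getElem?_stack_left hi]
    · obtain ⟨t, rfl⟩ : ∃ t, i = b.length + [M].length + t :=
        ⟨i - b.length - 1, by simp; omega⟩
      rw [getElem?_stack_right, List.length_singleton, ← List.length_singleton (a := N),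
        getElem?_stack_right]
  -- The labelling by `β 0` serves as reference for all labels away from `q`.
  obtain ⟨B, hB⟩ := exists_linear_cycleProd T hT h.permutes
    ⟨(b.length, q), N, hmid N, hq⟩ (portBead (b ++ [N.withBead (β 0)] ++ c))
  have key : ∀ a, slabValue T (b ++ [N.withBead (β a)] ++ c) = B a := by
    intro a
    have h1 : slabValue T (b ++ [N.withBead (β a)] ++ c) =
        cycleProd T (Port.coords (xs := b ++ [N] ++ c)) (portNext (b ++ [N] ++ c))
          (portBead (b ++ [N.withBead (β a)] ++ c)) := by
      -- Ports of different lists form different types, although the places are the same; they have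
      -- to be carried over.
      have hport : ∀ (M M' : Slab A), (∀ q, M.Enters q → M'.Enters q) → ∀ P : ℕ × Bool × ℕ,
          (∃ x, (b ++ [M] ++ c)[P.1]? = some x ∧ x.Enters P.2) →
          (∃ x, (b ++ [M'] ++ c)[P.1]? = some x ∧ x.Enters P.2) := by
        rintro M M' hMM ⟨i, q⟩ ⟨x, hx, hq⟩
        by_cases hi : i = b.length
        · subst hi
          rw [hmid] at hx
          obtain rfl := Option.some.inj hx
          exact ⟨M', hmid _, hMM q hq⟩
        · exact ⟨x, by rw [← hx, hne M hi, hne M' hi], hq⟩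
      refine cycleProd_congr hT (h.withBead _).permutes h.permutes
        (fun P => ⟨P.1, hport N (N.withBead (β a)) (fun _ hq => hq) P.1 P.2⟩)
        ⟨fun P Q h => Subtype.ext (congrArg (fun P => P.1) h :), fun P =>
          ⟨⟨P.1, hport (N.withBead (β a)) N (fun _ hq => hq) P.1 P.2⟩, rfl⟩⟩ ?_ ?_
      · rintro ⟨⟨i, q⟩, hP⟩ z hz
        refine Eq.trans ?_ hz
        change portNext _ (i, q) = portNext _ (i, q)
        by_cases hi : i = b.length
        · subst hi
          rw [portNext_eq (hmid _), portNext_eq (hmid _)]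
          rfl
        · simp only [portNext, hne (N.withBead (β a)) hi]
      · intro y
        rfl
    rw [h1, hB]
    · change B (portBead _ (b.length, q)) = B a
      rw [portBead_eq (hmid _)]
      exact congrArg B (hβ a)
    · rintro ⟨⟨i, q'⟩, x, hx, hq'⟩ hne'
      change portBead _ (i, q') = portBead _ (i, q')
      by_cases hi : i = b.length
      · subst hi
        rw [hmid] at hx
        obtain rfl := Option.some.inj hx
        rw [portBead_eq (hmid _), portBead_eq (hmid _)]
        refine hβ' a q' ?_ hq'
        rintro rfl
        exact hne' rfl
      · simp only [portBead, hne (N.withBead _) hi]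
  refine ⟨fun x y => ?_, fun r x => ?_⟩
  · rw [key, key, key, map_add]
  · rw [key, key, map_smul]

/-- If three beads of a slab vary, then the value of the diagram is a linear function of their
tensor product. -/
theorem exists_linear_slabValue_three {K : Type*} [CommRing K] [Ring A] [Algebra K A]
    {T : A →ₗ[K] K} (hT : ∀ a b, T (a * b) = T (b * a)) {b c : List (Slab A)} {N : Slab A}
    (h : SlabsClosed (b ++ [N] ++ c)) {q₁ q₂ q₃ : Bool × ℕ} (hq₁ : N.Enters q₁)
    (hq₂ : N.Enters q₂) (hq₃ : N.Enters q₃) (β : A → A → A → Bool × ℕ → A)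
    (h₁ : ∀ a₁ a₂ a₃, β a₁ a₂ a₃ q₁ = a₁) (h₂ : ∀ a₁ a₂ a₃, β a₁ a₂ a₃ q₂ = a₂)
    (h₃ : ∀ a₁ a₂ a₃, β a₁ a₂ a₃ q₃ = a₃)
    (hβ : ∀ a₁ a₂ a₃ q, q ≠ q₁ → q ≠ q₂ → q ≠ q₃ → N.Enters q → β a₁ a₂ a₃ q = β 0 0 0 q) :
    ∃ B : A ⊗[K] (A ⊗[K] A) →ₗ[K] K, ∀ a₁ a₂ a₃,
      slabValue T (b ++ [N.withBead (β a₁ a₂ a₃)] ++ c) = B (a₁ ⊗ₜ (a₂ ⊗ₜ a₃)) := by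
  classical
  have l₁ : ∀ a₂ a₃, IsLinearMap K fun a₁ => slabValue T (b ++ [N.withBead (β a₁ a₂ a₃)] ++ c) := by
    intro a₂ a₃
    refine isLinearMap_slabValue hT h hq₁ (fun a => β a a₂ a₃) (fun a => h₁ a a₂ a₃) ?_
    intro a q hq hE
    by_cases e₂ : q = q₂
    · subst e₂; simp only [h₂]
    by_cases e₃ : q = q₃
    · subst e₃; simp only [h₃]
    rw [hβ a a₂ a₃ q hq e₂ e₃ hE, hβ 0 a₂ a₃ q hq e₂ e₃ hE]
  have l₂ : ∀ a₁ a₃, IsLinearMap K fun a₂ => slabValue T (b ++ [N.withBead (β a₁ a₂ a₃)] ++ c) := by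
    intro a₁ a₃
    refine isLinearMap_slabValue hT h hq₂ (fun a => β a₁ a a₃) (fun a => h₂ a₁ a a₃) ?_
    intro a q hq hE
    by_cases e₁ : q = q₁
    · subst e₁; simp only [h₁]
    by_cases e₃ : q = q₃
    · subst e₃; simp only [h₃]
    rw [hβ a₁ a a₃ q e₁ hq e₃ hE, hβ a₁ 0 a₃ q e₁ hq e₃ hE]
  have l₃ : ∀ a₁ a₂, IsLinearMap K fun a₃ => slabValue T (b ++ [N.withBead (β a₁ a₂ a₃)] ++ c) := by
    intro a₁ a₂
    refine isLinearMap_slabValue hT h hq₃ (fun a => β a₁ a₂ a) (fun a => h₃ a₁ a₂ a) ?_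
    intro a q hq hE
    by_cases e₁ : q = q₁
    · subst e₁; simp only [h₁]
    by_cases e₂ : q = q₂
    · subst e₂; simp only [h₂]
    rw [hβ a₁ a₂ a q e₁ e₂ hq hE, hβ a₁ a₂ 0 q e₁ e₂ hq hE]
  let L : A →ₗ[K] A →ₗ[K] A →ₗ[K] K :=
    { toFun := fun a₁ => LinearMap.mk₂ K
        (fun a₂ a₃ => slabValue T (b ++ [N.withBead (β a₁ a₂ a₃)] ++ c))
        (fun x y z => (l₂ a₁ z).1 x y) (fun r x z => (l₂ a₁ z).2 r x)
        (fun x y z => (l₃ a₁ x).1 y z) (fun r x z => (l₃ a₁ x).2 r z)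
      map_add' := fun x y => LinearMap.ext₂ fun a₂ a₃ => (l₁ a₂ a₃).1 x y
      map_smul' := fun r x => LinearMap.ext₂ fun a₂ a₃ => (l₁ a₂ a₃).2 r x }
  refine ⟨TensorProduct.lift ((TensorProduct.uncurry (.id K) A A K).comp L), fun a₁ a₂ a₃ => ?_⟩
  rfl

/-- If two beads of a slab vary, then the value of the diagram is a linear function of their
tensor product. -/
theorem exists_linear_slabValue_two {K : Type*} [CommRing K] [Ring A] [Algebra K A]
    {T : A →ₗ[K] K} (hT : ∀ a b, T (a * b) = T (b * a)) {b c : List (Slab A)} {N : Slab A}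
    (h : SlabsClosed (b ++ [N] ++ c)) {q₁ q₂ : Bool × ℕ} (hq₁ : N.Enters q₁)
    (hq₂ : N.Enters q₂) (β : A → A → Bool × ℕ → A)
    (h₁ : ∀ a₁ a₂, β a₁ a₂ q₁ = a₁) (h₂ : ∀ a₁ a₂, β a₁ a₂ q₂ = a₂)
    (hβ : ∀ a₁ a₂ q, q ≠ q₁ → q ≠ q₂ → N.Enters q → β a₁ a₂ q = β 0 0 q) :
    ∃ B : A ⊗[K] A →ₗ[K] K, ∀ a₁ a₂,
      slabValue T (b ++ [N.withBead (β a₁ a₂)] ++ c) = B (a₁ ⊗ₜ a₂) := by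
  classical
  have l₁ : ∀ a₂, IsLinearMap K fun a₁ => slabValue T (b ++ [N.withBead (β a₁ a₂)] ++ c) := by
    intro a₂
    refine isLinearMap_slabValue hT h hq₁ (fun a => β a a₂) (fun a => h₁ a a₂) ?_
    intro a q hq hE
    by_cases e₂ : q = q₂
    · subst e₂; simp only [h₂]
    rw [hβ a a₂ q hq e₂ hE, hβ 0 a₂ q hq e₂ hE]
  have l₂ : ∀ a₁, IsLinearMap K fun a₂ => slabValue T (b ++ [N.withBead (β a₁ a₂)] ++ c) := by
    intro a₁
    refine isLinearMap_slabValue hT h hq₂ (fun a => β a₁ a) (fun a => h₂ a₁ a) ?_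
    intro a q hq hE
    by_cases e₁ : q = q₁
    · subst e₁; simp only [h₁]
    rw [hβ a₁ a q e₁ hq hE, hβ a₁ 0 q e₁ hq hE]
  refine ⟨TensorProduct.lift (LinearMap.mk₂ K
    (fun a₁ a₂ => slabValue T (b ++ [N.withBead (β a₁ a₂)] ++ c))
    (fun x y z => (l₁ z).1 x y) (fun r x z => (l₁ z).2 r x)
    (fun x y z => (l₂ x).1 y z) (fun r x z => (l₂ x).2 r z)), fun a₁ a₂ => rfl⟩

end LinearSlab

/-! ### Adding vertical lines on both sides -/

section Whisker

variable {A : Type*}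

namespace Slab

/-- The slab `x` with vertical lines on both sides. -/
def whisker [One A] (l r : List Dir) (x : Slab A) : Slab A where
  dom := l ++ x.dom ++ r
  cod := l ++ x.cod ++ r
  pass q :=
    if q.2 < l.length then (!q.1, q.2)
    else if l.length + (x.side q.1).length ≤ q.2 then
      (!q.1, q.2 - (x.side q.1).length + (x.side (!q.1)).length)
    else ((x.pass (q.1, q.2 - l.length)).1, l.length + (x.pass (q.1, q.2 - l.length)).2)
  bead q :=
    if q.2 < l.length then 1
    else if l.length + (x.side q.1).length ≤ q.2 then 1
    else x.bead (q.1, q.2 - l.length)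

theorem whisker_cases (l : List Dir) (x : Slab A) (t : Bool) (j : ℕ) :
    j < l.length ∨ (∃ i, j = l.length + i ∧ i < (x.side t).length) ∨
      ∃ i, j = l.length + (x.side t).length + i := by
  rcases lt_or_ge j l.length with h | h
  · exact .inl h
  · rcases lt_or_ge j (l.length + (x.side t).length) with h' | h'
    · exact .inr (.inl ⟨j - l.length, by omega, by omega⟩)
    · exact .inr (.inr ⟨j - (l.length + (x.side t).length), by omega⟩)

variable [One A] {l r : List Dir} {x : Slab A}

theorem side_whisker (t : Bool) : (x.whisker l r).side t = l ++ x.side t ++ r := by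
  cases t <;> rfl

theorem getElem?_whisker_left {t : Bool} {j : ℕ} (h : j < l.length) :
    ((x.whisker l r).side t)[j]? = l[j]? := by
  rw [side_whisker, List.append_assoc, List.getElem?_append_left h]

theorem getElem?_whisker_mid {t : Bool} {j : ℕ} (h : j < (x.side t).length) :
    ((x.whisker l r).side t)[l.length + j]? = (x.side t)[j]? := by
  rw [side_whisker, List.append_assoc, List.getElem?_append_right (by omega),
    Nat.add_sub_cancel_left, List.getElem?_append_left h]

theorem getElem?_whisker_right {t : Bool} {j : ℕ} :
    ((x.whisker l r).side t)[l.length + (x.side t).length + j]? = r[j]? := by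
  rw [side_whisker, List.getElem?_append_right (by simp), List.length_append,
    Nat.add_sub_cancel_left]

theorem whisker_pass_left {t : Bool} {j : ℕ} (h : j < l.length) :
    (x.whisker l r).pass (t, j) = (!t, j) := by
  simp [whisker, h]

theorem whisker_pass_mid {t : Bool} {j : ℕ} (h : j < (x.side t).length) :
    (x.whisker l r).pass (t, l.length + j) =
      ((x.pass (t, j)).1, l.length + (x.pass (t, j)).2) := by
  simp [whisker, h]

theorem whisker_pass_right {t : Bool} {j : ℕ} :
    (x.whisker l r).pass (t, l.length + (x.side t).length + j) =
      (!t, l.length + (x.side (!t)).length + j) := by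
  simp only [whisker, if_neg (show ¬ l.length + (x.side t).length + j < l.length by omega),
    if_pos (show l.length + (x.side t).length ≤ l.length + (x.side t).length + j by omega)]
  congr 1
  omega

theorem whisker_bead_left {t : Bool} {j : ℕ} (h : j < l.length) :
    (x.whisker l r).bead (t, j) = 1 := by
  simp [whisker, h]

theorem whisker_bead_mid {t : Bool} {j : ℕ} (h : j < (x.side t).length) :
    (x.whisker l r).bead (t, l.length + j) = x.bead (t, j) := by
  simp [whisker, h]

theorem whisker_bead_right {t : Bool} {j : ℕ} :
    (x.whisker l r).bead (t, l.length + (x.side t).length + j) = 1 := by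
  simp only [whisker, if_neg (show ¬ l.length + (x.side t).length + j < l.length by omega),
    if_pos (show l.length + (x.side t).length ≤ l.length + (x.side t).length + j by omega)]

theorem whisker_enters_mid {t : Bool} {j : ℕ} (h : j < (x.side t).length) :
    (x.whisker l r).Enters (t, l.length + j) ↔ x.Enters (t, j) := by
  rw [Enters, Enters, getElem?_whisker_mid h]

theorem Enters.whisker {t : Bool} {j : ℕ} (h : x.Enters (t, j)) :
    (x.whisker l r).Enters (t, l.length + j) :=
  (whisker_enters_mid h.lt).2 h

theorem Valid.whisker (h : x.Valid) (l r : List Dir) : (x.whisker l r).Valid := by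
  constructor
  · rintro ⟨t, j⟩ hq
    rcases whisker_cases l x t j with hj | ⟨i, rfl, hi⟩ | ⟨i, rfl⟩
    · rw [whisker_pass_left hj]
      rw [Enters, getElem?_whisker_left hj] at hq
      rw [Leaves, getElem?_whisker_left hj, hq, Bool.not_not]
    · rw [whisker_pass_mid hi]
      have := h.leaves _ ((whisker_enters_mid hi).1 hq)
      rw [Leaves, getElem?_whisker_mid this.lt]
      exact this
    · rw [whisker_pass_right]
      rw [Enters, getElem?_whisker_right] at hq
      rw [Leaves, getElem?_whisker_right, hq, Bool.not_not]
  · rintro ⟨t, j⟩ ⟨t', j'⟩ hq hq' he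
    rcases whisker_cases l x t j with hj | ⟨i, rfl, hi⟩ | ⟨i, rfl⟩ <;>
    rcases whisker_cases l x t' j' with hj' | ⟨i', rfl, hi'⟩ | ⟨i', rfl⟩
    · rw [whisker_pass_left hj, whisker_pass_left hj'] at he
      simpa using he
    · rw [whisker_pass_left hj, whisker_pass_mid hi', Prod.ext_iff] at he
      simp only at he
      omega
    · rw [whisker_pass_left hj, whisker_pass_right, Prod.ext_iff] at he
      simp only at he
      omega
    · rw [whisker_pass_left hj', whisker_pass_mid hi, Prod.ext_iff] at he
      simp only at he
      omega
    · have h1 := (whisker_enters_mid hi).1 hq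
      have h1' := (whisker_enters_mid hi').1 hq'
      rw [whisker_pass_mid hi, whisker_pass_mid hi', Prod.ext_iff] at he
      simp only [Nat.add_left_cancel_iff] at he
      have := h.inj _ _ h1 h1' (Prod.ext he.1 he.2)
      simp only [Prod.mk.injEq] at this ⊢
      exact ⟨this.1, by rw [this.2]⟩
    · have hl := (h.leaves _ ((whisker_enters_mid hi).1 hq)).lt
      rw [whisker_pass_mid hi, whisker_pass_right, Prod.ext_iff] at he
      simp only at he
      rw [he.1] at hl
      omega
    · rw [whisker_pass_left hj', whisker_pass_right, Prod.ext_iff] at he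
      simp only at he
      omega
    · have hl := (h.leaves _ ((whisker_enters_mid hi').1 hq')).lt
      rw [whisker_pass_mid hi', whisker_pass_right, Prod.ext_iff] at he
      simp only at he
      rw [← he.1] at hl
      omega
    · rw [whisker_pass_right, whisker_pass_right, Prod.ext_iff] at he
      simp only [Bool.not_inj_iff] at he
      obtain ⟨rfl, he⟩ := he
      congr 1
      omega

theorem Straight.whisker (h : x.Straight) (l r : List Dir) : (x.whisker l r).Straight := by
  refine ⟨?_, ?_, ?_⟩
  · simp [Slab.whisker, h.dom_eq]
  · rintro ⟨t, j⟩ hq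
    rcases whisker_cases l x t j with hj | ⟨i, rfl, hi⟩ | ⟨i, rfl⟩
    · rw [whisker_pass_left hj]
    · rw [whisker_pass_mid hi, h.pass _ ((whisker_enters_mid hi).1 hq)]
    · rw [whisker_pass_right]
      cases t <;> simp [h.dom_eq]
  · rintro ⟨t, j⟩ hq
    rcases whisker_cases l x t j with hj | ⟨i, rfl, hi⟩ | ⟨i, rfl⟩
    · rw [whisker_bead_left hj]
    · rw [whisker_bead_mid hi, h.bead _ ((whisker_enters_mid hi).1 hq)]
    · rw [whisker_bead_right]

theorem Straight.valid (h : x.Straight) : x.Valid := by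
  constructor
  · rintro ⟨t, j⟩ hq
    rw [h.pass _ hq]
    cases t <;> simpa [Enters, Leaves, h.dom_eq] using hq
  · rintro ⟨t, j⟩ ⟨t', j'⟩ hq hq' he
    rw [h.pass _ hq, h.pass _ hq'] at he
    simpa using he

/-- This separates the vertical lines that take part in a local move from those far away, so that
each move need only be studied in its smallest form. -/
theorem whisker_whisker (l l' r r' : List Dir) (x : Slab A) :
    (x.whisker l' r').whisker l r = x.whisker (l ++ l') (r' ++ r) := by
  have hs : ∀ t, ((x.whisker l' r').side t).length =
      l'.length + (x.side t).length + r'.length := fun t => by simp [side_whisker, add_assoc]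
  have h1 : ((x.whisker l' r').whisker l r).pass = (x.whisker (l ++ l') (r' ++ r)).pass := by
    funext ⟨t, j⟩
    simp only [whisker, List.length_append] at hs ⊢
    simp only [hs]
    clear hs
    by_cases h1 : j < l.length
    · simp [h1, Nat.lt_add_right]
    by_cases h2 : j < l.length + l'.length
    · simp only [if_neg h1, if_pos h2, if_pos (show j - l.length < l'.length by omega),
        if_neg (show ¬ l.length + (l'.length + (x.side t).length + r'.length) ≤ j by omega)]
      congr 1
      omega
    by_cases h3 : l.length + l'.length + (x.side t).length ≤ j
    · by_cases h4 : l.length + (l'.length + (x.side t).length + r'.length) ≤ j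
      · simp only [if_neg h1, if_neg h2, if_pos h3, if_pos h4]
        congr 1
        omega
      · simp only [if_neg h1, if_neg h2, if_pos h3, if_neg h4,
          if_neg (show ¬ j - l.length < l'.length by omega),
          if_pos (show l'.length + (x.side t).length ≤ j - l.length by omega)]
        congr 1
        omega
    · simp only [if_neg h1, if_neg h2, if_neg h3,
        if_neg (show ¬ l.length + (l'.length + (x.side t).length + r'.length) ≤ j by omega),
          if_neg (show ¬ j - l.length < l'.length by omega),
          if_neg (show ¬ l'.length + (x.side t).length ≤ j - l.length by omega), Nat.sub_sub]
      rw [add_assoc]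
  have h2 : ((x.whisker l' r').whisker l r).bead = (x.whisker (l ++ l') (r' ++ r)).bead := by
    funext ⟨t, j⟩
    simp only [whisker, List.length_append] at hs ⊢
    simp only [hs]
    clear hs h1
    by_cases h1 : j < l.length
    · simp [h1, Nat.lt_add_right]
    by_cases h2 : j < l.length + l'.length
    · simp only [if_neg h1, if_pos h2, if_pos (show j - l.length < l'.length by omega), ite_self]
    by_cases h3 : l.length + l'.length + (x.side t).length ≤ j
    · simp only [if_neg h1, if_neg h2, if_pos h3,
        if_neg (show ¬ j - l.length < l'.length by omega),
        if_pos (show l'.length + (x.side t).length ≤ j - l.length by omega), ite_self]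
    · simp only [if_neg h1, if_neg h2, if_neg h3,
        if_neg (show ¬ l.length + (l'.length + (x.side t).length + r'.length) ≤ j by omega),
          if_neg (show ¬ j - l.length < l'.length by omega),
          if_neg (show ¬ l'.length + (x.side t).length ≤ j - l.length by omega), Nat.sub_sub]
  have h3 : ((x.whisker l' r').whisker l r).dom = (x.whisker (l ++ l') (r' ++ r)).dom := by
    simp [whisker]
  have h4 : ((x.whisker l' r').whisker l r).cod = (x.whisker (l ++ l') (r' ++ r)).cod := by
    simp [whisker]
  -- With both sides made opaque, equality of the four fields gives equality of the structures.
  generalize (x.whisker l' r').whisker l r = y at *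
  generalize x.whisker (l ++ l') (r' ++ r) = z at *
  cases y
  cases z
  simp_all

end Slab

theorem SlabsFit.whisker [One A] (l r : List Dir) {c d : List Dir} {M : List (Slab A)}
    (h : SlabsFit c M d) :
    SlabsFit (l ++ c ++ r) (M.map (Slab.whisker l r)) (l ++ d ++ r) := by
  induction M generalizing c with
  | nil => rw [show c = d from h]; rfl
  | cons x xs ih => exact ⟨by rw [h.1]; rfl, ih h.2⟩

/-- The position `u i` of a vertical line may vary with the height, since the slabs to its left can
change the number of strands. -/
theorem Transit.vertical_up [Monoid A] {M : List (Slab A)} (u : ℕ → ℕ)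
    (hpass : ∀ i (x : Slab A), M[i]? = some x → x.pass (false, u i) = (true, u (i + 1)))
    (hbead : ∀ i (x : Slab A), M[i]? = some x → x.bead (false, u i) = 1) (n : ℕ) {i : ℕ}
    (hi : i + n + 1 = M.length) : Transit M i (false, u i) 1 (true, u M.length) := by
  induction n generalizing i with
  | zero =>
    have hx : M[i]? = some (M[i]) := by simp
    have hu : u M.length = u (i + 1) := by rw [← hi, add_zero]
    rw [← hbead i _ hx, hu]
    exact .last hx (hpass i _ hx) (by omega)
  | succ n ih =>
    have hx : M[i]? = some (M[i]) := by simp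
    have := Transit.up hx (hpass i _ hx) (by omega) (ih (i := i + 1) (by omega))
    rwa [hbead i _ hx, mul_one] at this

theorem Transit.vertical_down [Monoid A] {M : List (Slab A)} (u : ℕ → ℕ)
    (hpass : ∀ i (x : Slab A), M[i]? = some x → x.pass (true, u (i + 1)) = (false, u i))
    (hbead : ∀ i (x : Slab A), M[i]? = some x → x.bead (true, u (i + 1)) = 1) {i : ℕ}
    (hi : i < M.length) : Transit M i (true, u (i + 1)) 1 (false, u 0) := by
  induction i with
  | zero =>
    have hx : M[0]? = some (M[0]) := by simp
    rw [← hbead 0 _ hx]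
    exact .first hx (hpass 0 _ hx)
  | succ i ih =>
    have hx : M[i + 1]? = some (M[i + 1]) := by simp
    have := Transit.down hx (hpass (i + 1) _ hx) (ih (by omega))
    rwa [hbead (i + 1) _ hx, mul_one] at this

theorem Transit.whisker [Monoid A] {M : List (Slab A)} {c d : List Dir} (hf : SlabsFit c M d)
    (hv : ∀ x ∈ M, x.Valid) (l r : List Dir) {i : ℕ} {q e : Bool × ℕ} {w : A}
    (h : Transit M i q w e) (hq : ∀ x, M[i]? = some x → x.Enters q) :
    Transit (M.map (Slab.whisker l r)) i (q.1, l.length + q.2) w (e.1, l.length + e.2) := by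
  have hmap : ∀ {i : ℕ} {x : Slab A}, M[i]? = some x →
      (M.map (Slab.whisker l r))[i]? = some (x.whisker l r) := by
    intro i x hx
    simp [hx]
  induction h with
  | last hx hp hi =>
    have hlt := (hq _ hx).lt
    rw [← Slab.whisker_bead_mid hlt (l := l) (r := r)]
    refine .last (hmap hx) ?_ (by simpa using hi)
    rw [Slab.whisker_pass_mid hlt]
    simp [hp]
  | first hx hp =>
    have hlt := (hq _ hx).lt
    rw [← Slab.whisker_bead_mid hlt (l := l) (r := r)]
    refine .first (hmap hx) ?_
    rw [Slab.whisker_pass_mid hlt]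
    simp [hp]
  | @up i x q j w e hx hp hi _ ih =>
    have hlt := (hq _ hx).lt
    rw [← Prod.mk.eta (p := q), ← Slab.whisker_bead_mid hlt (l := l) (r := r)]
    refine .up (j := l.length + j) (hmap hx) ?_ (by simpa using hi) (ih fun y hy => ?_)
    · rw [Slab.whisker_pass_mid hlt]
      simp [hp]
    · have := (hv _ (List.mem_of_getElem? hx)).leaves _ (hq _ hx)
      rw [hp] at this
      simpa [Slab.Leaves, Slab.Enters, hf.cod_eq_dom hx hy] using this
  | @down i x q j w e hx hp _ ih =>
    have hlt := (hq _ hx).lt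
    rw [← Prod.mk.eta (p := q), ← Slab.whisker_bead_mid hlt (l := l) (r := r)]
    refine .down (j := l.length + j) (hmap hx) ?_ (ih fun y hy => ?_)
    · rw [Slab.whisker_pass_mid hlt]
      simp [hp]
    · have := (hv _ (List.mem_of_getElem? hx)).leaves _ (hq _ hx)
      rw [hp] at this
      simpa [Slab.Leaves, Slab.Enters, hf.cod_eq_dom hy hx] using this

theorem Slab.Represents.whisker [Monoid A] {N : Slab A} {M : List (Slab A)} (h : N.Represents M)
    (l r : List Dir) : (N.whisker l r).Represents (M.map (Slab.whisker l r)) := by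
  have hp : 0 < M.length := List.length_pos_of_ne_nil h.ne_nil
  have hM0 : M[0]? = some M[0] := by simp
  have hM1 : M[M.length - 1]? = some M[M.length - 1] := by simp
  have hdom := h.fits.dom_eq hM0
  have hcod := h.fits.cod_eq hM1 (by omega)
  have hex : ∀ {i : ℕ} {x : Slab A}, (M.map (Slab.whisker l r))[i]? = some x →
      ∃ y : Slab A, M[i]? = some y ∧ x = y.whisker l r := by
    intro i x hx
    rw [List.getElem?_map, Option.map_eq_some_iff] at hx
    obtain ⟨y, hy, rfl⟩ := hx
    exact ⟨y, hy, rfl⟩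
  have leftUp : ∀ {i j}, j < l.length → i < M.length →
      Transit (M.map (Slab.whisker l r)) i (false, j) 1 (true, j) := by
    intro i j hj hi
    refine Transit.vertical_up (fun _ => j) ?_ ?_ (M.length - i - 1) (by simp; omega)
    · intro i x hx
      obtain ⟨y, hy, rfl⟩ := hex hx
      exact Slab.whisker_pass_left hj
    · intro i x hx
      obtain ⟨y, hy, rfl⟩ := hex hx
      exact Slab.whisker_bead_left hj
  have leftDown : ∀ {i j}, j < l.length → i < M.length →
      Transit (M.map (Slab.whisker l r)) i (true, j) 1 (false, j) := by
    intro i j hj hi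
    refine Transit.vertical_down (fun _ => j) ?_ ?_ (by simpa using hi)
    · intro i x hx
      obtain ⟨y, hy, rfl⟩ := hex hx
      exact Slab.whisker_pass_left hj
    · intro i x hx
      obtain ⟨y, hy, rfl⟩ := hex hx
      exact Slab.whisker_bead_left hj
  -- `v i` is the number of strands of the bare stack at height `i`, so a line on the right stands
  -- at `l.length + v i + j`. The default value is the number at the top of the stack.
  let v : ℕ → ℕ := fun i => match M[i]? with
    | some x => x.dom.length
    | none => N.cod.length
  have hv : ∀ {i x}, M[i]? = some x → v i = x.dom.length := fun hx => by simp [v, hx]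
  have hv' : ∀ {i x}, M[i]? = some x → v (i + 1) = x.cod.length := by
    intro i x hx
    have hi := (List.getElem?_eq_some_iff.1 hx).1
    rcases hy : M[i + 1]? with _ | y
    · simp only [v, hy]
      rw [h.fits.cod_eq hx (by have := List.getElem?_eq_none_iff.1 hy; omega)]
    · simp only [v, hy]
      rw [h.fits.cod_eq_dom hx hy]
  have rightUp : ∀ {i x j}, M[i]? = some x →
      Transit (M.map (Slab.whisker l r)) i (false, l.length + x.dom.length + j) 1
        (true, l.length + N.cod.length + j) := by
    intro i x j hx
    have hi := (List.getElem?_eq_some_iff.1 hx).1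
    have := Transit.vertical_up (M := M.map (Slab.whisker l r))
      (fun i => l.length + v i + j) ?_ ?_ (M.length - i - 1) (i := i) (by simp; omega)
    · simpa [hv hx, v] using this
    · intro i x hx
      obtain ⟨y, hy, rfl⟩ := hex hx
      rw [hv hy, hv' hy]
      exact Slab.whisker_pass_right (t := false)
    · intro i x hx
      obtain ⟨y, hy, rfl⟩ := hex hx
      rw [hv hy]
      exact Slab.whisker_bead_right (t := false)
  have rightDown : ∀ {i x j}, M[i]? = some x →
      Transit (M.map (Slab.whisker l r)) i (true, l.length + x.cod.length + j) 1
        (false, l.length + N.dom.length + j) := by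
    intro i x j hx
    have hi := (List.getElem?_eq_some_iff.1 hx).1
    have := Transit.vertical_down (M := M.map (Slab.whisker l r))
      (fun i => l.length + v i + j) ?_ ?_ (i := i) (by simpa using hi)
    · rw [hv' hx, hv hM0, hdom] at this
      exact this
    · intro i x hx
      obtain ⟨y, hy, rfl⟩ := hex hx
      rw [hv hy, hv' hy]
      exact Slab.whisker_pass_right (t := true)
    · intro i x hx
      obtain ⟨y, hy, rfl⟩ := hex hx
      rw [hv' hy]
      exact Slab.whisker_bead_right (t := true)
  refine ⟨by simpa using h.ne_nil, h.fits.whisker l r, ?_, ?_, ?_, ?_⟩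
  · intro x hx
    obtain ⟨y, hy, rfl⟩ := List.mem_map.1 hx
    exact (h.valid y hy).whisker l r
  · intro j hj
    rcases Slab.whisker_cases l N false j with hl | ⟨i, rfl, hi⟩ | ⟨i, rfl⟩
    · rw [Slab.whisker_bead_left hl, Slab.whisker_pass_left hl]
      exact leftUp hl hp
    · have hN := (Slab.whisker_enters_mid hi).1 hj
      rw [Slab.whisker_bead_mid hi, Slab.whisker_pass_mid hi]
      refine (h.bottom i hN).whisker h.fits h.valid l r fun x hx => ?_
      simpa [Slab.Enters, h.fits.dom_eq hx] using hN
    · rw [Slab.whisker_bead_right, Slab.whisker_pass_right]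
      have := rightUp (j := i) hM0
      rw [hdom] at this
      exact this
  · intro j hj
    rw [List.length_map]
    rcases Slab.whisker_cases l N true j with hl | ⟨i, rfl, hi⟩ | ⟨i, rfl⟩
    · rw [Slab.whisker_bead_left hl, Slab.whisker_pass_left hl]
      exact leftDown hl (by omega)
    · have hN := (Slab.whisker_enters_mid hi).1 hj
      rw [Slab.whisker_bead_mid hi, Slab.whisker_pass_mid hi]
      refine (h.top i hN).whisker h.fits h.valid l r fun x hx => ?_
      simpa [Slab.Enters, h.fits.cod_eq hx (by omega)] using hN
    · rw [Slab.whisker_bead_right, Slab.whisker_pass_right]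
      have := rightDown (j := i) hM1
      rw [hcod] at this
      exact this
  · rintro i x ⟨t, j⟩ hx hq
    obtain ⟨y, hy, rfl⟩ := hex hx
    have hi := (List.getElem?_eq_some_iff.1 hy).1
    rcases Slab.whisker_cases l y t j with hl | ⟨s, rfl, hs⟩ | ⟨s, rfl⟩
    · cases t with
      | true => exact ⟨_, _, leftDown hl hi⟩
      | false => exact ⟨_, _, leftUp hl hi⟩
    · have hE := (Slab.whisker_enters_mid hs).1 hq
      obtain ⟨w, e, ht⟩ := h.exits i y _ hy hE
      refine ⟨_, _, ht.whisker h.fits h.valid l r fun z hz => ?_⟩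
      obtain rfl : y = z := by simpa [hy] using hz
      exact hE
    · cases t with
      | true => exact ⟨_, _, rightDown hy⟩
      | false => exact ⟨_, _, rightUp hy⟩

end Whisker

/-! ### The slabs of a diagram and the sum over the states -/

section Trace

variable {A : Type*} [Monoid A]

/-- The transit through a stack of slabs, calculated in at most `n` steps. -/
def transitTrace (M : List (Slab A)) : ℕ → ℕ → Bool × ℕ → Option (A × Bool × ℕ)
  | 0, _, _ => none
  | n + 1, i, q =>
    match M[i]? with
    | none => none
    | some x =>
      match x.pass q with
      | (true, j) =>
        if i + 1 = M.length then some (x.bead q, true, j)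
        else (transitTrace M n (i + 1) (false, j)).map fun r => (x.bead q * r.1, r.2)
      | (false, j) =>
        match i with
        | 0 => some (x.bead q, false, j)
        | i' + 1 => (transitTrace M n i' (true, j)).map fun r => (x.bead q * r.1, r.2)

/-- Through this lemma the transits of the small concrete stacks are obtained by evaluation, that
is, by `rfl`. -/
theorem Transit.of_trace {M : List (Slab A)} {n i : ℕ} {q e : Bool × ℕ} {w : A}
    (h : transitTrace M n i q = some (w, e)) : Transit M i q w e := by
  induction n generalizing i q w e with
  | zero => simp [transitTrace] at h
  | succ n ih =>
    rw [transitTrace] at h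
    rcases hx : M[i]? with _ | x
    · simp [hx] at h
    · have hi := (List.getElem?_eq_some_iff.1 hx).1
      simp only [hx] at h
      rcases hp : x.pass q with ⟨t, j⟩
      cases t with
      | true =>
        simp only [hp] at h
        split_ifs at h with hl
        · obtain ⟨rfl, rfl⟩ := Prod.ext_iff.1 (Option.some.inj h)
          exact .last hx hp hl
        · obtain ⟨⟨w', e'⟩, hr, he⟩ := Option.map_eq_some_iff.1 h
          obtain ⟨rfl, rfl⟩ := Prod.ext_iff.1 he
          exact .up hx hp (by omega) (ih hr)
      | false =>
        simp only [hp] at h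
        cases i with
        | zero =>
          obtain ⟨rfl, rfl⟩ := Prod.ext_iff.1 (Option.some.inj h)
          exact .first hx hp
        | succ i =>
          obtain ⟨⟨w', e'⟩, hr, he⟩ := Option.map_eq_some_iff.1 h
          obtain ⟨rfl, rfl⟩ := Prod.ext_iff.1 he
          exact .down hx hp (ih hr)

/-- All strands that enter a slab of the stack leave the stack after at most `n` steps. -/
def allExit (M : List (Slab A)) (n : ℕ) : Bool :=
  (List.range M.length).all fun i => [true, false].all fun t =>
    (List.range ((M[i]?.map fun x => (x.side t).length).getD 0)).all fun j =>
      (transitTrace M n i (t, j)).isSome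

theorem Slab.Represents.of_trace {N : Slab A} {M : List (Slab A)} (n : ℕ) (hM : M ≠ [])
    (hf : SlabsFit N.dom M N.cod) (hv : ∀ x ∈ M, x.Valid)
    (hb : ∀ j < N.dom.length,
      transitTrace M n 0 (false, j) = some (N.bead (false, j), N.pass (false, j)))
    (ht : ∀ j < N.cod.length,
      transitTrace M n (M.length - 1) (true, j) = some (N.bead (true, j), N.pass (true, j)))
    (he : allExit M n = true) : N.Represents M := by
  refine ⟨hM, hf, hv, fun j hj => .of_trace (hb j hj.lt), fun j hj => .of_trace (ht j hj.lt), ?_⟩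
  rintro i x ⟨t, j⟩ hx hq
  have hi := (List.getElem?_eq_some_iff.1 hx).1
  rw [allExit, List.all_eq_true] at he
  have h1 := he i (List.mem_range.2 hi)
  rw [List.all_eq_true] at h1
  have h2 := h1 t (by cases t <;> simp)
  rw [List.all_eq_true] at h2
  have h3 := h2 j (List.mem_range.2 (by simpa [hx] using hq.lt))
  obtain ⟨⟨w, e⟩, hw⟩ := Option.isSome_iff_exists.1 h3
  exact ⟨w, e, .of_trace hw⟩

end Trace

/-! ### Crossings and extrema as slabs -/

section Pieces

variable {A : Type*} [Monoid A]

/-- The slab that consists of the piece `p`. On a crossing the bead `a` lies on the rising line and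
the bead `b` on the falling line. Extrema of type `u₋` and `u₊` carry the beads `g` and `g⁻¹`. -/
def Piece.slab (g : Aˣ) (p : Piece) (a b : A) : Slab A where
  dom := p.dom
  cod := p.cod
  pass q := match p with
    | .crossing _ _ _ => (!q.1, 1 - q.2)
    | _ => (q.1, 1 - q.2)
  bead q := match p with
    -- The rising line is entered at position 0 of the bottom or at position 1 of the top; these are
    -- the two cases in which the equation holds.
    | .crossing _ _ _ => if (q.2 == 1) = q.1 then a else b
    | .max .up => g
    | .max .down => 1
    | .min .up => 1
    | .min .down => (g⁻¹ : Aˣ)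

/-- The slab of a slice. -/
def Slice.slab (g : Aˣ) (x : Slice) (a b : A) : Slab A :=
  (x.piece.slab g a b).whisker x.left x.right

theorem Piece.slab_valid (g : Aˣ) (p : Piece) (a b : A) : (p.slab g a b).Valid := by
  have hlt : ∀ {j : ℕ} {x y d : Dir}, [x, y][j]? = some d → j = 0 ∨ j = 1 := by
    intro j x y d h
    have := (List.getElem?_eq_some_iff.1 h).1
    simp at this
    omega
  constructor
  · rintro ⟨t, j⟩ hq
    rcases p with ⟨s, x, y⟩ | x | x <;> cases t <;>
    simp only [Slab.Enters, Slab.Leaves, Piece.slab, Slab.side, Piece.dom, Piece.cod, if_true,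
      if_false, Bool.false_eq_true, Bool.not_true, Bool.not_false, Dir.into] at hq ⊢ <;>
    first
    | (rcases hlt hq with rfl | rfl <;> simp at hq ⊢ <;> try cases x <;> simp_all [Dir.flip])
    | simp at hq
  · rintro ⟨t, j⟩ ⟨t', j'⟩ hq hq' he
    rcases p with ⟨s, x, y⟩ | x | x <;> cases t <;> cases t' <;>
    simp only [Slab.Enters, Piece.slab, Slab.side, Piece.dom, Piece.cod, if_true,
      if_false, Bool.false_eq_true, Bool.not_true, Bool.not_false, Dir.into, Prod.mk.injEq,
      reduceCtorEq, false_and, true_and] at hq hq' he ⊢ <;>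
    first
    | (rcases hlt hq with rfl | rfl <;> rcases hlt hq' with rfl | rfl <;> omega)
    | simp at hq

theorem Slice.slab_valid (g : Aˣ) (x : Slice) (a b : A) : (x.slab g a b).Valid :=
  (x.piece.slab_valid g a b).whisker _ _

/-- The slabs `ys` are those of the slices `xs`, with some beads. -/
def Decorates (g : Aˣ) (xs : List Slice) (ys : List (Slab A)) : Prop :=
  List.Forall₂ (fun x y => ∃ a b, y = x.slab g a b) xs ys

theorem Decorates.fits {g : Aˣ} {xs : List Slice} {ys : List (Slab A)} (h : Decorates g xs ys)
    {c d : List Dir} (hf : Fits c xs d) : SlabsFit c ys d := by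
  induction h generalizing c with
  | nil => exact hf
  | cons hxy _ ih =>
    obtain ⟨a, b, rfl⟩ := hxy
    exact ⟨hf.1, ih hf.2⟩

theorem Decorates.valid {g : Aˣ} {xs : List Slice} {ys : List (Slab A)} (h : Decorates g xs ys) :
    ∀ y ∈ ys, y.Valid := by
  induction h with
  | nil => simp
  | cons hxy _ ih =>
    obtain ⟨a, b, rfl⟩ := hxy
    intro y hy
    rcases List.mem_cons.1 hy with rfl | hy
    · exact Slice.slab_valid ..
    · exact ih y hy

theorem Decorates.closed {g : Aˣ} {xs : List Slice} {ys : List (Slab A)} (h : Decorates g xs ys)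
    (hf : Fits [] xs []) : SlabsClosed ys := ⟨h.fits hf, h.valid⟩

theorem Decorates.append {g : Aˣ} {xs xs' : List Slice} {ys ys' : List (Slab A)}
    (h : Decorates g xs ys) (h' : Decorates g xs' ys') : Decorates g (xs ++ xs') (ys ++ ys') :=
  List.rel_append h h'

end Pieces

/-! ### Sums over states and independence of the expansions -/

section StateSum

variable {k A : Type*} [Field k] [Ring A] [Algebra k A]

/-- Expansions of the tensors that belong to the crossings. The first factor is the bead on the
rising line, the second one the bead on the falling line. -/
abbrev CrossingExpansions (c : Bool → Dir → Dir → A ⊗[k] A) : Type _ :=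
  (s : Bool) → (x y : Dir) → Expansion (c s x y)

variable {c : Bool → Dir → Dir → A ⊗[k] A}

/-- The number of summands for the piece `p`. -/
def CrossingExpansions.count (D : CrossingExpansions c) : Piece → ℕ
  | .crossing s x y => (D s x y).n
  | .max _ => 1
  | .min _ => 1

/-- The beads in the summands for the piece `p`. -/
def CrossingExpansions.beads (D : CrossingExpansions c) : (p : Piece) → Fin (D.count p) → A × A
  | .crossing s x y => fun j => ((D s x y).fst j, (D s x y).snd j)
  | .max _ => fun _ => (1, 1)
  | .min _ => fun _ => (1, 1)

/-- The sum of the values of `F` over all choices of a summand at every crossing. -/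
def stateSum (D : CrossingExpansions c) (g : Aˣ) : List Slice → (List (Slab A) → k) → k
  | [], F => F []
  | x :: xs, F => ∑ j : Fin (D.count x.piece),
      stateSum D g xs fun ys => F (x.slab g (D.beads _ j).1 (D.beads _ j).2 :: ys)

variable {D : CrossingExpansions c} {g : Aˣ}

theorem stateSum_congr {xs : List Slice} {F F' : List (Slab A) → k}
    (h : ∀ ys, Decorates g xs ys → F ys = F' ys) : stateSum D g xs F = stateSum D g xs F' := by
  induction xs generalizing F F' with
  | nil => exact h _ .nil
  | cons x xs ih =>
    refine Finset.sum_congr rfl fun j _ => ih fun ys hys => h _ (.cons ⟨_, _, rfl⟩ hys)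

theorem stateSum_append (xs xs' : List Slice) (F : List (Slab A) → k) :
    stateSum D g (xs ++ xs') F =
      stateSum D g xs fun ys => stateSum D g xs' fun ys' => F (ys ++ ys') := by
  induction xs generalizing F with
  | nil => rfl
  | cons x xs ih =>
    refine Finset.sum_congr rfl fun j _ => ?_
    exact ih _

theorem stateSum_sum {ι : Type*} (s : Finset ι) (xs : List Slice) (F : ι → List (Slab A) → k) :
    stateSum D g xs (fun ys => ∑ i ∈ s, F i ys) = ∑ i ∈ s, stateSum D g xs (F i) := by
  induction xs generalizing F with
  | nil => rfl
  | cons x xs ih =>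
    simp only [stateSum, ih]
    exact Finset.sum_comm

/-- It allows the slabs above a local move to be chosen before those of the move. -/
theorem stateSum_comm (D D' : CrossingExpansions c) (xs xs' : List Slice)
    (F : List (Slab A) → List (Slab A) → k) :
    stateSum D g xs (fun ys => stateSum D' g xs' fun ys' => F ys ys') =
      stateSum D' g xs' fun ys' => stateSum D g xs fun ys => F ys ys' := by
  induction xs generalizing F with
  | nil => rfl
  | cons x xs ih =>
    simp only [stateSum, ih]
    rw [stateSum_sum]

theorem Expansion.sum_apply {x : A ⊗[k] A} (E : Expansion x) (B : A ⊗[k] A →ₗ[k] k) :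
    ∑ j, B (E.fst j ⊗ₜ E.snd j) = B x := by
  conv_rhs => rw [E.sum_eq, map_sum]

/-- The entry of a strand of direction `x` at the position `i` on the bottom and `j` on the top. -/
def Dir.entry (x : Dir) (i j : ℕ) : Bool × ℕ :=
  match x with
  | .up => (false, i)
  | .down => (true, j)

/-- The bead sum of a diagram, in terms of the tensors of the crossings. -/
noncomputable def diagramValue (D : CrossingExpansions c) (g : Aˣ) (T : A →ₗ[k] k)
    (xs : List Slice) : k :=
  stateSum D g xs (slabValue T)

/-- The value at a crossing only depends on the tensor. -/
theorem exists_linear_crossing {T : A →ₗ[k] k} (hT : ∀ a b, T (a * b) = T (b * a)) (g : Aˣ)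
    {l r : List Dir} {s : Bool} {x y : Dir} {below above : List (Slab A)}
    (h : SlabsClosed (below ++ [Slice.slab g ⟨l, .crossing s x y, r⟩ 1 1] ++ above)) :
    ∃ B : A ⊗[k] A →ₗ[k] k, ∀ a b,
      slabValue T (below ++ [Slice.slab g ⟨l, .crossing s x y, r⟩ a b] ++ above) =
        B (a ⊗ₜ b) := by
  have hx : ((Piece.crossing s x y).slab g (1 : A) 1).Enters (x.entry 0 1) := by
    cases x <;> rfl
  have hy : ((Piece.crossing s x y).slab g (1 : A) 1).Enters (y.entry 1 0) := by
    cases y <;> rfl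
  have hlx : (x.entry 0 1).2 < 2 := by cases x <;> decide
  have hly : (y.entry 1 0).2 < 2 := by cases y <;> decide
  have hside : ∀ a b t, (((Piece.crossing s x y).slab g (a : A) b).side t).length = 2 := by
    intro a b t
    cases t <;> rfl
  refine exists_linear_slabValue_two hT h (hx.whisker (l := l) (r := r))
    (hy.whisker (l := l) (r := r))
    (fun a b => (Slice.slab g ⟨l, .crossing s x y, r⟩ a b).bead) ?_ ?_ ?_
  · intro a b
    refine (Slab.whisker_bead_mid (by rw [hside]; exact hlx)).trans ?_
    cases x <;> simp [Piece.slab]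
  · intro a b
    refine (Slab.whisker_bead_mid (by rw [hside]; exact hly)).trans ?_
    cases y <;> simp [Piece.slab]
  · rintro a b ⟨t, j⟩ h1 h2 hE
    rcases Slab.whisker_cases l ((Piece.crossing s x y).slab g (1 : A) 1) t j with
      hj | ⟨i, rfl, hi⟩ | ⟨i, rfl⟩
    · exact (Slab.whisker_bead_left hj).trans (Slab.whisker_bead_left hj).symm
    -- Only two strands enter a crossing, one on each line, and both places have been excluded.
    · exfalso
      have hE' := (Slab.whisker_enters_mid hi).1 hE
      rw [hside] at hi
      cases x <;> cases y <;> cases t <;> interval_cases i <;>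
        simp [Slab.Enters, Piece.slab, Dir.into, Piece.dom, Piece.cod] at hE' h1 h2
    · have key : ∀ a b : A, (Slice.slab g ⟨l, .crossing s x y, r⟩ a b).bead
          (t, l.length + (((Piece.crossing s x y).slab g (1 : A) 1).side t).length + i) = 1 := by
        intro a b
        rw [hside, ← hside a b t]
        exact Slab.whisker_bead_right
      rw [key, key]

/-- The bead sum only depends on the tensors of the crossings, and not on their expansions. -/
theorem diagramValue_expansions (D D' : CrossingExpansions c) (g : Aˣ) {T : A →ₗ[k] k}
    (hT : ∀ a b, T (a * b) = T (b * a)) {xs : List Slice} (hf : Fits [] xs []) :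
    diagramValue D g T xs = diagramValue D' g T xs := by
  -- With the slabs `ys` already chosen below, the expansions can be exchanged one slice at a time.
  suffices h : ∀ ys, (∀ zs, Decorates g xs zs → SlabsClosed (ys ++ zs)) →
      stateSum D g xs (fun zs => slabValue T (ys ++ zs)) =
        stateSum D' g xs (fun zs => slabValue T (ys ++ zs)) from
    h [] fun zs h => h.closed hf
  clear hf
  induction xs with
  | nil => intro ys _; rfl
  | cons x xs ih =>
    intro ys hcl
    have h1 : ∀ a b, stateSum D g xs (fun zs => slabValue T (ys ++ x.slab g a b :: zs)) =
        stateSum D' g xs (fun zs => slabValue T (ys ++ x.slab g a b :: zs)) := by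
      intro a b
      have := ih (ys ++ [x.slab g a b]) fun zs hzs => by
        rw [List.append_assoc]
        exact hcl _ (.cons ⟨a, b, rfl⟩ hzs)
      simpa using this
    simp only [stateSum, h1]
    -- The sum over the present slice is moved innermost. There all other slabs are fixed, and it
    -- evaluates a linear form at the tensor of the crossing.
    rw [← stateSum_sum, ← stateSum_sum]
    refine stateSum_congr fun zs hzs => ?_
    obtain ⟨l, p, r⟩ := x
    rcases p with ⟨s, x, y⟩ | x | x
    · obtain ⟨B, hB⟩ := exists_linear_crossing hT g (below := ys) (above := zs) (l := l) (r := r)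
        (s := s) (x := x) (y := y) (by simpa using hcl _ (.cons ⟨1, 1, rfl⟩ hzs))
      simp only [List.append_assoc, List.singleton_append] at hB
      simp only [hB]
      exact ((D s x y).sum_apply B).trans ((D' s x y).sum_apply B).symm
    · rfl
    · rfl

end StateSum

/-! ### The stacks in the local moves -/

section Stacks

variable {A : Type*}

/-- Three strands with beads that exchange their positions. -/
def reversalSlab (x y z : Dir) (a b c : A) : Slab A where
  dom := [x, y, z]
  cod := [z, y, x]
  pass q := (!q.1, 2 - q.2)
  -- The strand between the bottom right and the top left is the one that carries `c`.
  bead q := if q.2 = 1 then b else if (q.2 == 0) = q.1 then c else a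

theorem reversalSlab_valid (x y z : Dir) (a b c : A) : (reversalSlab x y z a b c).Valid := by
  constructor
  · rintro ⟨t, j⟩ h
    have hlt := h.lt
    cases t <;> simp [reversalSlab] at hlt <;> interval_cases j <;>
      simpa [Slab.Enters, Slab.Leaves, reversalSlab] using h
  · rintro ⟨t, j⟩ ⟨t', j'⟩ h h' he
    have hlt := h.lt
    have hlt' := h'.lt
    cases t <;> cases t' <;> simp [reversalSlab] at hlt hlt' he ⊢ <;> omega

/-- A line with the bead `b` that crosses a local maximum with the bead `a`. -/
def maxSlab (x y : Dir) (a b : A) : Slab A where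
  dom := [x, y, x.flip]
  cod := [y]
  pass q := if q.1 then (false, 1) else if q.2 = 1 then (true, 0) else (false, 2 - q.2)
  bead q := if q.1 then b else if q.2 = 1 then b else a

theorem maxSlab_valid (x y : Dir) (a b : A) : (maxSlab x y a b).Valid := by
  constructor
  · rintro ⟨t, j⟩ h
    have hlt : j < 3 := h.lt.trans_le (by cases t <;> simp [maxSlab])
    cases t <;> interval_cases j <;> cases x <;> cases y <;>
      simp [Slab.Enters, Slab.Leaves, maxSlab, Dir.into, Dir.flip] at h ⊢
  · rintro ⟨t, j⟩ ⟨t', j'⟩ h h' he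
    have hlt : j < 3 := h.lt.trans_le (by cases t <;> simp [maxSlab])
    have hlt' : j' < 3 := h'.lt.trans_le (by cases t' <;> simp [maxSlab])
    cases t <;> cases t' <;> interval_cases j <;>
      interval_cases j' <;>
      simp [maxSlab, Slab.Enters] at he h h' ⊢

/-- A line with the bead `b` that crosses a local minimum with the bead `a`. -/
def minSlab (x y : Dir) (a b : A) : Slab A where
  dom := [y]
  cod := [x, y, x.flip]
  pass q := if !q.1 then (true, 1) else if q.2 = 1 then (false, 0) else (true, 2 - q.2)
  bead q := if !q.1 then b else if q.2 = 1 then b else a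

theorem minSlab_valid (x y : Dir) (a b : A) : (minSlab x y a b).Valid := by
  constructor
  · rintro ⟨t, j⟩ h
    have hlt : j < 3 := h.lt.trans_le (by cases t <;> simp [minSlab])
    cases t <;> interval_cases j <;> cases x <;> cases y <;>
      simp [Slab.Enters, Slab.Leaves, minSlab, Dir.into, Dir.flip] at h ⊢
  · rintro ⟨t, j⟩ ⟨t', j'⟩ h h' he
    have hlt : j < 3 := h.lt.trans_le (by cases t <;> simp [minSlab])
    have hlt' : j' < 3 := h'.lt.trans_le (by cases t' <;> simp [minSlab])
    cases t <;> cases t' <;> interval_cases j <;>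
      interval_cases j' <;>
      simp [minSlab, Slab.Enters] at he h h' ⊢

variable [Monoid A]

/-- The product of the beads `a`, `b` met by a strand of direction `x` from bottom to top. -/
def Dir.mul (x : Dir) (a b : A) : A :=
  match x with
  | .up => a * b
  | .down => b * a

/-- `β` is the literal output of the trace, with a factor 1 for each slab passed vertically, so that
the transits hold by `rfl`. It matches the intended beads only at places where a strand enters, and
this suffices. The other stacks below are treated in the same way. -/
theorem reversalSlab_represents_left (g : Aˣ) (s : Bool) (x y z : Dir) (a a' b b' c c' : A) :
    ∃ β, (∀ q, (reversalSlab x y z (1 : A) 1 1).Enters q →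
        β q = (reversalSlab x y z (x.mul a b) (y.mul a' c) (z.mul b' c')).bead q) ∧
      ((reversalSlab x y z (1 : A) 1 1).withBead β).Represents
        [((Piece.crossing s x y).slab g a a').whisker [] [z],
          ((Piece.crossing s x z).slab g b b').whisker [y] [],
          ((Piece.crossing s y z).slab g c c').whisker [] [x]] := by
  refine ⟨fun q =>
    if q.1 then (if q.2 = 0 then c' * (b' * 1) else if q.2 = 1 then c * (1 * a') else 1 * (b * a))
    else if q.2 = 0 then a * (b * 1) else if q.2 = 1 then a' * (1 * c) else 1 * (b' * c'),
    ?_, ?_⟩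
  · rintro ⟨t, j⟩ h
    have hlt := h.lt
    cases t <;> simp [reversalSlab] at hlt <;> interval_cases j <;>
      cases x <;> cases y <;> cases z <;>
      simp [Slab.Enters, reversalSlab, Dir.into, Dir.mul] at h ⊢
  · refine .of_trace 4 (by simp) ⟨rfl, rfl, rfl, rfl⟩ ?_ ?_ ?_ rfl
    · simp [Slab.Valid.whisker, Piece.slab_valid]
    · intro j hj
      replace hj : j < 3 := hj
      interval_cases j <;> rfl
    · intro j hj
      replace hj : j < 3 := hj
      interval_cases j <;> rfl

theorem reversalSlab_represents_right (g : Aˣ) (s : Bool) (x y z : Dir) (a a' b b' c c' : A) :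
    ∃ β, (∀ q, (reversalSlab x y z (1 : A) 1 1).Enters q →
        β q = (reversalSlab x y z (x.mul b a) (y.mul c a') (z.mul c' b')).bead q) ∧
      ((reversalSlab x y z (1 : A) 1 1).withBead β).Represents
        [((Piece.crossing s y z).slab g c c').whisker [x] [],
          ((Piece.crossing s x z).slab g b b').whisker [] [y],
          ((Piece.crossing s x y).slab g a a').whisker [z] []] := by
  refine ⟨fun q =>
    if q.1 then (if q.2 = 0 then 1 * (b' * c') else if q.2 = 1 then a' * (1 * c) else a * (b * 1))
    else if q.2 = 0 then 1 * (b * a) else if q.2 = 1 then c * (1 * a') else c' * (b' * 1),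
    ?_, ?_⟩
  · rintro ⟨t, j⟩ h
    have hlt := h.lt
    cases t <;> simp [reversalSlab] at hlt <;> interval_cases j <;>
      cases x <;> cases y <;> cases z <;>
      simp [Slab.Enters, reversalSlab, Dir.into, Dir.mul] at h ⊢
  · refine .of_trace 4 (by simp) ⟨rfl, rfl, rfl, rfl⟩ ?_ ?_ ?_ rfl
    · simp [Slab.Valid.whisker, Piece.slab_valid]
    · intro j hj
      replace hj : j < 3 := hj
      interval_cases j <;> rfl
    · intro j hj
      replace hj : j < 3 := hj
      interval_cases j <;> rfl

/-- Two vertical strands with beads. -/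
def parallelSlab (x y : Dir) (a b : A) : Slab A where
  dom := [x, y]
  cod := [x, y]
  pass q := (!q.1, q.2)
  bead q := if q.2 = 0 then a else b

theorem parallelSlab_straight (x y : Dir) : (parallelSlab x y (1 : A) 1).Straight :=
  ⟨rfl, fun _ _ => rfl, fun _ _ => ite_self _⟩

theorem parallelSlab_represents (g : Aˣ) (s s' : Bool) (x y : Dir) (a a' b b' : A) :
    ∃ β, (∀ q, (parallelSlab x y (1 : A) 1).Enters q →
        β q = (parallelSlab x y (x.mul a b') (y.mul a' b)).bead q) ∧
      ((parallelSlab x y (1 : A) 1).withBead β).Represents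
        [((Piece.crossing s x y).slab g a a').whisker [] [],
          ((Piece.crossing s' y x).slab g b b').whisker [] []] := by
  refine ⟨fun q =>
    if q.1 then (if q.2 = 0 then b' * a else b * a') else if q.2 = 0 then a * b' else a' * b,
    ?_, ?_⟩
  · rintro ⟨t, j⟩ h
    have hlt := h.lt
    cases t <;> simp [parallelSlab] at hlt <;> interval_cases j <;>
      cases x <;> cases y <;>
      simp [Slab.Enters, parallelSlab, Dir.into, Dir.mul] at h ⊢
  · refine .of_trace 3 (by simp) ⟨rfl, rfl, rfl⟩ ?_ ?_ ?_ rfl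
    · simp [Slab.Valid.whisker, Piece.slab_valid]
    · intro j hj
      replace hj : j < 2 := hj
      interval_cases j <;> rfl
    · intro j hj
      replace hj : j < 2 := hj
      interval_cases j <;> rfl

/-- One vertical strand with a bead. -/
def lineSlab (x : Dir) (β : Bool × ℕ → A) : Slab A where
  dom := [x]
  cod := [x]
  pass q := (!q.1, q.2)
  bead := β

/-- The two extrema of an S-shaped arc are either `u₋` and `u₊`, with the beads `g` and `g⁻¹`, or
both of type `d`, with beads 1. In either case the beads cancel. -/
theorem lineSlab_represents_left (g : Aˣ) (x : Dir) (a a' b b' : A) :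
    ∃ β, (lineSlab x β).Straight ∧ (lineSlab x β).Represents
      [((Piece.min x.flip).slab g a a').whisker [x] [],
        ((Piece.max x).slab g b b').whisker [] [x]] := by
  let u : A := match x with
    | .up => g
    | .down => 1
  let v : A := match x with
    | .up => (g⁻¹ : Aˣ)
    | .down => 1
  refine ⟨fun q => if q.1 then 1 * (v * (u * 1)) else 1 * (u * (v * 1)),
    ⟨rfl, fun _ _ => rfl, ?_⟩, ?_⟩
  · rintro ⟨t, j⟩ _
    cases x <;> cases t <;> simp [lineSlab, u, v]
  · cases x
    · refine .of_trace 5 (by simp) ⟨rfl, rfl, rfl⟩ ?_ ?_ ?_ rfl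
      · simp [Slab.Valid.whisker, Piece.slab_valid]
      · intro j hj
        obtain rfl : j = 0 := Nat.lt_one_iff.1 hj
        rfl
      · intro j hj
        obtain rfl : j = 0 := Nat.lt_one_iff.1 hj
        rfl
    · refine .of_trace 5 (by simp) ⟨rfl, rfl, rfl⟩ ?_ ?_ ?_ rfl
      · simp [Slab.Valid.whisker, Piece.slab_valid]
      · intro j hj
        obtain rfl : j = 0 := Nat.lt_one_iff.1 hj
        rfl
      · intro j hj
        obtain rfl : j = 0 := Nat.lt_one_iff.1 hj
        rfl

theorem lineSlab_represents_right (g : Aˣ) (x : Dir) (a a' b b' : A) :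
    ∃ β, (lineSlab x β).Straight ∧ (lineSlab x β).Represents
      [((Piece.min x).slab g a a').whisker [] [x],
        ((Piece.max x.flip).slab g b b').whisker [x] []] := by
  let u : A := match x with
    | .down => g
    | .up => 1
  let v : A := match x with
    | .down => (g⁻¹ : Aˣ)
    | .up => 1
  refine ⟨fun q => if q.1 then 1 * (v * (u * 1)) else 1 * (u * (v * 1)),
    ⟨rfl, fun _ _ => rfl, ?_⟩, ?_⟩
  · rintro ⟨t, j⟩ _
    cases x <;> cases t <;> simp [lineSlab, u, v]
  · cases x
    · refine .of_trace 5 (by simp) ⟨rfl, rfl, rfl⟩ ?_ ?_ ?_ rfl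
      · simp [Slab.Valid.whisker, Piece.slab_valid]
      · intro j hj
        obtain rfl : j = 0 := Nat.lt_one_iff.1 hj
        rfl
      · intro j hj
        obtain rfl : j = 0 := Nat.lt_one_iff.1 hj
        rfl
    · refine .of_trace 5 (by simp) ⟨rfl, rfl, rfl⟩ ?_ ?_ ?_ rfl
      · simp [Slab.Valid.whisker, Piece.slab_valid]
      · intro j hj
        obtain rfl : j = 0 := Nat.lt_one_iff.1 hj
        rfl
      · intro j hj
        obtain rfl : j = 0 := Nat.lt_one_iff.1 hj
        rfl

/-- The bead on a local maximum whose left end has direction `x`. -/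
def Dir.maxBead (g : Aˣ) : Dir → A
  | .up => g
  | .down => 1

/-- The bead on a local minimum whose left end has direction `x`. -/
def Dir.minBead (g : Aˣ) : Dir → A
  | .up => 1
  | .down => (g⁻¹ : Aˣ)

/-- The line crosses only one leg of the arc. The bead of the arc is therefore that of the crossing
and that of the extremum, multiplied in the order of travel; crossing the other leg reverses this
order. -/
theorem maxSlab_represents_left (g : Aˣ) (s : Bool) (x y : Dir) (a a' c c' : A) :
    ∃ β, (∀ q, (maxSlab x y (1 : A) 1).Enters q →
        β q = (maxSlab x y (x.mul a (x.maxBead g)) a').bead q) ∧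
      ((maxSlab x y (1 : A) 1).withBead β).Represents
        [((Piece.crossing s x y).slab g a a').whisker [] [x.flip],
          ((Piece.max x).slab g c c').whisker [y] []] := by
  refine ⟨fun q =>
    if q.1 then 1 * a' else if q.2 = 0 then a * (x.maxBead g * 1) else if q.2 = 1 then a' * 1 else
      1 * (x.maxBead g * a), ?_, ?_⟩
  · rintro ⟨t, j⟩ h
    have hlt : j < 3 := h.lt.trans_le (by cases t <;> simp [maxSlab])
    cases t <;> interval_cases j <;>
      cases x <;> cases y <;>
      simp [Slab.Enters, maxSlab, Dir.into, Dir.mul, Dir.flip] at h ⊢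
  · refine .of_trace 4 (by simp) ⟨rfl, rfl, rfl⟩ ?_ ?_ ?_ rfl
    · simp [Slab.Valid.whisker, Piece.slab_valid]
    · intro j hj
      replace hj : j < 3 := hj
      cases x <;> interval_cases j <;> rfl
    · intro j hj
      obtain rfl : j = 0 := Nat.lt_one_iff.1 hj
      rfl

theorem maxSlab_represents_right (g : Aˣ) (s : Bool) (x y : Dir) (a a' c c' : A) :
    ∃ β, (∀ q, (maxSlab x y (1 : A) 1).Enters q →
        β q = (maxSlab x y (x.mul (x.maxBead g) a') a).bead q) ∧
      ((maxSlab x y (1 : A) 1).withBead β).Represents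
        [((Piece.crossing s y x.flip).slab g a a').whisker [x] [],
          ((Piece.max x).slab g c c').whisker [] [y]] := by
  refine ⟨fun q =>
    if q.1 then 1 * a else if q.2 = 0 then 1 * (x.maxBead g * a') else if q.2 = 1 then a * 1 else
      a' * (x.maxBead g * 1), ?_, ?_⟩
  · rintro ⟨t, j⟩ h
    have hlt : j < 3 := h.lt.trans_le (by cases t <;> simp [maxSlab])
    cases t <;> interval_cases j <;>
      cases x <;> cases y <;>
      simp [Slab.Enters, maxSlab, Dir.into, Dir.mul, Dir.flip] at h ⊢
  · refine .of_trace 4 (by simp) ⟨rfl, rfl, rfl⟩ ?_ ?_ ?_ rfl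
    · simp [Slab.Valid.whisker, Piece.slab_valid]
    · intro j hj
      replace hj : j < 3 := hj
      cases x <;> interval_cases j <;> rfl
    · intro j hj
      obtain rfl : j = 0 := Nat.lt_one_iff.1 hj
      rfl

theorem minSlab_represents_left (g : Aˣ) (s : Bool) (x y : Dir) (a a' c c' : A) :
    ∃ β, (∀ q, (minSlab x y (1 : A) 1).Enters q →
        β q = (minSlab x y (x.mul (x.minBead g) a') a).bead q) ∧
      ((minSlab x y (1 : A) 1).withBead β).Represents
        [((Piece.min x).slab g c c').whisker [y] [],
          ((Piece.crossing s y x).slab g a a').whisker [] [x.flip]] := by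
  refine ⟨fun q =>
    if !q.1 then 1 * a else if q.2 = 0 then a' * (x.minBead g * 1) else if q.2 = 1 then a * 1 else
      1 * (x.minBead g * a'), ?_, ?_⟩
  · rintro ⟨t, j⟩ h
    have hlt : j < 3 := h.lt.trans_le (by cases t <;> simp [minSlab])
    cases t <;> interval_cases j <;>
      cases x <;> cases y <;>
      simp [Slab.Enters, minSlab, Dir.into, Dir.mul, Dir.flip] at h ⊢
  · refine .of_trace 4 (by simp) ⟨rfl, rfl, rfl⟩ ?_ ?_ ?_ rfl
    · simp [Slab.Valid.whisker, Piece.slab_valid]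
    · intro j hj
      obtain rfl : j = 0 := Nat.lt_one_iff.1 hj
      rfl
    · intro j hj
      replace hj : j < 3 := hj
      cases x <;> interval_cases j <;> rfl

theorem minSlab_represents_right (g : Aˣ) (s : Bool) (x y : Dir) (a a' c c' : A) :
    ∃ β, (∀ q, (minSlab x y (1 : A) 1).Enters q →
        β q = (minSlab x y (x.mul a (x.minBead g)) a').bead q) ∧
      ((minSlab x y (1 : A) 1).withBead β).Represents
        [((Piece.min x).slab g c c').whisker [] [y],
          ((Piece.crossing s x.flip y).slab g a a').whisker [x] []] := by
  refine ⟨fun q =>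
    if !q.1 then 1 * a' else if q.2 = 0 then 1 * (x.minBead g * a) else if q.2 = 1 then a' * 1 else
      a * (x.minBead g * 1), ?_, ?_⟩
  · rintro ⟨t, j⟩ h
    have hlt : j < 3 := h.lt.trans_le (by cases t <;> simp [minSlab])
    cases t <;> interval_cases j <;>
      cases x <;> cases y <;>
      simp [Slab.Enters, minSlab, Dir.into, Dir.mul, Dir.flip] at h ⊢
  · refine .of_trace 4 (by simp) ⟨rfl, rfl, rfl⟩ ?_ ?_ ?_ rfl
    · simp [Slab.Valid.whisker, Piece.slab_valid]
    · intro j hj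
      obtain rfl : j = 0 := Nat.lt_one_iff.1 hj
      rfl
    · intro j hj
      replace hj : j < 3 := hj
      cases x <;> interval_cases j <;> rfl

end Stacks

/-! ### The tensor identities behind the local moves -/

section Algebra

variable {k A : Type*} [Field k] [Ring A] [Algebra k A]

/-- Conjugation with `g`. -/
def conjLinear (k : Type*) {A : Type*} [Field k] [Ring A] [Algebra k A] (g : Aˣ) : A →ₗ[k] A :=
  LinearMap.mulLeft k (g : A) ∘ₗ LinearMap.mulRight k ((g⁻¹ : Aˣ) : A)

@[simp] theorem conjLinear_apply (g : Aˣ) (a : A) :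
    conjLinear k g a = g * (a * (g⁻¹ : Aˣ)) := rfl

/-- The product of two tensors when the strands have the directions `x` and `y`. -/
noncomputable def Dir.mulTensor (k : Type*) (A : Type*) [Field k] [Ring A] [Algebra k A]
    (x y : Dir) : A ⊗[k] A →ₗ[k] A ⊗[k] A →ₗ[k] A ⊗[k] A :=
  let m : Dir → (A →ₗ[k] A →ₗ[k] A) := fun
    | .up => LinearMap.mul k A
    | .down => (LinearMap.mul k A).flip
  TensorProduct.map₂ (m x) (m y)

@[simp] theorem Dir.mulTensor_tmul (x y : Dir) (a a' b b' : A) :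
    x.mulTensor k A y (a ⊗ₜ a') (b ⊗ₜ b') = (x.mul a b) ⊗ₜ (y.mul a' b') := by
  cases x <;> cases y <;> rfl

/-- The tensor `r`, with the inverse `r'`, satisfies the axioms of a standard twist oriented quantum
algebra with the invertible element `g`. -/
structure BraidTensor (g : Aˣ) (r r' : A ⊗[k] A) : Prop where
  mul_inv : r * r' = 1
  inv_mul : r' * r = 1
  conj : TensorProduct.map (conjLinear k g) (conjLinear k g) r = r
  conj' : TensorProduct.map (conjLinear k g) (conjLinear k g) r' = r'
  op_mul : Dir.mulTensor k A .up .down r' (TensorProduct.map .id (conjLinear k g) r) = 1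
  mul_op : Dir.mulTensor k A .up .down (TensorProduct.map .id (conjLinear k g) r) r' = 1
  yang_baxter : leg12 k A r * leg13 k A r * leg23 k A r = leg23 k A r * leg13 k A r * leg12 k A r

/-- The tensor of a crossing with a rising line of direction `x` and a falling line of direction
`y`. The first factor belongs to the rising line. -/
noncomputable def orientedTensor (g : Aˣ) (r r' : A ⊗[k] A) : Dir → Dir → A ⊗[k] A
  | .up, .up => r
  | .down, .down => r
  -- This is the decoration `t_u(E) ⊗ E'` after `t_d` has been applied on the line directed up,
  -- where t_d t_u is conjugation with `g`.
  | .up, .down => TensorProduct.map (conjLinear k g) .id r'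
  | .down, .up => r'

/-! ### Yang--Baxter equations for strands of all directions -/

section Place

variable {B₁ B₂ B₃ : Type*} [Ring B₁] [Ring B₂] [Ring B₃] [Algebra k B₁] [Algebra k B₂]
  [Algebra k B₃]

/-- A unital map that preserves the order of products for the direction `up` and reverses it for
the direction `down`. -/
structure Dir.IsHom (x : Dir) {B : Type*} [Ring B] [Algebra k B] (e : A →ₗ[k] B) : Prop where
  map_mul : ∀ a b, e (x.mul a b) = e a * e b
  map_one : e 1 = 1

/-- Conjugation is an automorphism of the algebra and of its opposite. Twisting an embedding by it
absorbs the conjugations in the tensors of antiparallel strands. -/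
theorem Dir.IsHom.conj {x : Dir} {B : Type*} [Ring B] [Algebra k B] {e : A →ₗ[k] B}
    (h : x.IsHom e) (g : Aˣ) : x.IsHom (e ∘ₗ conjLinear k g) := by
  refine ⟨fun a b => ?_, by simp [h.map_one]⟩
  rw [LinearMap.comp_apply, LinearMap.comp_apply, LinearMap.comp_apply, ← h.map_mul]
  congr 1
  cases x <;> simp [Dir.mul, mul_assoc]

/-- `a ⊗ b ↦ a ⊗ b ⊗ 1`. -/
noncomputable def place12 (B₃ : Type*) [Ring B₃] [Algebra k B₃] (e₁ : A →ₗ[k] B₁)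
    (e₂ : A →ₗ[k] B₂) : A ⊗[k] A →ₗ[k] B₁ ⊗[k] (B₂ ⊗[k] B₃) :=
  TensorProduct.map e₁
    ((Algebra.TensorProduct.includeLeft : B₂ →ₐ[k] B₂ ⊗[k] B₃).toLinearMap ∘ₗ e₂)

/-- `a ⊗ b ↦ a ⊗ 1 ⊗ b`. -/
noncomputable def place13 (B₂ : Type*) [Ring B₂] [Algebra k B₂] (e₁ : A →ₗ[k] B₁)
    (e₃ : A →ₗ[k] B₃) : A ⊗[k] A →ₗ[k] B₁ ⊗[k] (B₂ ⊗[k] B₃) :=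
  TensorProduct.map e₁
    ((Algebra.TensorProduct.includeRight : B₃ →ₐ[k] B₂ ⊗[k] B₃).toLinearMap ∘ₗ e₃)

/-- `a ⊗ b ↦ 1 ⊗ a ⊗ b`. -/
noncomputable def place23 (B₁ : Type*) [Ring B₁] [Algebra k B₁] (e₂ : A →ₗ[k] B₂)
    (e₃ : A →ₗ[k] B₃) : A ⊗[k] A →ₗ[k] B₁ ⊗[k] (B₂ ⊗[k] B₃) :=
  (Algebra.TensorProduct.includeRight : B₂ ⊗[k] B₃ →ₐ[k] B₁ ⊗[k] (B₂ ⊗[k] B₃)).toLinearMap ∘ₗ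
    TensorProduct.map e₂ e₃

@[simp] theorem place12_tmul (e₁ : A →ₗ[k] B₁) (e₂ : A →ₗ[k] B₂) (a b : A) :
    place12 B₃ e₁ e₂ (a ⊗ₜ b) = e₁ a ⊗ₜ (e₂ b ⊗ₜ 1) := rfl

@[simp] theorem place13_tmul (e₁ : A →ₗ[k] B₁) (e₃ : A →ₗ[k] B₃) (a b : A) :
    place13 B₂ e₁ e₃ (a ⊗ₜ b) = e₁ a ⊗ₜ (1 ⊗ₜ e₃ b) := rfl

@[simp] theorem place23_tmul (e₂ : A →ₗ[k] B₂) (e₃ : A →ₗ[k] B₃) (a b : A) :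
    place23 B₁ e₂ e₃ (a ⊗ₜ b) = 1 ⊗ₜ (e₂ a ⊗ₜ e₃ b) := rfl

/-- Two functions of three tensors that are additive in each of them agree if they agree on pure
tensors. -/
theorem tensor_induction_three {M : Type*} [AddCommGroup M]
    {F F' : A ⊗[k] A → A ⊗[k] A → A ⊗[k] A → M}
    (hF : ∀ a a' b b' c c', F (a ⊗ₜ a') (b ⊗ₜ b') (c ⊗ₜ c') = F' (a ⊗ₜ a') (b ⊗ₜ b') (c ⊗ₜ c'))
    (h₁ : ∀ u u' v w, F (u + u') v w = F u v w + F u' v w)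
    (h₂ : ∀ u v v' w, F u (v + v') w = F u v w + F u v' w)
    (h₃ : ∀ u v w w', F u v (w + w') = F u v w + F u v w')
    (h₁' : ∀ u u' v w, F' (u + u') v w = F' u v w + F' u' v w)
    (h₂' : ∀ u v v' w, F' u (v + v') w = F' u v w + F' u v' w)
    (h₃' : ∀ u v w w', F' u v (w + w') = F' u v w + F' u v w') (u v w : A ⊗[k] A) :
    F u v w = F' u v w := by
  induction u with
  | zero =>
    -- Additivity at 0 + 0 forces the value at 0 to vanish.
    have h := h₁ 0 0 v w
    have h' := h₁' 0 0 v w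
    rw [add_zero, right_eq_add] at h h'
    rw [h, h']
  | add u u' hu hu' => rw [h₁, h₁', hu, hu']
  | tmul a a' =>
    induction v with
    | zero =>
      have h := h₂ (a ⊗ₜ a') 0 0 w
      have h' := h₂' (a ⊗ₜ a') 0 0 w
      rw [add_zero, right_eq_add] at h h'
      rw [h, h']
    | add v v' hv hv' => rw [h₂, h₂', hv, hv']
    | tmul b b' =>
      induction w with
      | zero =>
        have h := h₃ (a ⊗ₜ a') (b ⊗ₜ b') 0 0
        have h' := h₃' (a ⊗ₜ a') (b ⊗ₜ b') 0 0
        rw [add_zero, right_eq_add] at h h'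
        rw [h, h']
      | add w w' hw hw' => rw [h₃, h₃', hw, hw']
      | tmul c c' => exact hF a a' b b' c c'

variable {e₁ : A →ₗ[k] B₁} {e₂ : A →ₗ[k] B₂} {e₃ : A →ₗ[k] B₃}

theorem place12_mul (x y : Dir) (h₁ : x.IsHom e₁) (h₂ : y.IsHom e₂) (u v : A ⊗[k] A) :
    place12 B₃ e₁ e₂ (x.mulTensor k A y u v) = place12 B₃ e₁ e₂ u * place12 B₃ e₁ e₂ v := by
  induction u with
  | zero => simp
  | add u u' hu hu' => simp only [map_add, LinearMap.add_apply, hu, hu', add_mul]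
  | tmul a a' =>
    induction v with
    | zero => simp
    | add v v' hv hv' => simp only [map_add, hv, hv', mul_add]
    | tmul b b' => simp [h₁.map_mul, h₂.map_mul]

theorem place13_mul (x y : Dir) (h₁ : x.IsHom e₁) (h₃ : y.IsHom e₃) (u v : A ⊗[k] A) :
    place13 B₂ e₁ e₃ (x.mulTensor k A y u v) = place13 B₂ e₁ e₃ u * place13 B₂ e₁ e₃ v := by
  induction u with
  | zero => simp
  | add u u' hu hu' => simp only [map_add, LinearMap.add_apply, hu, hu', add_mul]
  | tmul a a' =>
    induction v with
    | zero => simp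
    | add v v' hv hv' => simp only [map_add, hv, hv', mul_add]
    | tmul b b' => simp [h₁.map_mul, h₃.map_mul]

theorem place23_mul (x y : Dir) (h₂ : x.IsHom e₂) (h₃ : y.IsHom e₃) (u v : A ⊗[k] A) :
    place23 B₁ e₂ e₃ (x.mulTensor k A y u v) = place23 B₁ e₂ e₃ u * place23 B₁ e₂ e₃ v := by
  induction u with
  | zero => simp
  | add u u' hu hu' => simp only [map_add, LinearMap.add_apply, hu, hu', add_mul]
  | tmul a a' =>
    induction v with
    | zero => simp
    | add v v' hv hv' => simp only [map_add, hv, hv', mul_add]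
    | tmul b b' => simp [h₂.map_mul, h₃.map_mul]

theorem place12_one (x y : Dir) (h₁ : x.IsHom e₁) (h₂ : y.IsHom e₂) :
    place12 B₃ e₁ e₂ 1 = 1 := by
  simp [Algebra.TensorProduct.one_def, h₁.map_one, h₂.map_one]

theorem place13_one (x y : Dir) (h₁ : x.IsHom e₁) (h₃ : y.IsHom e₃) :
    place13 B₂ e₁ e₃ 1 = 1 := by
  simp [Algebra.TensorProduct.one_def, h₁.map_one, h₃.map_one]

theorem place23_one (x y : Dir) (h₂ : x.IsHom e₂) (h₃ : y.IsHom e₃) :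
    place23 B₁ e₂ e₃ 1 = 1 := by
  simp [Algebra.TensorProduct.one_def, h₂.map_one, h₃.map_one]

/-- The Yang--Baxter equation in the order in which it holds for three strands, up to inversion of
one of the factors. -/
theorem BraidTensor.place_yang_baxter {g : Aˣ} {r r' : A ⊗[k] A} (H : BraidTensor g r r') :
    ∀ x y z : Dir, x.IsHom e₁ → y.IsHom e₂ → z.IsHom e₃ →
    match x, y, z with
    | .up, .up, .up => place12 B₃ e₁ e₂ r * place13 B₂ e₁ e₃ r * place23 B₁ e₂ e₃ r =
        place23 B₁ e₂ e₃ r * place13 B₂ e₁ e₃ r * place12 B₃ e₁ e₂ r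
    | .down, .down, .down => place12 B₃ e₁ e₂ r * place13 B₂ e₁ e₃ r * place23 B₁ e₂ e₃ r =
        place23 B₁ e₂ e₃ r * place13 B₂ e₁ e₃ r * place12 B₃ e₁ e₂ r
    | .up, .up, .down => place12 B₃ e₁ e₂ r * place23 B₁ e₂ e₃ r * place13 B₂ e₁ e₃ r =
        place13 B₂ e₁ e₃ r * place23 B₁ e₂ e₃ r * place12 B₃ e₁ e₂ r
    | .down, .down, .up => place12 B₃ e₁ e₂ r * place23 B₁ e₂ e₃ r * place13 B₂ e₁ e₃ r =
        place13 B₂ e₁ e₃ r * place23 B₁ e₂ e₃ r * place12 B₃ e₁ e₂ r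
    | .down, .up, .up => place13 B₂ e₁ e₃ r * place12 B₃ e₁ e₂ r * place23 B₁ e₂ e₃ r =
        place23 B₁ e₂ e₃ r * place12 B₃ e₁ e₂ r * place13 B₂ e₁ e₃ r
    | .up, .down, .down => place13 B₂ e₁ e₃ r * place12 B₃ e₁ e₂ r * place23 B₁ e₂ e₃ r =
        place23 B₁ e₂ e₃ r * place12 B₃ e₁ e₂ r * place13 B₂ e₁ e₃ r
    | .up, .down, .up => place12 B₃ e₁ e₂ r * place23 B₁ e₂ e₃ r' * place13 B₂ e₁ e₃ r =
        place13 B₂ e₁ e₃ r * place23 B₁ e₂ e₃ r' * place12 B₃ e₁ e₂ r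
    | .down, .up, .down => place23 B₁ e₂ e₃ r * place12 B₃ e₁ e₂ r' * place13 B₂ e₁ e₃ r =
        place13 B₂ e₁ e₃ r * place12 B₃ e₁ e₂ r' * place23 B₁ e₂ e₃ r := by
  have i12 : leg12 k A r * leg12 k A r' = 1 := by rw [← map_mul, H.mul_inv, map_one]
  have i12' : leg12 k A r' * leg12 k A r = 1 := by rw [← map_mul, H.inv_mul, map_one]
  have i23 : leg23 k A r * leg23 k A r' = 1 := by rw [← map_mul, H.mul_inv, map_one]
  have i23' : leg23 k A r' * leg23 k A r = 1 := by rw [← map_mul, H.inv_mul, map_one]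
  have yb := H.yang_baxter
  -- The factor at 23 is carried to the other side, for a middle strand opposed to the outer ones.
  -- In `yb3` the same is done with the factor at 12.
  have yb2 : leg23 k A r' * leg12 k A r * leg13 k A r =
      leg13 k A r * leg12 k A r * leg23 k A r' := by
    calc leg23 k A r' * leg12 k A r * leg13 k A r
        = leg23 k A r' * (leg12 k A r * leg13 k A r * leg23 k A r) * leg23 k A r' := by
          simp only [mul_assoc, i23, mul_one]
      _ = _ := by rw [yb]; simp only [← mul_assoc, i23', one_mul]
  have yb3 : leg13 k A r * leg23 k A r * leg12 k A r' =
      leg12 k A r' * leg23 k A r * leg13 k A r := by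
    calc leg13 k A r * leg23 k A r * leg12 k A r'
        = leg12 k A r' * (leg12 k A r * leg13 k A r * leg23 k A r) * leg12 k A r' := by
          simp only [← mul_assoc, i12', one_mul]
      _ = _ := by rw [yb]; simp only [mul_assoc, i12, mul_one]
  intro x y z h₁ h₂ h₃
  -- `Θ` is only linear: a leg directed down reverses the products in that leg. In each case the
  -- factors are arranged so that, leg by leg, the product of the images is the image under `Θ` of
  -- one side of a Yang--Baxter equation; this is then compared on pure tensors.
  let Θ : A ⊗[k] (A ⊗[k] A) →ₗ[k] B₁ ⊗[k] (B₂ ⊗[k] B₃) :=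
    TensorProduct.map e₁ (TensorProduct.map e₂ e₃)
  replace yb := congrArg Θ yb
  replace yb2 := congrArg Θ yb2
  replace yb3 := congrArg Θ yb3
  have m₁ := h₁.map_mul
  have m₂ := h₂.map_mul
  have m₃ := h₃.map_mul
  cases x <;> cases y <;> cases z <;> simp only [Dir.mul] at m₁ m₂ m₃ ⊢
  case up.up.up =>
    convert yb using 1
    · refine tensor_induction_three
        (F := fun u v w => place12 B₃ e₁ e₂ u * place13 B₂ e₁ e₃ v * place23 B₁ e₂ e₃ w)
        (F' := fun u v w => Θ (leg12 k A u * leg13 k A v * leg23 k A w)) ?_ ?_ ?_ ?_ ?_ ?_ ?_ r r r <;> intros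
      · simp [Θ, leg12, leg13, leg23, m₁, m₂, m₃]
      all_goals simp only [map_add, add_mul, mul_add]
    · refine tensor_induction_three
        (F := fun u v w => place23 B₁ e₂ e₃ w * place13 B₂ e₁ e₃ v * place12 B₃ e₁ e₂ u)
        (F' := fun u v w => Θ (leg23 k A w * leg13 k A v * leg12 k A u)) ?_ ?_ ?_ ?_ ?_ ?_ ?_ r r r <;> intros
      · simp [Θ, leg12, leg13, leg23, m₁, m₂, m₃]
      all_goals simp only [map_add, add_mul, mul_add]
  case down.down.down =>
    convert yb.symm using 1
    · refine tensor_induction_three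
        (F := fun u v w => place12 B₃ e₁ e₂ u * place13 B₂ e₁ e₃ v * place23 B₁ e₂ e₃ w)
        (F' := fun u v w => Θ (leg23 k A w * leg13 k A v * leg12 k A u)) ?_ ?_ ?_ ?_ ?_ ?_ ?_ r r r <;> intros
      · simp [Θ, leg12, leg13, leg23, m₁, m₂, m₃]
      all_goals simp only [map_add, add_mul, mul_add]
    · refine tensor_induction_three
        (F := fun u v w => place23 B₁ e₂ e₃ w * place13 B₂ e₁ e₃ v * place12 B₃ e₁ e₂ u)
        (F' := fun u v w => Θ (leg12 k A u * leg13 k A v * leg23 k A w)) ?_ ?_ ?_ ?_ ?_ ?_ ?_ r r r <;> intros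
      · simp [Θ, leg12, leg13, leg23, m₁, m₂, m₃]
      all_goals simp only [map_add, add_mul, mul_add]
  case up.up.down =>
    convert yb using 1
    · refine tensor_induction_three
        (F := fun u v w => place12 B₃ e₁ e₂ u * place23 B₁ e₂ e₃ w * place13 B₂ e₁ e₃ v)
        (F' := fun u v w => Θ (leg12 k A u * leg13 k A v * leg23 k A w)) ?_ ?_ ?_ ?_ ?_ ?_ ?_ r r r <;> intros
      · simp [Θ, leg12, leg13, leg23, m₁, m₂, m₃]
      all_goals simp only [map_add, add_mul, mul_add]
    · refine tensor_induction_three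
        (F := fun u v w => place13 B₂ e₁ e₃ v * place23 B₁ e₂ e₃ w * place12 B₃ e₁ e₂ u)
        (F' := fun u v w => Θ (leg23 k A w * leg13 k A v * leg12 k A u)) ?_ ?_ ?_ ?_ ?_ ?_ ?_ r r r <;> intros
      · simp [Θ, leg12, leg13, leg23, m₁, m₂, m₃]
      all_goals simp only [map_add, add_mul, mul_add]
  case down.down.up =>
    convert yb.symm using 1
    · refine tensor_induction_three
        (F := fun u v w => place12 B₃ e₁ e₂ u * place23 B₁ e₂ e₃ w * place13 B₂ e₁ e₃ v)
        (F' := fun u v w => Θ (leg23 k A w * leg13 k A v * leg12 k A u)) ?_ ?_ ?_ ?_ ?_ ?_ ?_ r r r <;> intros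
      · simp [Θ, leg12, leg13, leg23, m₁, m₂, m₃]
      all_goals simp only [map_add, add_mul, mul_add]
    · refine tensor_induction_three
        (F := fun u v w => place13 B₂ e₁ e₃ v * place23 B₁ e₂ e₃ w * place12 B₃ e₁ e₂ u)
        (F' := fun u v w => Θ (leg12 k A u * leg13 k A v * leg23 k A w)) ?_ ?_ ?_ ?_ ?_ ?_ ?_ r r r <;> intros
      · simp [Θ, leg12, leg13, leg23, m₁, m₂, m₃]
      all_goals simp only [map_add, add_mul, mul_add]
  case down.up.up =>
    convert yb using 1
    · refine tensor_induction_three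
        (F := fun u v w => place13 B₂ e₁ e₃ v * place12 B₃ e₁ e₂ u * place23 B₁ e₂ e₃ w)
        (F' := fun u v w => Θ (leg12 k A u * leg13 k A v * leg23 k A w)) ?_ ?_ ?_ ?_ ?_ ?_ ?_ r r r <;> intros
      · simp [Θ, leg12, leg13, leg23, m₁, m₂, m₃]
      all_goals simp only [map_add, add_mul, mul_add]
    · refine tensor_induction_three
        (F := fun u v w => place23 B₁ e₂ e₃ w * place12 B₃ e₁ e₂ u * place13 B₂ e₁ e₃ v)
        (F' := fun u v w => Θ (leg23 k A w * leg13 k A v * leg12 k A u)) ?_ ?_ ?_ ?_ ?_ ?_ ?_ r r r <;> intros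
      · simp [Θ, leg12, leg13, leg23, m₁, m₂, m₃]
      all_goals simp only [map_add, add_mul, mul_add]
  case up.down.down =>
    convert yb.symm using 1
    · refine tensor_induction_three
        (F := fun u v w => place13 B₂ e₁ e₃ v * place12 B₃ e₁ e₂ u * place23 B₁ e₂ e₃ w)
        (F' := fun u v w => Θ (leg23 k A w * leg13 k A v * leg12 k A u)) ?_ ?_ ?_ ?_ ?_ ?_ ?_ r r r <;> intros
      · simp [Θ, leg12, leg13, leg23, m₁, m₂, m₃]
      all_goals simp only [map_add, add_mul, mul_add]
    · refine tensor_induction_three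
        (F := fun u v w => place23 B₁ e₂ e₃ w * place12 B₃ e₁ e₂ u * place13 B₂ e₁ e₃ v)
        (F' := fun u v w => Θ (leg12 k A u * leg13 k A v * leg23 k A w)) ?_ ?_ ?_ ?_ ?_ ?_ ?_ r r r <;> intros
      · simp [Θ, leg12, leg13, leg23, m₁, m₂, m₃]
      all_goals simp only [map_add, add_mul, mul_add]
  case up.down.up =>
    convert yb2 using 1
    · refine tensor_induction_three
        (F := fun u v w => place12 B₃ e₁ e₂ u * place23 B₁ e₂ e₃ w * place13 B₂ e₁ e₃ v)
        (F' := fun u v w => Θ (leg23 k A w * leg12 k A u * leg13 k A v)) ?_ ?_ ?_ ?_ ?_ ?_ ?_ r r r' <;> intros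
      · simp [Θ, leg12, leg13, leg23, m₁, m₂, m₃]
      all_goals simp only [map_add, add_mul, mul_add]
    · refine tensor_induction_three
        (F := fun u v w => place13 B₂ e₁ e₃ v * place23 B₁ e₂ e₃ w * place12 B₃ e₁ e₂ u)
        (F' := fun u v w => Θ (leg13 k A v * leg12 k A u * leg23 k A w)) ?_ ?_ ?_ ?_ ?_ ?_ ?_ r r r' <;> intros
      · simp [Θ, leg12, leg13, leg23, m₁, m₂, m₃]
      all_goals simp only [map_add, add_mul, mul_add]
  case down.up.down =>
    convert yb3 using 1
    · refine tensor_induction_three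
        (F := fun u v w => place23 B₁ e₂ e₃ w * place12 B₃ e₁ e₂ u * place13 B₂ e₁ e₃ v)
        (F' := fun u v w => Θ (leg13 k A v * leg23 k A w * leg12 k A u)) ?_ ?_ ?_ ?_ ?_ ?_ ?_ r' r r <;> intros
      · simp [Θ, leg12, leg13, leg23, m₁, m₂, m₃]
      all_goals simp only [map_add, add_mul, mul_add]
    · refine tensor_induction_three
        (F := fun u v w => place13 B₂ e₁ e₃ v * place12 B₃ e₁ e₂ u * place23 B₁ e₂ e₃ w)
        (F' := fun u v w => Θ (leg12 k A u * leg23 k A w * leg13 k A v)) ?_ ?_ ?_ ?_ ?_ ?_ ?_ r' r r <;> intros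
      · simp [Θ, leg12, leg13, leg23, m₁, m₂, m₃]
      all_goals simp only [map_add, add_mul, mul_add]

end Place

end Algebra

/-! ### Inverses of the crossing tensors and the braid relation -/

section Algebra

variable {k A : Type*} [Field k] [Ring A] [Algebra k A]

theorem mulTensor_conj_left (g : Aˣ) (x y : Dir) (u v : A ⊗[k] A) :
    x.mulTensor k A y (TensorProduct.map (conjLinear k g) .id u)
      (TensorProduct.map (conjLinear k g) .id v) =
      TensorProduct.map (conjLinear k g) .id (x.mulTensor k A y u v) := by
  induction u with
  | zero => simp
  | add u u' hu hu' => simp only [map_add, LinearMap.add_apply, hu, hu']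
  | tmul a a' =>
    induction v with
    | zero => simp
    | add v v' hv hv' => simp only [map_add, hv, hv']
    | tmul b b' => cases x <;> simp [Dir.mul, mul_assoc]

theorem mulTensor_flip (x y : Dir) (u v : A ⊗[k] A) :
    x.mulTensor k A y u v = x.flip.mulTensor k A y.flip v u := by
  induction u with
  | zero => simp
  | add u u' hu hu' => simp only [map_add, LinearMap.add_apply, hu, hu']
  | tmul a a' =>
    induction v with
    | zero => simp
    | add v v' hv hv' => simp only [map_add, LinearMap.add_apply, hv, hv']
    | tmul b b' => cases x <;> cases y <;> simp [Dir.mul, Dir.flip]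

theorem mulTensor_comm (x y : Dir) (u v : A ⊗[k] A) :
    TensorProduct.comm k A A (x.mulTensor k A y u v) =
      y.mulTensor k A x (TensorProduct.comm k A A u) (TensorProduct.comm k A A v) := by
  induction u with
  | zero => simp
  | add u u' hu hu' => simp only [map_add, LinearMap.add_apply, hu, hu']
  | tmul a a' =>
    induction v with
    | zero => simp
    | add v v' hv hv' => simp only [map_add, hv, hv']
    | tmul b b' => simp

theorem mulTensor_up (u v : A ⊗[k] A) : Dir.mulTensor k A .up .up u v = u * v := by
  induction u with
  | zero => simp
  | add u u' hu hu' => simp only [map_add, LinearMap.add_apply, hu, hu', add_mul]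
  | tmul a a' =>
    induction v with
    | zero => simp
    | add v v' hv hv' => simp only [map_add, hv, hv', mul_add]
    | tmul b b' => simp [Dir.mul]

theorem map_conj_comp (g : Aˣ) (u : A ⊗[k] A) :
    TensorProduct.map (conjLinear k g) .id (TensorProduct.map .id (conjLinear k g) u) =
      TensorProduct.map (conjLinear k g) (conjLinear k g) u := by
  induction u with
  | zero => simp
  | add u u' hu hu' => simp only [map_add, hu, hu']
  | tmul a a' => rfl

theorem map_conj_one (g : Aˣ) :
    TensorProduct.map (conjLinear k g) .id (1 : A ⊗[k] A) = 1 := by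
  simp [Algebra.TensorProduct.one_def]

theorem comm_map_left (f : A →ₗ[k] A) (u : A ⊗[k] A) :
    TensorProduct.comm k A A (TensorProduct.map f .id u) =
      TensorProduct.map .id f (TensorProduct.comm k A A u) := by
  induction u with
  | zero => simp
  | add u u' hu hu' => simp only [map_add, hu, hu']
  | tmul a a' => rfl

theorem comm_map_both (f : A →ₗ[k] A) (u : A ⊗[k] A) :
    TensorProduct.comm k A A (TensorProduct.map f f u) =
      TensorProduct.map f f (TensorProduct.comm k A A u) := by
  induction u with
  | zero => simp
  | add u u' hu hu' => simp only [map_add, hu, hu']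
  | tmul a a' => rfl

theorem comm_one : TensorProduct.comm k A A 1 = 1 := by
  simp [Algebra.TensorProduct.one_def]

/-- The inverse of `orientedTensor` for strands of the directions `x` and `y`. -/
noncomputable def orientedInverse (g : Aˣ) (r r' : A ⊗[k] A) : Dir → Dir → A ⊗[k] A
  | .up, .up => r'
  | .down, .down => r'
  | .up, .down => r
  | .down, .up => TensorProduct.map .id (conjLinear k g) r

namespace BraidTensor

variable {g : Aˣ} {r r' : A ⊗[k] A}

/-- Conjugation in the first factor is applied to `op_mul`. On `r` it meets the conjugation in the
second factor, and the two together leave `r` unchanged; on `r'` it remains. -/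
theorem conj_op_mul (H : BraidTensor g r r') :
    Dir.mulTensor k A .up .down (TensorProduct.map (conjLinear k g) .id r') r = 1 := by
  have h := mulTensor_conj_left g .up .down r' (TensorProduct.map .id (conjLinear k g) r)
  rwa [map_conj_comp, H.conj, H.op_mul, map_conj_one] at h

theorem conj_mul_op (H : BraidTensor g r r') :
    Dir.mulTensor k A .up .down r (TensorProduct.map (conjLinear k g) .id r') = 1 := by
  have h := mulTensor_conj_left g .up .down (TensorProduct.map .id (conjLinear k g) r) r'
  rwa [map_conj_comp, H.conj, H.mul_op, map_conj_one] at h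

/-- Parallel strands give the invertibility of ρ in A ⊗ A, antiparallel ones the axiom on inverses
in A ⊗ Aᵒᵖ, possibly transported by conjugation. -/
theorem oriented_mul_inverse (H : BraidTensor g r r') (x y : Dir) :
    x.mulTensor k A y (orientedTensor g r r' x y) (orientedInverse g r r' x y) = 1 := by
  cases x <;> cases y
  · exact (mulTensor_up _ _).trans H.mul_inv
  · exact H.conj_op_mul
  · rw [mulTensor_flip]; exact H.mul_op
  · rw [mulTensor_flip]; exact (mulTensor_up _ _).trans H.inv_mul

theorem oriented_inverse_mul (H : BraidTensor g r r') (x y : Dir) :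
    x.mulTensor k A y (orientedInverse g r r' x y) (orientedTensor g r r' x y) = 1 := by
  cases x <;> cases y
  · exact (mulTensor_up _ _).trans H.inv_mul
  · exact H.conj_mul_op
  · rw [mulTensor_flip]; exact H.op_mul
  · rw [mulTensor_flip]; exact (mulTensor_up _ _).trans H.mul_inv

end BraidTensor

section Ring

variable {R : Type*} [Ring R] {a b c a' b' c' : R}

/-- A relation abc = cba stays equivalent when an outer factor, or an adjacent pair of factors, is
replaced by inverses in a suitable order. In this way the Yang--Baxter equation reaches strands that
are not all parallel. -/
theorem braid_of_inverse_right (hb : b * b' = 1) (hb' : b' * b = 1) (hc : c * c' = 1)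
    (hc' : c' * c = 1) (h : a * c' * b' = b' * c' * a) : a * b * c = c * b * a := by
  calc a * b * c = c * (b * b') * c' * a * b * c := by rw [hb, mul_one, hc, one_mul]
    _ = c * b * (b' * c' * a) * b * c := by simp only [mul_assoc]
    _ = c * b * a * (c' * (b' * b) * c) := by rw [← h]; simp only [mul_assoc]
    _ = c * b * a := by rw [hb', mul_one, hc', mul_one]

theorem braid_of_inverse_left (ha : a * a' = 1) (ha' : a' * a = 1) (hb : b * b' = 1)
    (hb' : b' * b = 1) (h : b' * a' * c = c * a' * b') : a * b * c = c * b * a := by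
  calc a * b * c = a * b * c * (a' * (b' * b) * a) := by rw [hb', mul_one, ha', mul_one]
    _ = a * b * (c * a' * b') * b * a := by simp only [mul_assoc]
    _ = a * (b * b') * a' * c * b * a := by rw [← h]; simp only [mul_assoc]
    _ = c * b * a := by rw [hb, mul_one, ha, one_mul]

theorem braid_of_inverse_outer_left (ha : a * a' = 1) (ha' : a' * a = 1)
    (h : a' * c * b = b * c * a') : a * b * c = c * b * a := by
  calc a * b * c = a * (b * c * a') * a := by simp only [mul_assoc, ha', mul_one]
    _ = (a * a') * c * b * a := by rw [← h]; simp only [mul_assoc]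
    _ = c * b * a := by rw [ha, one_mul]

theorem braid_of_inverse_outer_right (hc : c * c' = 1) (hc' : c' * c = 1)
    (h : c' * a * b = b * a * c') : a * b * c = c * b * a := by
  calc a * b * c = c * (c' * a * b) * c := by simp only [← mul_assoc, hc, one_mul]
    _ = c * b * a * (c' * c) := by rw [h]; simp only [mul_assoc]
    _ = c * b * a := by rw [hc', mul_one]

end Ring

section Place

variable {B₁ B₂ B₃ : Type*} [Ring B₁] [Ring B₂] [Ring B₃] [Algebra k B₁] [Algebra k B₂]
  [Algebra k B₃] {e₁ : A →ₗ[k] B₁} {e₂ : A →ₗ[k] B₂} {e₃ : A →ₗ[k] B₃}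

theorem place12_comp (f₁ f₂ : A →ₗ[k] A) (u : A ⊗[k] A) :
    place12 B₃ (e₁ ∘ₗ f₁) (e₂ ∘ₗ f₂) u = place12 B₃ e₁ e₂ (TensorProduct.map f₁ f₂ u) := by
  induction u with
  | zero => simp
  | add u u' hu hu' => simp only [map_add, hu, hu']
  | tmul a a' => rfl

theorem place13_comp (f₁ f₃ : A →ₗ[k] A) (u : A ⊗[k] A) :
    place13 B₂ (e₁ ∘ₗ f₁) (e₃ ∘ₗ f₃) u = place13 B₂ e₁ e₃ (TensorProduct.map f₁ f₃ u) := by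
  induction u with
  | zero => simp
  | add u u' hu hu' => simp only [map_add, hu, hu']
  | tmul a a' => rfl

theorem place23_comp (f₂ f₃ : A →ₗ[k] A) (u : A ⊗[k] A) :
    place23 B₁ (e₂ ∘ₗ f₂) (e₃ ∘ₗ f₃) u = place23 B₁ e₂ e₃ (TensorProduct.map f₂ f₃ u) := by
  induction u with
  | zero => simp
  | add u u' hu hu' => simp only [map_add, hu, hu']
  | tmul a a' => rfl

/-- The braid relation for strands of arbitrary directions. -/
theorem BraidTensor.braid {g : Aˣ} {r r' : A ⊗[k] A} (H : BraidTensor g r r') (x y z : Dir)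
    (h₁ : x.IsHom e₁) (h₂ : y.IsHom e₂) (h₃ : z.IsHom e₃) :
    place12 B₃ e₁ e₂ (orientedTensor g r r' x y) * place13 B₂ e₁ e₃ (orientedTensor g r r' x z) *
        place23 B₁ e₂ e₃ (orientedTensor g r r' y z) =
      place23 B₁ e₂ e₃ (orientedTensor g r r' y z) * place13 B₂ e₁ e₃ (orientedTensor g r r' x z) *
        place12 B₃ e₁ e₂ (orientedTensor g r r' x y) := by
  have i12 : place12 B₃ e₁ e₂ (orientedTensor g r r' x y) *
      place12 B₃ e₁ e₂ (orientedInverse g r r' x y) = 1 := by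
    rw [← place12_mul x y h₁ h₂, H.oriented_mul_inverse, place12_one x y h₁ h₂]
  have i12' : place12 B₃ e₁ e₂ (orientedInverse g r r' x y) *
      place12 B₃ e₁ e₂ (orientedTensor g r r' x y) = 1 := by
    rw [← place12_mul x y h₁ h₂, H.oriented_inverse_mul, place12_one x y h₁ h₂]
  have i13 : place13 B₂ e₁ e₃ (orientedTensor g r r' x z) *
      place13 B₂ e₁ e₃ (orientedInverse g r r' x z) = 1 := by
    rw [← place13_mul x z h₁ h₃, H.oriented_mul_inverse, place13_one x z h₁ h₃]
  have i13' : place13 B₂ e₁ e₃ (orientedInverse g r r' x z) *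
      place13 B₂ e₁ e₃ (orientedTensor g r r' x z) = 1 := by
    rw [← place13_mul x z h₁ h₃, H.oriented_inverse_mul, place13_one x z h₁ h₃]
  have i23 : place23 B₁ e₂ e₃ (orientedTensor g r r' y z) *
      place23 B₁ e₂ e₃ (orientedInverse g r r' y z) = 1 := by
    rw [← place23_mul y z h₂ h₃, H.oriented_mul_inverse, place23_one y z h₂ h₃]
  have i23' : place23 B₁ e₂ e₃ (orientedInverse g r r' y z) *
      place23 B₁ e₂ e₃ (orientedTensor g r r' y z) = 1 := by
    rw [← place23_mul y z h₂ h₃, H.oriented_inverse_mul, place23_one y z h₂ h₃]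
  have hyb := H.place_yang_baxter x y z h₁ h₂ h₃
  cases x <;> cases y <;> cases z
  case up.up.up => exact hyb
  case down.down.down => exact hyb
  case up.up.down => exact braid_of_inverse_right i13 i13' i23 i23' hyb
  case down.down.up =>
    -- The inverses needed here are `r` conjugated in the third leg, hence plain copies of `r` for
    -- the twisted embedding.
    have h := H.place_yang_baxter _ _ _ h₁ h₂ (h₃.conj g)
    have e13 := place13_comp (B₂ := B₂) (e₁ := e₁) (e₃ := e₃) .id (conjLinear k g) r
    have e23 := place23_comp (B₁ := B₁) (e₂ := e₂) (e₃ := e₃) .id (conjLinear k g) r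
    rw [LinearMap.comp_id] at e13 e23
    simp only [e13, e23] at h
    exact braid_of_inverse_right i13 i13' i23 i23' h
  case down.up.up =>
    -- Both other legs are twisted; in the factor at 23 the two conjugations cancel by the
    -- invariance of `r`.
    have h := H.place_yang_baxter _ _ _ h₁ (h₂.conj g) (h₃.conj g)
    have e12 := place12_comp (B₃ := B₃) (e₁ := e₁) (e₂ := e₂) .id (conjLinear k g) r
    have e13 := place13_comp (B₂ := B₂) (e₁ := e₁) (e₃ := e₃) .id (conjLinear k g) r
    rw [LinearMap.comp_id] at e12 e13
    simp only [e12, e13, place23_comp, H.conj] at h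
    exact braid_of_inverse_left i12 i12' i13 i13' h
  case up.down.down => exact braid_of_inverse_left i12 i12' i13 i13' hyb
  case up.down.up => exact braid_of_inverse_outer_left i12 i12' hyb
  case down.up.down => exact braid_of_inverse_outer_right i23 i23' hyb

end Place

/-- An algebra in which the products are those of the beads on a strand of direction `x`. -/
theorem Dir.exists_isHom {k : Type*} {A : Type u} [Field k] [Ring A] [Algebra k A] (x : Dir) :
    ∃ (B : Type u) (_ : Ring B) (_ : Algebra k B) (e : A ≃ₗ[k] B), x.IsHom (e : A →ₗ[k] B) := by
  cases x
  · exact ⟨A, _, _, .refl k A, fun _ _ => rfl, rfl⟩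
  · exact ⟨Aᵐᵒᵖ, _, _, MulOpposite.opLinearEquiv k, fun _ _ => rfl, rfl⟩

/-- The tensor identity for the third Reidemeister move. -/
theorem BraidTensor.reidemeister_three {g : Aˣ} {r r' : A ⊗[k] A} (H : BraidTensor g r r')
    (x y z : Dir) (E₁₂ : Expansion (orientedTensor g r r' x y))
    (E₁₃ : Expansion (orientedTensor g r r' x z)) (E₂₃ : Expansion (orientedTensor g r r' y z)) :
    ∑ i, ∑ j, ∑ l, x.mul (E₁₂.fst i) (E₁₃.fst j) ⊗ₜ[k]
        (y.mul (E₁₂.snd i) (E₂₃.fst l) ⊗ₜ[k] z.mul (E₁₃.snd j) (E₂₃.snd l)) =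
      ∑ i, ∑ j, ∑ l, x.mul (E₁₃.fst j) (E₁₂.fst i) ⊗ₜ[k]
        (y.mul (E₂₃.fst l) (E₁₂.snd i) ⊗ₜ[k] z.mul (E₂₃.snd l) (E₁₃.snd j)) := by
  -- In the algebra or its opposite, according to the direction, the products along the strands
  -- become ordinary products. The embeddings are bijective, so the identity can be pulled back from
  -- there.
  obtain ⟨B₁, _, _, e₁, h₁⟩ := x.exists_isHom (k := k) (A := A)
  obtain ⟨B₂, _, _, e₂, h₂⟩ := y.exists_isHom (k := k) (A := A)
  obtain ⟨B₃, _, _, e₃, h₃⟩ := z.exists_isHom (k := k) (A := A)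
  have h := H.braid x y z h₁ h₂ h₃
  rw [E₁₂.sum_eq, E₁₃.sum_eq, E₂₃.sum_eq] at h
  have m₁ := h₁.map_mul
  have m₂ := h₂.map_mul
  have m₃ := h₃.map_mul
  simp only [LinearEquiv.coe_coe] at m₁ m₂ m₃
  apply (TensorProduct.congr e₁ (TensorProduct.congr e₂ e₃)).injective
  simp only [map_sum, Finset.mul_sum, Finset.sum_mul, place12_tmul,
    place13_tmul, place23_tmul, Algebra.TensorProduct.tmul_mul_tmul, mul_one, one_mul,
    LinearEquiv.coe_coe, TensorProduct.congr_tmul, m₁, m₂, m₃] at h ⊢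
  refine Eq.trans ?_ h
  rw [Finset.sum_comm]
  conv_rhs => rw [Finset.sum_comm]
  exact Finset.sum_congr rfl fun _ _ => Finset.sum_comm

end Algebra

/-! ### Both kinds of crossings and the identities for the moves -/

section Algebra

variable {k A : Type*} [Field k] [Ring A] [Algebra k A]

theorem Expansion.sum_map {x : A ⊗[k] A} (E : Expansion x) (f f' : A →ₗ[k] A) :
    ∑ j, f (E.fst j) ⊗ₜ[k] f' (E.snd j) = TensorProduct.map f f' x := by
  conv_rhs => rw [E.sum_eq, map_sum]
  rfl

theorem Expansion.sum_map_comm {x : A ⊗[k] A} (E : Expansion x) (f f' : A →ₗ[k] A) :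
    ∑ j, f (E.snd j) ⊗ₜ[k] f' (E.fst j) = TensorProduct.map f f' (TensorProduct.comm k A A x) := by
  conv_rhs => rw [E.sum_eq, map_sum, map_sum]
  rfl

@[simp] theorem comm_comm (u : A ⊗[k] A) :
    TensorProduct.comm k A A (TensorProduct.comm k A A u) = u :=
  (TensorProduct.comm k A A).symm_apply_apply u

/-- In the second Reidemeister move the upper crossing is of the other kind and the two strands
exchange the roles of rising and falling line. Read in the factors of the lower crossing, its tensor
is exactly the inverse. -/
theorem comm_orientedTensor (g : Aˣ) (r r' : A ⊗[k] A) (x y : Dir) :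
    TensorProduct.comm k A A (orientedTensor g (TensorProduct.comm k A A r')
      (TensorProduct.comm k A A r) y x) = orientedInverse g r r' x y := by
  cases x <;> cases y <;> simp only [orientedTensor, orientedInverse, comm_comm, comm_map_left]

/-- The tensor of a crossing. The first factor belongs to the rising line. -/
noncomputable def crossingTensor (g : Aˣ) (r r' : A ⊗[k] A) : Bool → Dir → Dir → A ⊗[k] A
  | true => orientedTensor g r r'
  | false => orientedTensor g (TensorProduct.comm k A A r') (TensorProduct.comm k A A r)

/-- The map `a ⊗ b ⊗ c ↦ c ⊗ b ⊗ a`. -/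
noncomputable def reverseLegs (k A : Type*) [Field k] [Ring A] [Algebra k A] :
    A ⊗[k] (A ⊗[k] A) →ₐ[k] A ⊗[k] (A ⊗[k] A) :=
  ((Algebra.TensorProduct.assoc k k k A A A).toAlgHom.comp
    (Algebra.TensorProduct.map (Algebra.TensorProduct.comm k A A).toAlgHom (AlgHom.id k A))).comp
      (Algebra.TensorProduct.comm k A (A ⊗[k] A)).toAlgHom

theorem reverseLegs_leg12 (u : A ⊗[k] A) :
    reverseLegs k A (leg12 k A u) = leg23 k A (TensorProduct.comm k A A u) := by
  induction u with
  | zero => simp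
  | add u u' hu hu' => simp only [map_add, hu, hu']
  | tmul a a' => simp [reverseLegs, leg12, leg23]

theorem reverseLegs_leg13 (u : A ⊗[k] A) :
    reverseLegs k A (leg13 k A u) = leg13 k A (TensorProduct.comm k A A u) := by
  induction u with
  | zero => simp
  | add u u' hu hu' => simp only [map_add, hu, hu']
  | tmul a a' => simp [reverseLegs, leg13]

theorem reverseLegs_leg23 (u : A ⊗[k] A) :
    reverseLegs k A (leg23 k A u) = leg12 k A (TensorProduct.comm k A A u) := by
  induction u with
  | zero => simp
  | add u u' hu hu' => simp only [map_add, hu, hu']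
  | tmul a a' => simp [reverseLegs, leg12, leg23]

namespace BraidTensor

variable {g : Aˣ} {r r' : A ⊗[k] A}

/-- The two sides are the inverses of the two sides of the Yang--Baxter equation. -/
theorem yang_baxter' (H : BraidTensor g r r') :
    leg23 k A r' * leg13 k A r' * leg12 k A r' = leg12 k A r' * leg13 k A r' * leg23 k A r' := by
  have h12 : leg12 k A r * leg12 k A r' = 1 := by rw [← map_mul, H.mul_inv, map_one]
  have h13 : leg13 k A r * leg13 k A r' = 1 := by rw [← map_mul, H.mul_inv, map_one]
  have h23 : leg23 k A r * leg23 k A r' = 1 := by rw [← map_mul, H.mul_inv, map_one]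
  have k12 : leg12 k A r' * leg12 k A r = 1 := by rw [← map_mul, H.inv_mul, map_one]
  have k13 : leg13 k A r' * leg13 k A r = 1 := by rw [← map_mul, H.inv_mul, map_one]
  have k23 : leg23 k A r' * leg23 k A r = 1 := by rw [← map_mul, H.inv_mul, map_one]
  refine left_inv_eq_right_inv (a := leg12 k A r * leg13 k A r * leg23 k A r) ?_ ?_
  · calc _ = leg23 k A r' * (leg13 k A r' * (leg12 k A r' * leg12 k A r) * leg13 k A r) *
          leg23 k A r := by simp only [mul_assoc]
      _ = 1 := by rw [k12, mul_one, k13, mul_one, k23]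
  · rw [H.yang_baxter]
    calc _ = leg23 k A r * (leg13 k A r * (leg12 k A r * leg12 k A r') * leg13 k A r') *
          leg23 k A r' := by simp only [mul_assoc]
      _ = 1 := by rw [h12, mul_one, h13, mul_one, h23]

/-- The axioms are symmetric with respect to over- and undercrossing lines. -/
theorem symm (H : BraidTensor g r r') :
    BraidTensor g (TensorProduct.comm k A A r') (TensorProduct.comm k A A r) where
  mul_inv := by
    rw [← mulTensor_up, ← mulTensor_comm, mulTensor_up, H.inv_mul, comm_one]
  inv_mul := by
    rw [← mulTensor_up, ← mulTensor_comm, mulTensor_up, H.mul_inv, comm_one]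
  conj := by rw [← comm_map_both, H.conj']
  conj' := by rw [← comm_map_both, H.conj]
  op_mul := by
    rw [← comm_map_left, ← mulTensor_comm, mulTensor_flip]
    exact (congrArg _ H.conj_op_mul).trans comm_one
  mul_op := by
    rw [← comm_map_left, ← mulTensor_comm, mulTensor_flip]
    exact (congrArg _ H.conj_mul_op).trans comm_one
  yang_baxter := by
    -- Reversing the three legs interchanges the positions 12 and 23 and flips every tensor, which
    -- restores the order of the equation.
    have h := congrArg (reverseLegs k A) H.yang_baxter'
    simpa only [map_mul, reverseLegs_leg12, reverseLegs_leg13, reverseLegs_leg23] using h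

/-- Each kind of crossing is given by a tensor that satisfies the axioms, and the other kind by the
inverse of this tensor. -/
theorem exists_crossing (H : BraidTensor g r r') (s : Bool) :
    ∃ v v' : A ⊗[k] A, BraidTensor g v v' ∧ crossingTensor g r r' s = orientedTensor g v v' ∧
      ∀ x y, TensorProduct.comm k A A (crossingTensor g r r' (!s) y x) =
        orientedInverse g v v' x y := by
  cases s
  · refine ⟨_, _, H.symm, rfl, fun x y => ?_⟩
    rw [← comm_orientedTensor, comm_comm, comm_comm]
    rfl
  · exact ⟨r, r', H, rfl, fun x y => comm_orientedTensor g r r' x y⟩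

/-- The tensor identity for the second Reidemeister move. -/
theorem reidemeister_two (H : BraidTensor g r r') (s : Bool) (x y : Dir)
    (E : Expansion (crossingTensor g r r' s x y))
    (E' : Expansion (crossingTensor g r r' (!s) y x)) :
    ∑ i, ∑ j, x.mul (E.fst i) (E'.snd j) ⊗ₜ[k] y.mul (E.snd i) (E'.fst j) = 1 ⊗ₜ[k] 1 := by
  obtain ⟨v, v', hv, h, h'⟩ := H.exists_crossing s
  rw [← Algebra.TensorProduct.one_def, ← hv.oriented_mul_inverse x y, ← h, ← h']
  conv_rhs => rw [E.sum_eq, E'.sum_eq]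
  simp only [map_sum, LinearMap.sum_apply, TensorProduct.comm_tmul, Dir.mulTensor_tmul]
  exact Finset.sum_comm

/-- The tensor identity for the third Reidemeister move, for both kinds of crossings. -/
theorem crossing_reidemeister_three (H : BraidTensor g r r') (s : Bool) (x y z : Dir)
    (E₁₂ : Expansion (crossingTensor g r r' s x y)) (E₁₃ : Expansion (crossingTensor g r r' s x z))
    (E₂₃ : Expansion (crossingTensor g r r' s y z)) :
    ∑ i, ∑ j, ∑ l, x.mul (E₁₂.fst i) (E₁₃.fst j) ⊗ₜ[k]
        (y.mul (E₁₂.snd i) (E₂₃.fst l) ⊗ₜ[k] z.mul (E₁₃.snd j) (E₂₃.snd l)) =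
      ∑ i, ∑ j, ∑ l, x.mul (E₁₃.fst j) (E₁₂.fst i) ⊗ₜ[k]
        (y.mul (E₂₃.fst l) (E₁₂.snd i) ⊗ₜ[k] z.mul (E₂₃.snd l) (E₁₃.snd j)) := by
  obtain ⟨v, v', hv, h, -⟩ := H.exists_crossing s
  revert E₁₂ E₁₃ E₂₃
  rw [h]
  exact hv.reidemeister_three x y z

/-- The beads on an arc that turns around. -/
theorem oriented_mul_maxBead (H : BraidTensor g r r') (x y : Dir) :
    TensorProduct.map
        (match x with
          | .up => LinearMap.mulRight k (g : A)
          | .down => LinearMap.id) .id (orientedTensor g r r' x y) =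
      TensorProduct.map
        (match x with
          | .up => LinearMap.mulLeft k (g : A)
          | .down => LinearMap.id) .id (orientedInverse g r r' x.flip y) := by
  -- Multiplying `g a g⁻¹` by the bead `g` of the maximum gives `g a`: past the turn the conjugation
  -- is gone and the bead stands on the other side.
  have e : LinearMap.mulRight k (g : A) ∘ₗ conjLinear k g = LinearMap.mulLeft k (g : A) := by
    ext a
    simp [mul_assoc]
  cases x <;> cases y <;> simp only [Dir.flip, orientedTensor, orientedInverse]
  · conv_lhs => rw [← H.conj]
    rw [← LinearMap.comp_apply, ← LinearMap.comp_apply, ← TensorProduct.map_comp,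
      ← TensorProduct.map_comp, e]
    rfl
  · rw [← LinearMap.comp_apply, ← TensorProduct.map_comp, e]
    rfl

/-- The tensor identity for moving a line over or under a maximum. -/
theorem slide_max (H : BraidTensor g r r') (s : Bool) (x y : Dir)
    (E : Expansion (crossingTensor g r r' s x y))
    (E' : Expansion (crossingTensor g r r' (!s) y x.flip)) :
    ∑ i, x.mul (E.fst i) (x.maxBead g) ⊗ₜ[k] E.snd i =
      ∑ j, x.mul (x.maxBead g) (E'.snd j) ⊗ₜ[k] E'.fst j := by
  obtain ⟨v, v', hv, h, h'⟩ := H.exists_crossing s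
  have key := hv.oriented_mul_maxBead x y
  rw [← h, ← h', ← E.sum_map, ← E'.sum_map_comm] at key
  cases x <;> simpa [Dir.mul, Dir.maxBead] using key

/-- The tensor identity for moving a line over or under a minimum. -/
theorem slide_min (H : BraidTensor g r r') (s : Bool) (x y : Dir)
    (E : Expansion (crossingTensor g r r' s y x))
    (E' : Expansion (crossingTensor g r r' (!s) x.flip y)) :
    ∑ i, x.mul (x.minBead g) (E.snd i) ⊗ₜ[k] E.fst i =
      ∑ j, x.mul (E'.fst j) (x.minBead g) ⊗ₜ[k] E'.snd j := by
  obtain ⟨v, v', hv, h, h'⟩ := H.exists_crossing (!s)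
  rw [Bool.not_not] at h'
  -- The identity for a minimum is that for the maximum with the opposite direction, read backwards.
  have key := hv.oriented_mul_maxBead x.flip y
  cases x
  · simp only [Dir.flip] at key E' ⊢
    rw [← h, ← h', ← E'.sum_map, ← E.sum_map_comm] at key
    simpa [Dir.mul, Dir.minBead] using key.symm
  · simp only [Dir.flip] at key E' ⊢
    rw [← h, ← h', ← E'.sum_map, ← E.sum_map_comm] at key
    -- Multiplication by `g⁻¹` from both sides turns `a g = g b` into `g⁻¹ a = b g⁻¹`.
    have := congrArg (TensorProduct.map (LinearMap.mulLeft k ((g⁻¹ : Aˣ) : A) ∘ₗ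
      LinearMap.mulRight k ((g⁻¹ : Aˣ) : A)) LinearMap.id) key.symm
    simpa [Dir.mul, Dir.minBead, map_sum, ← mul_assoc] using this

end BraidTensor

/-- It rewrites the axiom stated in A ⊗ Aᵒᵖ as a statement about products along two antiparallel
strands. -/
theorem toTensorOp_mulTensor (u v : A ⊗[k] A) :
    toTensorOp AlgEquiv.refl AlgEquiv.refl (Dir.mulTensor k A .up .down u v) =
      toTensorOp AlgEquiv.refl AlgEquiv.refl u * toTensorOp AlgEquiv.refl AlgEquiv.refl v := by
  induction u with
  | zero => simp
  | add u u' hu hu' => simp only [map_add, LinearMap.add_apply, hu, hu', add_mul]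
  | tmul a a' =>
    induction v with
    | zero => simp
    | add v v' hv hv' => simp only [map_add, hv, hv', mul_add]
    | tmul b b' => simp [Dir.mul, toTensorOp]

theorem toTensorOp_injective :
    Function.Injective (toTensorOp (AlgEquiv.refl : A ≃ₐ[k] A) (AlgEquiv.refl : A ≃ₐ[k] A)) :=
  (TensorProduct.congr (.refl k A) (MulOpposite.opLinearEquiv k)).injective

theorem toTensorOp_one :
    toTensorOp (AlgEquiv.refl : A ≃ₐ[k] A) (AlgEquiv.refl : A ≃ₐ[k] A) (1 : A ⊗[k] A) = 1 := by
  simp [toTensorOp, Algebra.TensorProduct.one_def]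

/-- These are the axioms of the standard algebra, in which `t_d` is the identity and `t_u` is
conjugation with `G`. -/
theorem TwistOrientedQuantumAlgebra.braidTensor (Q : TwistOrientedQuantumAlgebra k A) :
    BraidTensor Q.G (Q.ρ : A ⊗[k] A) ((Q.ρ⁻¹ : (A ⊗[k] A)ˣ) : A ⊗[k] A) := by
  have htu : Q.standard.tu.toLinearMap = conjLinear k Q.G := by
    ext a
    exact (Q.conj_G a).trans (mul_assoc _ _ _)
  have hop : toTensorOp AlgEquiv.refl Q.standard.tu (Q.ρ : A ⊗[k] A) =
      toTensorOp AlgEquiv.refl AlgEquiv.refl (TensorProduct.map .id (conjLinear k Q.G)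
        (Q.ρ : A ⊗[k] A)) := by
    rw [toTensorOp, toTensorOp, htu, ← LinearMap.comp_apply, ← TensorProduct.map_comp]
    rfl
  refine ⟨Q.ρ.mul_inv, Q.ρ.inv_mul, ?_, ?_, ?_, ?_, Q.yang_baxter⟩
  · rw [← htu]; exact Q.standard.map_tu
  · rw [← htu]; exact map_inv_of_map _ _ Q.standard.map_tu
  · apply toTensorOp_injective
    rw [toTensorOp_mulTensor, ← hop, toTensorOp_one]
    exact Q.standard.inv_right
  · apply toTensorOp_injective
    rw [toTensorOp_mulTensor, ← hop, toTensorOp_one]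
    exact Q.standard.inv_left

end Algebra

/-! ### Invariance under the local moves -/

section Heights

variable {A : Type*}

theorem Slab.Represents.congr [Monoid A] {N N' : Slab A} {M : List (Slab A)} (h : N.Represents M)
    (hd : N'.dom = N.dom) (hc : N'.cod = N.cod) (hp : ∀ q, N.Enters q → N'.pass q = N.pass q)
    (hb : ∀ q, N.Enters q → N'.bead q = N.bead q) : N'.Represents M := by
  have hE : ∀ q, N'.Enters q → N.Enters q := by
    rintro ⟨t, j⟩ hq
    cases t <;> simpa [Slab.Enters, hd, hc] using hq
  refine ⟨h.ne_nil, by rw [hd, hc]; exact h.fits, h.valid, fun j hj => ?_, fun j hj => ?_, h.exits⟩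
  · rw [hp _ (hE _ hj), hb _ (hE _ hj)]
    exact h.bottom j (hE _ hj)
  · rw [hp _ (hE _ hj), hb _ (hE _ hj)]
    exact h.top j (hE _ hj)

theorem Slab.Represents.closed [Monoid A] {N : Slab A} {M b a : List (Slab A)} (h : N.Represents M)
    (hN : N.Valid) (hcl : SlabsClosed (b ++ M ++ a)) : SlabsClosed (b ++ [N] ++ a) :=
  hcl.replace h.ne_nil h.fits ⟨rfl, rfl⟩ (by simpa using hN)

theorem Slab.Represents.slabValue_eq [Monoid A] {K : Type*} [CommMonoid K] {T : A → K}
    (hT : ∀ a b, T (a * b) = T (b * a)) {N : Slab A} {M b a : List (Slab A)} (h : N.Represents M)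
    (hcl : SlabsClosed (b ++ [N] ++ a)) :
    slabValue T (b ++ M ++ a) = slabValue T (b ++ [N] ++ a) :=
  slabValue_merge hT (hcl.replace (by simp) (M := [N]) ⟨rfl, rfl⟩ h.fits h.valid)
    (hcl.valid N (by simp)) h

/-- The slabs `X` and `Y` side by side, with vertical lines `m` between them. -/
def Slab.beside [One A] (X : Slab A) (m : List Dir) (Y : Slab A) : Slab A where
  dom := X.dom ++ m ++ Y.dom
  cod := X.cod ++ m ++ Y.cod
  pass q :=
    if q.2 < (X.side q.1).length then X.pass q
    else if q.2 < (X.side q.1).length + m.length then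
      (!q.1, q.2 - (X.side q.1).length + (X.side (!q.1)).length)
    else
      let p := Y.pass (q.1, q.2 - ((X.side q.1).length + m.length))
      (p.1, (X.side p.1).length + m.length + p.2)
  bead q :=
    if q.2 < (X.side q.1).length then X.bead q
    else if q.2 < (X.side q.1).length + m.length then 1
    else Y.bead (q.1, q.2 - ((X.side q.1).length + m.length))

namespace Slab

variable {X Y : Slab A} {m : List Dir}

variable [One A]

theorem side_beside (t : Bool) : (X.beside m Y).side t = X.side t ++ m ++ Y.side t := by
  cases t <;> rfl

theorem beside_cases {A : Type*} (X : Slab A) (m : List Dir) (t : Bool) (j : ℕ) :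
    j < (X.side t).length ∨ (∃ i, j = (X.side t).length + i ∧ i < m.length) ∨
      ∃ i, j = (X.side t).length + m.length + i := by
  rcases lt_or_ge j (X.side t).length with h | h
  · exact .inl h
  · rcases lt_or_ge j ((X.side t).length + m.length) with h' | h'
    · exact .inr (.inl ⟨j - (X.side t).length, by omega, by omega⟩)
    · exact .inr (.inr ⟨j - ((X.side t).length + m.length), by omega⟩)

theorem beside_left {t : Bool} {j : ℕ} (h : j < (X.side t).length) :
    (X.beside m Y).pass (t, j) = X.pass (t, j) ∧ (X.beside m Y).bead (t, j) = X.bead (t, j) ∧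
      ((X.beside m Y).Enters (t, j) ↔ X.Enters (t, j)) := by
  refine ⟨by simp [beside, h], by simp [beside, h], ?_⟩
  rw [Enters, side_beside, List.append_assoc, List.getElem?_append_left h]
  rfl

theorem beside_mid {t : Bool} {i : ℕ} (h : i < m.length) :
    (X.beside m Y).pass (t, (X.side t).length + i) = (!t, (X.side (!t)).length + i) ∧
      (X.beside m Y).bead (t, (X.side t).length + i) = 1 := by
  refine ⟨by simp [beside, h, add_comm], by simp [beside, h]⟩

theorem beside_right {t : Bool} {i : ℕ} :
    (X.beside m Y).pass (t, (X.side t).length + m.length + i) =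
        ((Y.pass (t, i)).1, (X.side (Y.pass (t, i)).1).length + m.length + (Y.pass (t, i)).2) ∧
      (X.beside m Y).bead (t, (X.side t).length + m.length + i) = Y.bead (t, i) ∧
      ((X.beside m Y).Enters (t, (X.side t).length + m.length + i) ↔ Y.Enters (t, i)) := by
  have h1 : ¬ (X.side t).length + m.length + i < (X.side t).length := by omega
  have h2 : ¬ (X.side t).length + m.length + i < (X.side t).length + m.length := by omega
  have h3 : (X.side t).length + m.length + i - ((X.side t).length + m.length) = i := by omega
  refine ⟨by simp only [beside, h1, h2, h3, if_false], by simp only [beside, h1, h2, h3, if_false],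
    ?_⟩
  rw [Enters, side_beside, List.getElem?_append_right (by simp), List.length_append, h3]
  rfl

theorem getElem?_beside_left {t : Bool} {j : ℕ} (h : j < (X.side t).length) :
    ((X.beside m Y).side t)[j]? = (X.side t)[j]? := by
  rw [side_beside, List.append_assoc, List.getElem?_append_left h]

theorem getElem?_beside_mid {t : Bool} {i : ℕ} (h : i < m.length) :
    ((X.beside m Y).side t)[(X.side t).length + i]? = m[i]? := by
  rw [side_beside, List.append_assoc, List.getElem?_append_right (by omega),
    List.getElem?_append_left (by omega), Nat.add_sub_cancel_left]

theorem getElem?_beside_right {t : Bool} {i : ℕ} :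
    ((X.beside m Y).side t)[(X.side t).length + m.length + i]? = (Y.side t)[i]? := by
  rw [side_beside, List.getElem?_append_right (by simp), List.length_append,
    Nat.add_sub_cancel_left]

theorem Valid.beside (hX : X.Valid) (hY : Y.Valid) (m : List Dir) : (X.beside m Y).Valid := by
  constructor
  · rintro ⟨t, j⟩ hq
    rcases beside_cases X m t j with hj | ⟨i, rfl, hi⟩ | ⟨i, rfl⟩
    · rw [(beside_left hj).1]
      have hl := hX.leaves _ ((beside_left hj).2.2.1 hq)
      rw [Leaves, getElem?_beside_left hl.lt]
      exact hl
    · rw [(beside_mid hi).1]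
      rw [Enters, getElem?_beside_mid hi] at hq
      rw [Leaves, getElem?_beside_mid hi, hq, Bool.not_not]
    · rw [beside_right.1]
      have hl := hY.leaves _ (beside_right.2.2.1 hq)
      rw [Leaves, getElem?_beside_right]
      exact hl
  · rintro ⟨t, j⟩ ⟨t', j'⟩ hq hq' he
    rcases beside_cases X m t j with hj | ⟨i, rfl, hi⟩ | ⟨i, rfl⟩ <;>
      rcases beside_cases X m t' j' with hj' | ⟨i', rfl, hi'⟩ | ⟨i', rfl⟩
    · rw [(beside_left hj).1, (beside_left hj').1] at he
      exact hX.inj _ _ ((beside_left hj).2.2.1 hq) ((beside_left hj').2.2.1 hq') he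
    · exfalso
      rw [(beside_left hj).1, (beside_mid hi').1] at he
      have hl := (hX.leaves _ ((beside_left hj).2.2.1 hq)).lt
      rw [he] at hl
      exact absurd hl (by simp)
    · exfalso
      rw [(beside_left hj).1, beside_right.1] at he
      have hl := (hX.leaves _ ((beside_left hj).2.2.1 hq)).lt
      rw [he] at hl
      exact absurd hl (by simp; omega)
    · exfalso
      rw [(beside_left hj').1, (beside_mid hi).1] at he
      have hl := (hX.leaves _ ((beside_left hj').2.2.1 hq')).lt
      rw [← he] at hl
      exact absurd hl (by simp)
    · rw [(beside_mid hi).1, (beside_mid hi').1] at he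
      cases t <;> cases t' <;> simp at he ⊢ <;> exact he
    · exfalso
      rw [(beside_mid hi).1, beside_right.1] at he
      obtain ⟨h1, h2⟩ := Prod.ext_iff.1 he
      simp only at h1 h2
      rw [← h1] at h2
      omega
    · exfalso
      rw [(beside_left hj').1, beside_right.1] at he
      have hl := (hX.leaves _ ((beside_left hj').2.2.1 hq')).lt
      rw [← he] at hl
      exact absurd hl (by simp; omega)
    · exfalso
      rw [(beside_mid hi').1, beside_right.1] at he
      obtain ⟨h1, h2⟩ := Prod.ext_iff.1 he
      simp only at h1 h2
      rw [h1] at h2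
      omega
    · rw [beside_right.1, beside_right.1] at he
      obtain ⟨h1, h2⟩ := Prod.ext_iff.1 he
      simp only at h1 h2
      rw [h1] at h2
      have := hY.inj _ _ (beside_right.2.2.1 hq) (beside_right.2.2.1 hq')
        (Prod.ext h1 (by omega))
      simp only [Prod.mk.injEq] at this
      obtain ⟨rfl, rfl⟩ := this
      rfl

end Slab

section Two

variable [Monoid A] {P R : Slab A} {q : Bool × ℕ} {j j' j'' : ℕ}

/-- This and the following lemmas list the routes through a stack of two. In an exchange of heights
each strand meets at most one of the two pieces, so it can turn at most once and passes at most
three slabs. -/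
theorem Transit.two_zero_false (h : P.pass q = (false, j)) :
    Transit [P, R] 0 q (P.bead q) (false, j) := .first rfl h

theorem Transit.two_one_true (h : R.pass q = (true, j)) :
    Transit [P, R] 1 q (R.bead q) (true, j) := .last rfl h rfl

theorem Transit.two_zero_true (h : P.pass q = (true, j)) (h' : R.pass (false, j) = (true, j')) :
    Transit [P, R] 0 q (P.bead q * R.bead (false, j)) (true, j') :=
  .up rfl h (by simp) (two_one_true h')

theorem Transit.two_one_false (h : R.pass q = (false, j)) (h' : P.pass (true, j) = (false, j')) :
    Transit [P, R] 1 q (R.bead q * P.bead (true, j)) (false, j') :=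
  .down rfl h (two_zero_false h')

theorem Transit.two_zero_turn (h : P.pass q = (true, j)) (h' : R.pass (false, j) = (false, j'))
    (h'' : P.pass (true, j') = (false, j'')) :
    Transit [P, R] 0 q (P.bead q * (R.bead (false, j) * P.bead (true, j'))) (false, j'') :=
  .up rfl h (by simp) (two_one_false h' h'')

theorem Transit.two_one_turn (h : R.pass q = (false, j)) (h' : P.pass (true, j) = (true, j'))
    (h'' : R.pass (false, j') = (true, j'')) :
    Transit [P, R] 1 q (R.bead q * (P.bead (true, j) * R.bead (false, j'))) (true, j'') :=
  .down rfl h (two_zero_true h' h'')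

end Two

/-! ### Exchange of heights of two separated pieces -/

section Represents

variable [Monoid A] {X Y : Slab A}

theorem Slab.whisker_nil_pass {t : Bool} {j : ℕ} {r : List Dir} (h : j < (X.side t).length) :
    (X.whisker [] r).pass (t, j) = X.pass (t, j) ∧ (X.whisker [] r).bead (t, j) = X.bead (t, j) := by
  have h1 := whisker_pass_mid (l := []) (r := r) h
  have h2 := whisker_bead_mid (l := []) (r := r) h
  simp only [List.length_nil, zero_add] at h1 h2
  exact ⟨h1, h2⟩

theorem Slab.whisker_nil_pass_right {t : Bool} {i : ℕ} {r : List Dir} :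
    (X.whisker [] r).pass (t, (X.side t).length + i) = (!t, (X.side (!t)).length + i) ∧
      (X.whisker [] r).bead (t, (X.side t).length + i) = 1 := by
  have h1 := whisker_pass_right (x := X) (l := []) (r := r) (t := t) (j := i)
  have h2 := whisker_bead_right (x := X) (l := []) (r := r) (t := t) (j := i)
  simp only [List.length_nil, zero_add] at h1 h2
  exact ⟨h1, h2⟩

theorem Slab.whisker_pass_mid' {l r : List Dir} {t : Bool} {n j : ℕ} (hn : n = l.length)
    (h : j < (X.side t).length) :
    (X.whisker l r).pass (t, n + j) = ((X.pass (t, j)).1, n + (X.pass (t, j)).2) ∧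
      (X.whisker l r).bead (t, n + j) = X.bead (t, j) := by
  subst hn
  exact ⟨whisker_pass_mid h, whisker_bead_mid h⟩

theorem Slab.whisker_pass_left' {l r : List Dir} {t : Bool} {j : ℕ} (h : j < l.length) :
    (X.whisker l r).pass (t, j) = (!t, j) ∧ (X.whisker l r).bead (t, j) = 1 :=
  ⟨whisker_pass_left h, whisker_bead_left h⟩

/-- Both relative heights of `X` and `Y` represent the same slab, so the height move reduces to
merging twice. A strand of one piece sees the other slab as a vertical line with bead 1. -/
theorem Slab.beside_represents_left (hX : X.Valid) (hY : Y.Valid) (m : List Dir) :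
    (X.beside m Y).Represents [X.whisker [] (m ++ Y.dom), Y.whisker (X.cod ++ m) []] := by
  have hlen : X.cod.length + m.length = (X.cod ++ m).length := by simp
  have bottom : ∀ j, (X.beside m Y).Enters (false, j) →
      Transit [X.whisker [] (m ++ Y.dom), Y.whisker (X.cod ++ m) []] 0 (false, j)
        ((X.beside m Y).bead (false, j)) ((X.beside m Y).pass (false, j)) := by
    intro j hj
    rcases beside_cases X m false j with h | ⟨i, rfl, hi⟩ | ⟨i, rfl⟩
    · obtain ⟨h1, h2, h3⟩ := beside_left (m := m) (Y := Y) h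
      obtain ⟨h4, h5⟩ := whisker_nil_pass (r := m ++ Y.dom) h
      have hl := (hX.leaves _ (h3.1 hj)).lt
      rw [h1, h2]
      rw [← h5]
      rcases hp : X.pass (false, j) with ⟨t, j'⟩
      rw [hp] at hl h4
      cases t
      · exact .two_zero_false h4
      · obtain ⟨h6, h7⟩ := whisker_pass_left' (X := Y) (l := X.cod ++ m) (r := [])
          (t := false) (j := j') (by simp at hl ⊢; omega)
        have := Transit.two_zero_true h4 h6
        rwa [h7, mul_one] at this
    · obtain ⟨h1, h2⟩ := beside_mid (X := X) (Y := Y) (t := false) hi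
      obtain ⟨h4, h5⟩ := whisker_nil_pass_right (X := X) (r := m ++ Y.dom) (t := false) (i := i)
      obtain ⟨h6, h7⟩ := whisker_pass_left' (X := Y) (l := X.cod ++ m) (r := [])
          (t := false) (j := X.cod.length + i) (by simp; omega)
      rw [h1, h2]
      have := Transit.two_zero_true h4 h6
      simp only [side_true, side_false, Bool.not_false] at this h5 ⊢
      rwa [h5, h7, mul_one] at this
    · obtain ⟨h1, h2, h3⟩ := beside_right (X := X) (m := m) (Y := Y) (t := false) (i := i)
      have hE := h3.1 hj
      obtain ⟨h4, h5⟩ := whisker_nil_pass_right (X := X) (r := m ++ Y.dom) (t := false)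
        (i := m.length + i)
      obtain ⟨h6, h7⟩ := whisker_pass_mid' (X := Y) (l := X.cod ++ m) (r := []) hlen hE.lt
      rw [← add_assoc, ← add_assoc] at h4
      rw [← add_assoc] at h5
      rw [h1, h2]
      rcases hp : Y.pass (false, i) with ⟨t, j'⟩
      rw [hp] at h6
      cases t
      -- The strand turns back inside `Y` and crosses the lower slab a second time on its way out.
      · obtain ⟨h8, h9⟩ := whisker_nil_pass_right (X := X) (r := m ++ Y.dom) (t := true)
          (i := m.length + j')
        rw [← add_assoc, ← add_assoc] at h8
        rw [← add_assoc] at h9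
        have := Transit.two_zero_turn h4 h6 h8
        simp only [side_true, side_false, Bool.not_true, Bool.not_false] at this h9 h5 ⊢
        rwa [h5, h7, h9, one_mul, mul_one] at this
      · have := Transit.two_zero_true h4 h6
        simp only [side_true, side_false, Bool.not_false] at this h5 ⊢
        rwa [h5, h7, one_mul] at this
  have top : ∀ j, (X.beside m Y).Enters (true, j) →
      Transit [X.whisker [] (m ++ Y.dom), Y.whisker (X.cod ++ m) []] 1 (true, j)
        ((X.beside m Y).bead (true, j)) ((X.beside m Y).pass (true, j)) := by
    intro j hj
    rcases beside_cases X m true j with h | ⟨i, rfl, hi⟩ | ⟨i, rfl⟩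
    · obtain ⟨h1, h2, h3⟩ := beside_left (m := m) (Y := Y) h
      obtain ⟨h4, h5⟩ := whisker_nil_pass (r := m ++ Y.dom) h
      obtain ⟨h6, h7⟩ := whisker_pass_left' (X := Y) (l := X.cod ++ m) (r := [])
        (t := true) (j := j) (by simp at h ⊢; omega)
      have hl := (hX.leaves _ (h3.1 hj)).lt
      rw [h1, h2]
      rw [← h5]
      rcases hp : X.pass (true, j) with ⟨t, j'⟩
      rw [hp] at hl h4
      cases t
      · have := Transit.two_one_false h6 h4
        rwa [h7, one_mul] at this
      · obtain ⟨h8, h9⟩ := whisker_pass_left' (X := Y) (l := X.cod ++ m) (r := [])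
          (t := false) (j := j') (by simp at hl ⊢; omega)
        have := Transit.two_one_turn h6 h4 h8
        rwa [h7, h9, one_mul, mul_one] at this
    · obtain ⟨h1, h2⟩ := beside_mid (X := X) (Y := Y) (t := true) hi
      obtain ⟨h4, h5⟩ := whisker_nil_pass_right (X := X) (r := m ++ Y.dom) (t := true) (i := i)
      obtain ⟨h6, h7⟩ := whisker_pass_left' (X := Y) (l := X.cod ++ m) (r := [])
          (t := true) (j := X.cod.length + i) (by simp; omega)
      rw [h1, h2]
      have := Transit.two_one_false h6 h4
      simp only [side_true, side_false, Bool.not_true] at this h5 ⊢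
      rwa [h5, h7, mul_one] at this
    · obtain ⟨h1, h2, h3⟩ := beside_right (X := X) (m := m) (Y := Y) (t := true) (i := i)
      obtain ⟨h6, h7⟩ := whisker_pass_mid' (X := Y) (l := X.cod ++ m) (r := []) hlen (h3.1 hj).lt
      rw [h1, h2]
      rcases hp : Y.pass (true, i) with ⟨t, j'⟩
      rw [hp] at h6
      cases t
      · obtain ⟨h8, h9⟩ := whisker_nil_pass_right (X := X) (r := m ++ Y.dom) (t := true)
          (i := m.length + j')
        rw [← add_assoc, ← add_assoc] at h8
        rw [← add_assoc] at h9
        have := Transit.two_one_false h6 h8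
        simp only [side_true, side_false, Bool.not_true] at this h9 ⊢
        rwa [h7, h9, mul_one] at this
      · have := Transit.two_one_true (P := X.whisker [] (m ++ Y.dom)) h6
        simp only [side_true] at this ⊢
        rwa [h7] at this
  have hv : ∀ x ∈ [X.whisker [] (m ++ Y.dom), Y.whisker (X.cod ++ m) []], x.Valid := by
    simp [hX.whisker, hY.whisker]
  refine ⟨by simp, ⟨by simp [beside, whisker], by simp [whisker],
    by simp [beside, whisker, SlabsFit]⟩, hv,
    bottom, top, ?_⟩
  rintro i x ⟨t, j⟩ hx hq
  have hi := (List.getElem?_eq_some_iff.1 hx).1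
  simp only [List.length_cons, List.length_nil, zero_add, Nat.reduceAdd] at hi
  interval_cases i <;> obtain rfl := Option.some.inj hx <;> cases t
  · exact ⟨_, _, bottom j (by simpa [Enters, beside, whisker] using hq)⟩
  · rcases lt_or_ge j X.cod.length with h | h
    · obtain ⟨h4, h5⟩ := whisker_nil_pass (X := X) (t := true) (r := m ++ Y.dom) h
      have hE : X.Enters (true, j) := by
        have := (whisker_enters_mid (l := []) (x := X) (r := m ++ Y.dom) (t := true) h).1
        simp only [List.length_nil, zero_add] at this
        exact this hq
      have hl := (hX.leaves _ hE).lt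
      rcases hp : X.pass (true, j) with ⟨t, j'⟩
      rw [hp] at hl h4
      cases t
      · exact ⟨_, _, .two_zero_false h4⟩
      · exact ⟨_, _, .two_zero_true h4 (whisker_pass_left' (by simp at hl ⊢; omega)).1⟩
    · obtain ⟨i, rfl⟩ := Nat.exists_eq_add_of_le h
      exact ⟨_, _, .two_zero_false (whisker_nil_pass_right (X := X) (t := true)).1⟩
  · rcases lt_or_ge j (X.cod ++ m).length with h | h
    · exact ⟨_, _, .two_one_true (whisker_pass_left' h).1⟩
    · obtain ⟨i, rfl⟩ := Nat.exists_eq_add_of_le h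
      have hi : i < (Y.side false).length := by
        have := hq.lt
        simp [whisker] at this ⊢
        omega
      have h6 := (whisker_pass_mid' (X := Y) (l := X.cod ++ m) (r := []) rfl hi).1
      rcases hp : Y.pass (false, i) with ⟨t, j'⟩
      rw [hp] at h6
      cases t
      · have h8 := (whisker_nil_pass_right (X := X) (r := m ++ Y.dom) (t := true)
          (i := m.length + j')).1
        rw [← add_assoc, side_true, hlen] at h8
        exact ⟨_, _, .two_one_false h6 h8⟩
      · exact ⟨_, _, .two_one_true h6⟩
  · exact ⟨_, _, top j (by simpa [Enters, beside, whisker] using hq)⟩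

theorem Slab.beside_represents_right (hX : X.Valid) (hY : Y.Valid) (m : List Dir) :
    (X.beside m Y).Represents [Y.whisker (X.dom ++ m) [], X.whisker [] (m ++ Y.cod)] := by
  have hlen : X.dom.length + m.length = (X.dom ++ m).length := by simp
  have bottom : ∀ j, (X.beside m Y).Enters (false, j) →
      Transit [Y.whisker (X.dom ++ m) [], X.whisker [] (m ++ Y.cod)] 0 (false, j)
        ((X.beside m Y).bead (false, j)) ((X.beside m Y).pass (false, j)) := by
    intro j hj
    rcases beside_cases X m false j with h | ⟨i, rfl, hi⟩ | ⟨i, rfl⟩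
    · obtain ⟨h1, h2, h3⟩ := beside_left (m := m) (Y := Y) h
      obtain ⟨h4, h5⟩ := whisker_nil_pass (r := m ++ Y.cod) h
      obtain ⟨h6, h7⟩ := whisker_pass_left' (X := Y) (l := X.dom ++ m) (r := [])
        (t := false) (j := j) (by simp at h ⊢; omega)
      have hl := (hX.leaves _ (h3.1 hj)).lt
      rw [h1, h2]
      rw [← h5]
      rcases hp : X.pass (false, j) with ⟨t, j'⟩
      rw [hp] at hl h4
      cases t
      · obtain ⟨h8, h9⟩ := whisker_pass_left' (X := Y) (l := X.dom ++ m) (r := [])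
          (t := true) (j := j') (by simp at hl ⊢; omega)
        have := Transit.two_zero_turn h6 h4 h8
        rwa [h7, h9, one_mul, mul_one] at this
      · have := Transit.two_zero_true h6 h4
        rwa [h7, one_mul] at this
    · obtain ⟨h1, h2⟩ := beside_mid (X := X) (Y := Y) (t := false) hi
      obtain ⟨h4, h5⟩ := whisker_nil_pass_right (X := X) (r := m ++ Y.cod) (t := false) (i := i)
      obtain ⟨h6, h7⟩ := whisker_pass_left' (X := Y) (l := X.dom ++ m) (r := [])
          (t := false) (j := X.dom.length + i) (by simp; omega)
      rw [h1, h2]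
      have := Transit.two_zero_true h6 h4
      simp only [side_true, side_false, Bool.not_false] at this h5 ⊢
      rwa [h5, h7, mul_one] at this
    · obtain ⟨h1, h2, h3⟩ := beside_right (X := X) (m := m) (Y := Y) (t := false) (i := i)
      obtain ⟨h6, h7⟩ := whisker_pass_mid' (X := Y) (l := X.dom ++ m) (r := []) hlen (h3.1 hj).lt
      rw [h1, h2]
      rcases hp : Y.pass (false, i) with ⟨t, j'⟩
      rw [hp] at h6
      cases t
      · have := Transit.two_zero_false (R := X.whisker [] (m ++ Y.cod)) h6
        simp only [side_false] at this ⊢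
        rwa [h7] at this
      · obtain ⟨h8, h9⟩ := whisker_nil_pass_right (X := X) (r := m ++ Y.cod) (t := false)
          (i := m.length + j')
        rw [← add_assoc, ← add_assoc] at h8
        rw [← add_assoc] at h9
        have := Transit.two_zero_true h6 h8
        simp only [side_true, side_false, Bool.not_false] at this h9 ⊢
        rwa [h7, h9, mul_one] at this
  have top : ∀ j, (X.beside m Y).Enters (true, j) →
      Transit [Y.whisker (X.dom ++ m) [], X.whisker [] (m ++ Y.cod)] 1 (true, j)
        ((X.beside m Y).bead (true, j)) ((X.beside m Y).pass (true, j)) := by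
    intro j hj
    rcases beside_cases X m true j with h | ⟨i, rfl, hi⟩ | ⟨i, rfl⟩
    · obtain ⟨h1, h2, h3⟩ := beside_left (m := m) (Y := Y) h
      obtain ⟨h4, h5⟩ := whisker_nil_pass (r := m ++ Y.cod) h
      have hl := (hX.leaves _ (h3.1 hj)).lt
      rw [h1, h2]
      rw [← h5]
      rcases hp : X.pass (true, j) with ⟨t, j'⟩
      rw [hp] at hl h4
      cases t
      · obtain ⟨h6, h7⟩ := whisker_pass_left' (X := Y) (l := X.dom ++ m) (r := [])
          (t := true) (j := j') (by simp at hl ⊢; omega)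
        have := Transit.two_one_false h4 h6
        rwa [h7, mul_one] at this
      · exact .two_one_true h4
    · obtain ⟨h1, h2⟩ := beside_mid (X := X) (Y := Y) (t := true) hi
      obtain ⟨h4, h5⟩ := whisker_nil_pass_right (X := X) (r := m ++ Y.cod) (t := true) (i := i)
      obtain ⟨h6, h7⟩ := whisker_pass_left' (X := Y) (l := X.dom ++ m) (r := [])
          (t := true) (j := X.dom.length + i) (by simp; omega)
      rw [h1, h2]
      have := Transit.two_one_false h4 h6
      simp only [side_true, side_false, Bool.not_true] at this h5 ⊢
      rwa [h5, h7, mul_one] at this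
    · obtain ⟨h1, h2, h3⟩ := beside_right (X := X) (m := m) (Y := Y) (t := true) (i := i)
      obtain ⟨h4, h5⟩ := whisker_nil_pass_right (X := X) (r := m ++ Y.cod) (t := true)
        (i := m.length + i)
      obtain ⟨h6, h7⟩ := whisker_pass_mid' (X := Y) (l := X.dom ++ m) (r := []) hlen (h3.1 hj).lt
      rw [← add_assoc, ← add_assoc] at h4
      rw [← add_assoc] at h5
      rw [h1, h2]
      rcases hp : Y.pass (true, i) with ⟨t, j'⟩
      rw [hp] at h6
      cases t
      · have := Transit.two_one_false h4 h6
        simp only [side_true, side_false, Bool.not_true] at this h5 ⊢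
        rwa [h5, h7, one_mul] at this
      · obtain ⟨h8, h9⟩ := whisker_nil_pass_right (X := X) (r := m ++ Y.cod) (t := false)
          (i := m.length + j')
        rw [← add_assoc, ← add_assoc] at h8
        rw [← add_assoc] at h9
        have := Transit.two_one_turn h4 h6 h8
        simp only [side_true, side_false, Bool.not_true, Bool.not_false] at this h9 h5 ⊢
        rwa [h5, h7, h9, one_mul, mul_one] at this
  have hv : ∀ x ∈ [Y.whisker (X.dom ++ m) [], X.whisker [] (m ++ Y.cod)], x.Valid := by
    simp [hX.whisker, hY.whisker]
  refine ⟨by simp, ⟨by simp [beside, whisker], by simp [whisker],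
    by simp [beside, whisker, SlabsFit]⟩, hv, bottom, top, ?_⟩
  rintro i x ⟨t, j⟩ hx hq
  have hi := (List.getElem?_eq_some_iff.1 hx).1
  simp only [List.length_cons, List.length_nil, zero_add, Nat.reduceAdd] at hi
  interval_cases i <;> obtain rfl := Option.some.inj hx <;> cases t
  · exact ⟨_, _, bottom j (by simpa [Enters, beside, whisker] using hq)⟩
  · rcases lt_or_ge j (X.dom ++ m).length with h | h
    · exact ⟨_, _, .two_zero_false (whisker_pass_left' h).1⟩
    · obtain ⟨i, rfl⟩ := Nat.exists_eq_add_of_le h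
      have hi : i < (Y.side true).length := by
        have := hq.lt
        simp [whisker] at this ⊢
        omega
      have h6 := (whisker_pass_mid' (X := Y) (l := X.dom ++ m) (r := []) rfl hi).1
      rcases hp : Y.pass (true, i) with ⟨t, j'⟩
      rw [hp] at h6
      cases t
      · exact ⟨_, _, .two_zero_false h6⟩
      · have h8 := (whisker_nil_pass_right (X := X) (r := m ++ Y.cod) (t := false)
          (i := m.length + j')).1
        rw [← add_assoc, side_false, hlen] at h8
        exact ⟨_, _, .two_zero_true h6 h8⟩
  · rcases lt_or_ge j X.dom.length with h | h
    · obtain ⟨h4, h5⟩ := whisker_nil_pass (X := X) (t := false) (r := m ++ Y.cod) h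
      have hE : X.Enters (false, j) := by
        have := (whisker_enters_mid (l := []) (x := X) (r := m ++ Y.cod) (t := false) h).1
        simp only [List.length_nil, zero_add] at this
        exact this hq
      have hl := (hX.leaves _ hE).lt
      rcases hp : X.pass (false, j) with ⟨t, j'⟩
      rw [hp] at hl h4
      cases t
      · exact ⟨_, _, .two_one_false h4 (whisker_pass_left' (by simp at hl ⊢; omega)).1⟩
      · exact ⟨_, _, .two_one_true h4⟩
    · obtain ⟨i, rfl⟩ := Nat.exists_eq_add_of_le h
      exact ⟨_, _, .two_one_true (whisker_nil_pass_right (X := X) (t := false)).1⟩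
  · exact ⟨_, _, top j (by simpa [Enters, beside, whisker] using hq)⟩

end Represents

end Heights

/-! ### The local moves inside a diagram -/

section Moves

variable {k A : Type*} [Field k] [Ring A] [Algebra k A]

/-- The inner lists hold the vertical strands that take part in the move, the outer ones those that
do not. -/
theorem Slice.slab_whisker (g : Aˣ) (p : Piece) (a b : A) {l l' r r' L R : List Dir}
    (hL : L = l ++ l') (hR : R = r' ++ r) :
    Slice.slab g ⟨L, p, R⟩ a b = ((p.slab g a b).whisker l' r').whisker l r := by
  subst hL hR
  exact (Slab.whisker_whisker ..).symm

theorem Slab.withBead_whisker_bead {A : Type*} [One A] {N : Slab A} {l r : List Dir}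
    (β : Bool × ℕ → A) {t : Bool} {j : ℕ} (h : j < (N.side t).length) :
    ((N.withBead β).whisker l r).bead (t, l.length + j) = β (t, j) :=
  Slab.whisker_bead_mid (x := N.withBead β) h

theorem exists_linear_whisker_three {T : A →ₗ[k] k} (hT : ∀ a b, T (a * b) = T (b * a))
    {b c : List (Slab A)} {N : Slab A} {l r : List Dir}
    (h : SlabsClosed (b ++ [N.whisker l r] ++ c)) {q₁ q₂ q₃ : Bool × ℕ} (hq₁ : N.Enters q₁)
    (hq₂ : N.Enters q₂) (hq₃ : N.Enters q₃) (β : A → A → A → Bool × ℕ → A)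
    (h₁ : ∀ a₁ a₂ a₃, β a₁ a₂ a₃ q₁ = a₁) (h₂ : ∀ a₁ a₂ a₃, β a₁ a₂ a₃ q₂ = a₂)
    (h₃ : ∀ a₁ a₂ a₃, β a₁ a₂ a₃ q₃ = a₃)
    (hβ : ∀ a₁ a₂ a₃ q, q ≠ q₁ → q ≠ q₂ → q ≠ q₃ → N.Enters q → β a₁ a₂ a₃ q = β 0 0 0 q) :
    ∃ B : A ⊗[k] (A ⊗[k] A) →ₗ[k] k, ∀ a₁ a₂ a₃,
      slabValue T (b ++ [(N.withBead (β a₁ a₂ a₃)).whisker l r] ++ c) =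
        B (a₁ ⊗ₜ (a₂ ⊗ₜ a₃)) := by
  refine exists_linear_slabValue_three hT h (hq₁.whisker (l := l) (r := r))
    (hq₂.whisker (l := l) (r := r)) (hq₃.whisker (l := l) (r := r))
    (fun a₁ a₂ a₃ => ((N.withBead (β a₁ a₂ a₃)).whisker l r).bead) ?_ ?_ ?_ ?_
  · intro a₁ a₂ a₃
    exact (Slab.withBead_whisker_bead _ hq₁.lt).trans (h₁ ..)
  · intro a₁ a₂ a₃
    exact (Slab.withBead_whisker_bead _ hq₂.lt).trans (h₂ ..)
  · intro a₁ a₂ a₃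
    exact (Slab.withBead_whisker_bead _ hq₃.lt).trans (h₃ ..)
  · rintro a₁ a₂ a₃ ⟨t, j⟩ e₁ e₂ e₃ hE
    rcases Slab.whisker_cases l N t j with hj | ⟨i, rfl, hi⟩ | ⟨i, rfl⟩
    · exact (Slab.whisker_bead_left hj).trans (Slab.whisker_bead_left hj).symm
    · refine (Slab.withBead_whisker_bead _ hi).trans (Eq.trans ?_
        (Slab.withBead_whisker_bead _ hi).symm)
      refine hβ a₁ a₂ a₃ (t, i) ?_ ?_ ?_ ((Slab.whisker_enters_mid hi).1 hE)
      · rintro rfl; exact e₁ rfl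
      · rintro rfl; exact e₂ rfl
      · rintro rfl; exact e₃ rfl
    · exact (Slab.whisker_bead_right (x := N.withBead _)).trans
        (Slab.whisker_bead_right (x := N.withBead _)).symm

theorem exists_linear_whisker_two {T : A →ₗ[k] k} (hT : ∀ a b, T (a * b) = T (b * a))
    {b c : List (Slab A)} {N : Slab A} {l r : List Dir}
    (h : SlabsClosed (b ++ [N.whisker l r] ++ c)) {q₁ q₂ : Bool × ℕ} (hq₁ : N.Enters q₁)
    (hq₂ : N.Enters q₂) (β : A → A → Bool × ℕ → A)
    (h₁ : ∀ a₁ a₂, β a₁ a₂ q₁ = a₁) (h₂ : ∀ a₁ a₂, β a₁ a₂ q₂ = a₂)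
    (hβ : ∀ a₁ a₂ q, q ≠ q₁ → q ≠ q₂ → N.Enters q → β a₁ a₂ q = β 0 0 q) :
    ∃ B : A ⊗[k] A →ₗ[k] k, ∀ a₁ a₂,
      slabValue T (b ++ [(N.withBead (β a₁ a₂)).whisker l r] ++ c) = B (a₁ ⊗ₜ a₂) := by
  refine exists_linear_slabValue_two hT h (hq₁.whisker (l := l) (r := r))
    (hq₂.whisker (l := l) (r := r))
    (fun a₁ a₂ => ((N.withBead (β a₁ a₂)).whisker l r).bead) ?_ ?_ ?_
  · intro a₁ a₂
    exact (Slab.withBead_whisker_bead _ hq₁.lt).trans (h₁ ..)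
  · intro a₁ a₂
    exact (Slab.withBead_whisker_bead _ hq₂.lt).trans (h₂ ..)
  · rintro a₁ a₂ ⟨t, j⟩ e₁ e₂ hE
    rcases Slab.whisker_cases l N t j with hj | ⟨i, rfl, hi⟩ | ⟨i, rfl⟩
    · exact (Slab.whisker_bead_left hj).trans (Slab.whisker_bead_left hj).symm
    · refine (Slab.withBead_whisker_bead _ hi).trans (Eq.trans ?_
        (Slab.withBead_whisker_bead _ hi).symm)
      refine hβ a₁ a₂ (t, i) ?_ ?_ ((Slab.whisker_enters_mid hi).1 hE)
      · rintro rfl; exact e₁ rfl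
      · rintro rfl; exact e₂ rfl
    · exact (Slab.whisker_bead_right (x := N.withBead _)).trans
        (Slab.whisker_bead_right (x := N.withBead _)).symm

theorem Slab.Represents.of_withBead {N N' : Slab A} {M : List (Slab A)}
    (h : ∃ β, (∀ q, N.Enters q → β q = N'.bead q) ∧ (N.withBead β).Represents M)
    (hN : N' = N.withBead N'.bead) : N'.Represents M := by
  obtain ⟨β, hβ, hM⟩ := h
  rw [hN]
  exact hM.congr rfl rfl (fun _ _ => rfl) fun q hq => (hβ q hq).symm

theorem exists_linear_reversalSlab {T : A →ₗ[k] k} (hT : ∀ a b, T (a * b) = T (b * a))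
    {b c : List (Slab A)} {x y z : Dir} {l r : List Dir}
    (h : SlabsClosed (b ++ [(reversalSlab x y z (1 : A) 1 1).whisker l r] ++ c)) :
    ∃ B : A ⊗[k] (A ⊗[k] A) →ₗ[k] k, ∀ a₁ a₂ a₃,
      slabValue T (b ++ [(reversalSlab x y z a₁ a₂ a₃).whisker l r] ++ c) =
        B (a₁ ⊗ₜ (a₂ ⊗ₜ a₃)) := by
  -- The three strands join position 0 to 2, 1 to 1 and 2 to 0; the direction decides at which end
  -- each of them enters.
  refine exists_linear_whisker_three hT h (q₁ := x.entry 0 2) (q₂ := y.entry 1 1)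
    (q₃ := z.entry 2 0) (by cases x <;> rfl) (by cases y <;> rfl) (by cases z <;> rfl)
    (fun a₁ a₂ a₃ => (reversalSlab x y z a₁ a₂ a₃).bead) ?_ ?_ ?_ ?_
  · intros; cases x <;> rfl
  · intros; cases y <;> rfl
  · intros; cases z <;> rfl
  · rintro a₁ a₂ a₃ ⟨t, j⟩ e₁ e₂ e₃ hE
    exfalso
    have hj : j < 3 := hE.lt.trans_le (by cases t <;> simp [reversalSlab])
    cases x <;> cases y <;> cases z <;> cases t <;> interval_cases j <;>
      simp [Slab.Enters, reversalSlab, Dir.into, Dir.entry] at hE e₁ e₂ e₃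

theorem exists_linear_parallelSlab {T : A →ₗ[k] k} (hT : ∀ a b, T (a * b) = T (b * a))
    {b c : List (Slab A)} {x y : Dir} {l r : List Dir}
    (h : SlabsClosed (b ++ [(parallelSlab x y (1 : A) 1).whisker l r] ++ c)) :
    ∃ B : A ⊗[k] A →ₗ[k] k, ∀ a₁ a₂,
      slabValue T (b ++ [(parallelSlab x y a₁ a₂).whisker l r] ++ c) = B (a₁ ⊗ₜ a₂) := by
  refine exists_linear_whisker_two hT h (q₁ := x.entry 0 0) (q₂ := y.entry 1 1)
    (by cases x <;> rfl) (by cases y <;> rfl) (fun a₁ a₂ => (parallelSlab x y a₁ a₂).bead) ?_ ?_ ?_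
  · intros; cases x <;> rfl
  · intros; cases y <;> rfl
  · rintro a₁ a₂ ⟨t, j⟩ e₁ e₂ hE
    exfalso
    have hj : j < 2 := hE.lt.trans_le (by cases t <;> simp [parallelSlab])
    cases x <;> cases y <;> cases t <;> interval_cases j <;>
      simp [Slab.Enters, parallelSlab, Dir.into, Dir.entry] at hE e₁ e₂

theorem exists_linear_maxSlab {T : A →ₗ[k] k} (hT : ∀ a b, T (a * b) = T (b * a))
    {b c : List (Slab A)} {x y : Dir} {l r : List Dir}
    (h : SlabsClosed (b ++ [(maxSlab x y (1 : A) 1).whisker l r] ++ c)) :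
    ∃ B : A ⊗[k] A →ₗ[k] k, ∀ a₁ a₂,
      slabValue T (b ++ [(maxSlab x y a₁ a₂).whisker l r] ++ c) = B (a₁ ⊗ₜ a₂) := by
  refine exists_linear_whisker_two hT h
    -- Both ends of the arc are at the bottom, and the direction of its left leg decides by which of
    -- them it enters.
    (q₁ := match x with | .up => (false, 0) | .down => (false, 2)) (q₂ := y.entry 1 0)
    (by cases x <;> rfl) (by cases y <;> rfl) (fun a₁ a₂ => (maxSlab x y a₁ a₂).bead) ?_ ?_ ?_
  · intros; cases x <;> rfl
  · intros; cases y <;> rfl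
  · rintro a₁ a₂ ⟨t, j⟩ e₁ e₂ hE
    exfalso
    have hj : j < 3 := hE.lt.trans_le (by cases t <;> simp [maxSlab])
    cases x <;> cases y <;> cases t <;> interval_cases j <;>
      simp [Slab.Enters, maxSlab, Dir.into, Dir.entry, Dir.flip] at hE e₁ e₂

theorem exists_linear_minSlab {T : A →ₗ[k] k} (hT : ∀ a b, T (a * b) = T (b * a))
    {b c : List (Slab A)} {x y : Dir} {l r : List Dir}
    (h : SlabsClosed (b ++ [(minSlab x y (1 : A) 1).whisker l r] ++ c)) :
    ∃ B : A ⊗[k] A →ₗ[k] k, ∀ a₁ a₂,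
      slabValue T (b ++ [(minSlab x y a₁ a₂).whisker l r] ++ c) = B (a₁ ⊗ₜ a₂) := by
  refine exists_linear_whisker_two hT h
    -- An arc whose left leg is directed up comes in through its right end.
    (q₁ := match x with | .up => (true, 2) | .down => (true, 0)) (q₂ := y.entry 0 1)
    (by cases x <;> rfl) (by cases y <;> rfl) (fun a₁ a₂ => (minSlab x y a₁ a₂).bead) ?_ ?_ ?_
  · intros; cases x <;> rfl
  · intros; cases y <;> rfl
  · rintro a₁ a₂ ⟨t, j⟩ e₁ e₂ hE
    exfalso
    have hj : j < 3 := hE.lt.trans_le (by cases t <;> simp [minSlab])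
    cases x <;> cases y <;> cases t <;> interval_cases j <;>
      simp [Slab.Enters, minSlab, Dir.into, Dir.entry, Dir.flip] at hE e₁ e₂

variable {g : Aˣ} {r r' : A ⊗[k] A}

/-- The sum over the states is invariant under the local moves. -/
theorem LocalMove.stateSum_eq (H : BraidTensor g r r')
    (D : CrossingExpansions (crossingTensor g r r')) {T : A →ₗ[k] k}
    (hT : ∀ a b, T (a * b) = T (b * a)) {M M' : List Slice} (hM : LocalMove M M')
    {b c : List (Slab A)} (hcl : ∀ ys, Decorates g M ys → SlabsClosed (b ++ ys ++ c)) :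
    stateSum D g M (fun ys => slabValue T (b ++ ys ++ c)) =
      stateSum D g M' (fun ys => slabValue T (b ++ ys ++ c)) := by
  cases hM with
  | heights l m r p p' =>
    have e₁ : ∀ a a' : A, Slice.slab g ⟨l, p, m ++ p'.dom ++ r⟩ a a' =
        ((p.slab g a a').whisker [] (m ++ p'.dom)).whisker l r := fun a a' =>
      Slice.slab_whisker g p a a' (by simp) (by simp)
    have e₂ : ∀ a a' : A, Slice.slab g ⟨l ++ p.cod ++ m, p', r⟩ a a' =
        ((p'.slab g a a').whisker (p.cod ++ m) []).whisker l r := fun a a' =>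
      Slice.slab_whisker g p' a a' (by simp) (by simp)
    have e₃ : ∀ a a' : A, Slice.slab g ⟨l ++ p.dom ++ m, p', r⟩ a a' =
        ((p'.slab g a a').whisker (p.dom ++ m) []).whisker l r := fun a a' =>
      Slice.slab_whisker g p' a a' (by simp) (by simp)
    have e₄ : ∀ a a' : A, Slice.slab g ⟨l, p, m ++ p'.cod ++ r⟩ a a' =
        ((p.slab g a a').whisker [] (m ++ p'.cod)).whisker l r := fun a a' =>
      Slice.slab_whisker g p a a' (by simp) (by simp)
    have key : ∀ a a' d d' : A,
        slabValue T (b ++ [Slice.slab g ⟨l, p, m ++ p'.dom ++ r⟩ a a',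
          Slice.slab g ⟨l ++ p.cod ++ m, p', r⟩ d d'] ++ c) =
        slabValue T (b ++ [Slice.slab g ⟨l ++ p.dom ++ m, p', r⟩ d d',
          Slice.slab g ⟨l, p, m ++ p'.cod ++ r⟩ a a'] ++ c) := by
      intro a a' d d'
      have h := hcl _ (.cons ⟨a, a', rfl⟩ (.cons ⟨d, d', rfl⟩ .nil))
      have hX := p.slab_valid g a a'
      have hY := p'.slab_valid g d d'
      have h₁ := (Slab.beside_represents_left hX hY m).whisker l r
      have h₂ := (Slab.beside_represents_right hX hY m).whisker l r
      rw [e₁, e₂] at h ⊢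
      rw [e₃, e₄]
      have h' := h₁.closed ((hX.beside hY m).whisker l r) h
      exact (h₁.slabValue_eq hT h').trans (h₂.slabValue_eq hT h').symm
    -- The two slices appear in the opposite order on the other side, hence the exchange of the
    -- sums.
    refine Eq.trans ?_ Finset.sum_comm
    exact Finset.sum_congr rfl fun i _ => Finset.sum_congr rfl fun j _ => key ..
  | zigzag_left l r x =>
    have key : ∀ a a' d d' : A,
        slabValue T (b ++ [Slice.slab g ⟨l ++ [x], .min x.flip, r⟩ a a',
          Slice.slab g ⟨l, .max x, x :: r⟩ d d'] ++ c) = slabValue T (b ++ [] ++ c) := by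
      intro a a' d d'
      have h := hcl _ (.cons ⟨a, a', rfl⟩ (.cons ⟨d, d', rfl⟩ .nil))
      rw [Slice.slab_whisker g _ a a' (l := l) (l' := [x]) (r' := []) (r := r) (by simp) (by simp),
        Slice.slab_whisker g _ d d' (l := l) (l' := []) (r' := [x]) (r := r) (by simp) (by simp)]
        at h ⊢
      obtain ⟨β, hs, hr⟩ := lineSlab_represents_left g x a a' d d'
      have h₁ := hr.whisker l r
      have h' := h₁.closed (hs.valid.whisker l r) h
      rw [List.append_nil]
      exact (h₁.slabValue_eq hT h').trans (slabValue_straight hT h' (hs.whisker l r))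
    -- Extrema contribute a single summand each, so there is nothing to sum.
    exact (Fintype.sum_unique (ι := Fin 1) _).trans
      ((Fintype.sum_unique (ι := Fin 1) _).trans (key ..))
  | zigzag_right l r x =>
    have key : ∀ a a' d d' : A,
        slabValue T (b ++ [Slice.slab g ⟨l, .min x, x :: r⟩ a a',
          Slice.slab g ⟨l ++ [x], .max x.flip, r⟩ d d'] ++ c) = slabValue T (b ++ [] ++ c) := by
      intro a a' d d'
      have h := hcl _ (.cons ⟨a, a', rfl⟩ (.cons ⟨d, d', rfl⟩ .nil))
      rw [Slice.slab_whisker g _ a a' (l := l) (l' := []) (r' := [x]) (r := r) (by simp) (by simp),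
        Slice.slab_whisker g _ d d' (l := l) (l' := [x]) (r' := []) (r := r) (by simp) (by simp)]
        at h ⊢
      obtain ⟨β, hs, hr⟩ := lineSlab_represents_right g x a a' d d'
      have h₁ := hr.whisker l r
      have h' := h₁.closed (hs.valid.whisker l r) h
      rw [List.append_nil]
      exact (h₁.slabValue_eq hT h').trans (slabValue_straight hT h' (hs.whisker l r))
    exact (Fintype.sum_unique (ι := Fin 1) _).trans
      ((Fintype.sum_unique (ι := Fin 1) _).trans (key ..))
  | reidemeister_two l r s x y =>
    have hv : (parallelSlab x y (1 : A) 1).Valid := (parallelSlab_straight x y).valid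
    have hrep : ∀ a a' d d' : A, ((parallelSlab x y (x.mul a d') (y.mul a' d)).whisker l r).Represents
        [Slice.slab g ⟨l, .crossing s x y, r⟩ a a',
          Slice.slab g ⟨l, .crossing (!s) y x, r⟩ d d'] := by
      intro a a' d d'
      rw [Slice.slab_whisker g _ a a' (l := l) (l' := []) (r' := []) (r := r) (by simp) (by simp),
        Slice.slab_whisker g _ d d' (l := l) (l' := []) (r' := []) (r := r) (by simp) (by simp)]
      exact (Slab.Represents.of_withBead (parallelSlab_represents g s (!s) x y a a' d d')
        rfl).whisker l r
    -- Closedness does not involve the beads, so trivial beads may be used as reference.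
    have hcl' : SlabsClosed (b ++ [(parallelSlab x y (1 : A) 1).whisker l r] ++ c) := by
      have h := (hrep 1 1 1 1).closed ((hv.withBead _).whisker l r)
        (hcl _ (.cons ⟨1, 1, rfl⟩ (.cons ⟨1, 1, rfl⟩ .nil)))
      exact h.withBead _
    obtain ⟨B, hB⟩ := exists_linear_parallelSlab hT hcl'
    have key : ∀ a a' d d' : A,
        slabValue T (b ++ [Slice.slab g ⟨l, .crossing s x y, r⟩ a a',
          Slice.slab g ⟨l, .crossing (!s) y x, r⟩ d d'] ++ c) =
          B (x.mul a d' ⊗ₜ y.mul a' d) := fun a a' d d' =>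
      ((hrep a a' d d').slabValue_eq hT (hcl'.withBead _)).trans (hB _ _)
    refine (Finset.sum_congr rfl fun i _ => Finset.sum_congr rfl fun j _ => key ..).trans ?_
    -- The empty side is the value `B (1 ⊗ 1)`: with trivial beads the merged slab is straight and
    -- can be removed.
    change _ = slabValue T (b ++ [] ++ c)
    rw [List.append_nil, ← slabValue_straight hT hcl' ((parallelSlab_straight x y).whisker l r), hB,
      ← H.reidemeister_two s x y (D s x y) (D (!s) y x), map_sum]
    simp only [map_sum]
    rfl
  | reidemeister_three l r s x y z =>
    have hv := reversalSlab_valid x y z (1 : A) 1 1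
    have hrep : ∀ a a' d d' e e' : A,
        ((reversalSlab x y z (x.mul a d) (y.mul a' e) (z.mul d' e')).whisker l r).Represents
        [Slice.slab g ⟨l, .crossing s x y, z :: r⟩ a a',
          Slice.slab g ⟨l ++ [y], .crossing s x z, r⟩ d d',
          Slice.slab g ⟨l, .crossing s y z, x :: r⟩ e e'] := by
      intro a a' d d' e e'
      rw [Slice.slab_whisker g _ a a' (l := l) (l' := []) (r' := [z]) (r := r) (by simp) (by simp),
        Slice.slab_whisker g _ d d' (l := l) (l' := [y]) (r' := []) (r := r) (by simp) (by simp),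
        Slice.slab_whisker g _ e e' (l := l) (l' := []) (r' := [x]) (r := r) (by simp) (by simp)]
      exact (Slab.Represents.of_withBead (reversalSlab_represents_left g s x y z a a' d d' e e')
        rfl).whisker l r
    have hrep' : ∀ a a' d d' e e' : A,
        ((reversalSlab x y z (x.mul d a) (y.mul e a') (z.mul e' d')).whisker l r).Represents
        [Slice.slab g ⟨l ++ [x], .crossing s y z, r⟩ e e',
          Slice.slab g ⟨l, .crossing s x z, y :: r⟩ d d',
          Slice.slab g ⟨l ++ [z], .crossing s x y, r⟩ a a'] := by
      intro a a' d d' e e'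
      rw [Slice.slab_whisker g _ a a' (l := l) (l' := [z]) (r' := []) (r := r) (by simp) (by simp),
        Slice.slab_whisker g _ d d' (l := l) (l' := []) (r' := [y]) (r := r) (by simp) (by simp),
        Slice.slab_whisker g _ e e' (l := l) (l' := [x]) (r' := []) (r := r) (by simp) (by simp)]
      exact (Slab.Represents.of_withBead (reversalSlab_represents_right g s x y z a a' d d' e e')
        rfl).whisker l r
    have hcl' : SlabsClosed (b ++ [(reversalSlab x y z (1 : A) 1 1).whisker l r] ++ c) := by
      have h := (hrep 1 1 1 1 1 1).closed ((hv.withBead _).whisker l r)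
        (hcl _ (.cons ⟨1, 1, rfl⟩ (.cons ⟨1, 1, rfl⟩ (.cons ⟨1, 1, rfl⟩ .nil))))
      exact h.withBead _
    obtain ⟨B, hB⟩ := exists_linear_reversalSlab hT hcl'
    have key : ∀ a a' d d' e e' : A,
        slabValue T (b ++ [Slice.slab g ⟨l, .crossing s x y, z :: r⟩ a a',
          Slice.slab g ⟨l ++ [y], .crossing s x z, r⟩ d d',
          Slice.slab g ⟨l, .crossing s y z, x :: r⟩ e e'] ++ c) =
          B (x.mul a d ⊗ₜ (y.mul a' e ⊗ₜ z.mul d' e')) := fun a a' d d' e e' =>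
      ((hrep a a' d d' e e').slabValue_eq hT (hcl'.withBead _)).trans (hB _ _ _)
    have key' : ∀ a a' d d' e e' : A,
        slabValue T (b ++ [Slice.slab g ⟨l ++ [x], .crossing s y z, r⟩ e e',
          Slice.slab g ⟨l, .crossing s x z, y :: r⟩ d d',
          Slice.slab g ⟨l ++ [z], .crossing s x y, r⟩ a a'] ++ c) =
          B (x.mul d a ⊗ₜ (y.mul e a' ⊗ₜ z.mul e' d')) := fun a a' d d' e e' =>
      ((hrep' a a' d d' e e').slabValue_eq hT (hcl'.withBead _)).trans (hB _ _ _)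
    refine (Finset.sum_congr rfl fun i _ => Finset.sum_congr rfl fun j _ =>
      Finset.sum_congr rfl fun m _ => key ..).trans (Eq.trans ?_
      (Finset.sum_congr rfl fun i _ => Finset.sum_congr rfl fun j _ =>
      Finset.sum_congr rfl fun m _ => key' ..).symm)
    have h3 := congrArg B (H.crossing_reidemeister_three s x y z (D s x y) (D s x z) (D s y z))
    simp only [map_sum] at h3
    refine h3.trans ?_
    -- After the move the crossings occur in the reversed order, and so do the three sums.
    rw [Finset.sum_comm]
    refine (Finset.sum_congr rfl fun _ _ => Finset.sum_comm).trans ?_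
    exact Finset.sum_comm
  | slide_max l r s x y =>
    have hv := maxSlab_valid x y (1 : A) 1
    have hrep : ∀ a a' d d' : A, ((maxSlab x y (x.mul a (x.maxBead g)) a').whisker l r).Represents
        [Slice.slab g ⟨l, .crossing s x y, x.flip :: r⟩ a a',
          Slice.slab g ⟨l ++ [y], .max x, r⟩ d d'] := by
      intro a a' d d'
      rw [Slice.slab_whisker g _ a a' (l := l) (l' := []) (r' := [x.flip]) (r := r) (by simp)
          (by simp),
        Slice.slab_whisker g _ d d' (l := l) (l' := [y]) (r' := []) (r := r) (by simp) (by simp)]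
      exact (Slab.Represents.of_withBead (maxSlab_represents_left g s x y a a' d d')
        rfl).whisker l r
    have hrep' : ∀ a a' d d' : A, ((maxSlab x y (x.mul (x.maxBead g) a') a).whisker l r).Represents
        [Slice.slab g ⟨l ++ [x], .crossing (!s) y x.flip, r⟩ a a',
          Slice.slab g ⟨l, .max x, y :: r⟩ d d'] := by
      intro a a' d d'
      rw [Slice.slab_whisker g _ a a' (l := l) (l' := [x]) (r' := []) (r := r) (by simp) (by simp),
        Slice.slab_whisker g _ d d' (l := l) (l' := []) (r' := [y]) (r := r) (by simp) (by simp)]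
      exact (Slab.Represents.of_withBead (maxSlab_represents_right g (!s) x y a a' d d')
        rfl).whisker l r
    have hcl' : SlabsClosed (b ++ [(maxSlab x y (1 : A) 1).whisker l r] ++ c) := by
      have h := (hrep 1 1 1 1).closed ((hv.withBead _).whisker l r)
        (hcl _ (.cons ⟨1, 1, rfl⟩ (.cons ⟨1, 1, rfl⟩ .nil)))
      exact h.withBead _
    obtain ⟨B, hB⟩ := exists_linear_maxSlab hT hcl'
    have key : ∀ a a' d d' : A,
        slabValue T (b ++ [Slice.slab g ⟨l, .crossing s x y, x.flip :: r⟩ a a',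
          Slice.slab g ⟨l ++ [y], .max x, r⟩ d d'] ++ c) =
          B (x.mul a (x.maxBead g) ⊗ₜ a') := fun a a' d d' =>
      ((hrep a a' d d').slabValue_eq hT (hcl'.withBead _)).trans (hB _ _)
    have key' : ∀ a a' d d' : A,
        slabValue T (b ++ [Slice.slab g ⟨l ++ [x], .crossing (!s) y x.flip, r⟩ a a',
          Slice.slab g ⟨l, .max x, y :: r⟩ d d'] ++ c) =
          B (x.mul (x.maxBead g) a' ⊗ₜ a) := fun a a' d d' =>
      ((hrep' a a' d d').slabValue_eq hT (hcl'.withBead _)).trans (hB _ _)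
    refine (Finset.sum_congr rfl fun i _ => (Fintype.sum_unique (ι := Fin 1) _).trans
      (key ..)).trans (Eq.trans ?_ (Finset.sum_congr rfl fun i _ =>
        (Fintype.sum_unique (ι := Fin 1) _).trans (key' ..)).symm)
    have h3 := congrArg B (H.slide_max s x y (D s x y) (D (!s) y x.flip))
    simp only [map_sum] at h3
    exact h3
  | slide_min l r s x y =>
    have hv := minSlab_valid x y (1 : A) 1
    have hrep : ∀ a a' d d' : A, ((minSlab x y (x.mul (x.minBead g) a') a).whisker l r).Represents
        [Slice.slab g ⟨l ++ [y], .min x, r⟩ d d',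
          Slice.slab g ⟨l, .crossing s y x, x.flip :: r⟩ a a'] := by
      intro a a' d d'
      rw [Slice.slab_whisker g _ a a' (l := l) (l' := []) (r' := [x.flip]) (r := r) (by simp)
          (by simp),
        Slice.slab_whisker g _ d d' (l := l) (l' := [y]) (r' := []) (r := r) (by simp) (by simp)]
      exact (Slab.Represents.of_withBead (minSlab_represents_left g s x y a a' d d')
        rfl).whisker l r
    have hrep' : ∀ a a' d d' : A, ((minSlab x y (x.mul a (x.minBead g)) a').whisker l r).Represents
        [Slice.slab g ⟨l, .min x, y :: r⟩ d d',
          Slice.slab g ⟨l ++ [x], .crossing (!s) x.flip y, r⟩ a a'] := by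
      intro a a' d d'
      rw [Slice.slab_whisker g _ a a' (l := l) (l' := [x]) (r' := []) (r := r) (by simp) (by simp),
        Slice.slab_whisker g _ d d' (l := l) (l' := []) (r' := [y]) (r := r) (by simp) (by simp)]
      exact (Slab.Represents.of_withBead (minSlab_represents_right g (!s) x y a a' d d')
        rfl).whisker l r
    have hcl' : SlabsClosed (b ++ [(minSlab x y (1 : A) 1).whisker l r] ++ c) := by
      have h := (hrep 1 1 1 1).closed ((hv.withBead _).whisker l r)
        (hcl _ (.cons ⟨1, 1, rfl⟩ (.cons ⟨1, 1, rfl⟩ .nil)))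
      exact h.withBead _
    obtain ⟨B, hB⟩ := exists_linear_minSlab hT hcl'
    have key : ∀ a a' d d' : A,
        slabValue T (b ++ [Slice.slab g ⟨l ++ [y], .min x, r⟩ d d',
          Slice.slab g ⟨l, .crossing s y x, x.flip :: r⟩ a a'] ++ c) =
          B (x.mul (x.minBead g) a' ⊗ₜ a) := fun a a' d d' =>
      ((hrep a a' d d').slabValue_eq hT (hcl'.withBead _)).trans (hB _ _)
    have key' : ∀ a a' d d' : A,
        slabValue T (b ++ [Slice.slab g ⟨l, .min x, y :: r⟩ d d',
          Slice.slab g ⟨l ++ [x], .crossing (!s) x.flip y, r⟩ a a'] ++ c) =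
          B (x.mul a (x.minBead g) ⊗ₜ a') := fun a a' d d' =>
      ((hrep' a a' d d').slabValue_eq hT (hcl'.withBead _)).trans (hB _ _)
    refine ((Fintype.sum_unique (ι := Fin 1) _).trans
      (Finset.sum_congr rfl fun i _ => key ..)).trans (Eq.trans ?_
        ((Fintype.sum_unique (ι := Fin 1) _).trans (Finset.sum_congr rfl fun i _ => key' ..)).symm)
    have h3 := congrArg B (H.slide_min s x y (D s y x) (D (!s) x.flip y))
    simp only [map_sum] at h3
    exact h3

/-- Once the summands at all crossings outside the replaced portion are fixed, only the sum over the
crossings inside it is left, and the local statement applies to that sum. -/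
theorem LinkDiagram.Move.diagramValue_eq (H : BraidTensor g r r')
    (D : CrossingExpansions (crossingTensor g r r')) {T : A →ₗ[k] k}
    (hT : ∀ a b, T (a * b) = T (b * a)) {L L' : LinkDiagram} (h : L.Move L') :
    diagramValue D g T L.slices = diagramValue D g T L'.slices := by
  obtain ⟨below, M, M', above, hM, hL, hL'⟩ := h
  have hf := L.fits
  rw [hL] at hf
  rw [hL, hL', diagramValue, diagramValue]
  simp only [stateSum_append]
  refine stateSum_congr fun bs hb => ?_
  rw [stateSum_comm, stateSum_comm D D M' above]
  refine stateSum_congr fun as ha => ?_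
  refine hM.stateSum_eq H D hT fun ys hy => ?_
  exact ((hb.append hy).append ha).closed hf

theorem LinkDiagram.RegularlyIsotopic.diagramValue_eq (H : BraidTensor g r r')
    (D : CrossingExpansions (crossingTensor g r r')) {T : A →ₗ[k] k}
    (hT : ∀ a b, T (a * b) = T (b * a)) {L L' : LinkDiagram} (h : L.RegularlyIsotopic L') :
    diagramValue D g T L.slices = diagramValue D g T L'.slices := by
  induction h with
  | rel _ _ h => exact h.diagramValue_eq H D hT
  | refl => rfl
  | symm _ _ _ ih => exact ih.symm
  | trans _ _ _ _ _ ih ih' => exact ih.trans ih'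

end Moves

/-! ### Reduction to a standard twist oriented quantum algebra -/

section Reduction

variable {k A : Type*} [Field k] [Ring A] [Algebra k A]

/-- The exponent of `t_d` in the bead on a crossing line of direction `x`. -/
def Dir.exponent : Dir → ℤ
  | .up => 1
  | .down => 0

namespace TwistOrientedQuantumAlgebra

variable (Q : TwistOrientedQuantumAlgebra k A)

/-- The tensors of the crossings. -/
noncomputable def crossing : Bool → Dir → Dir → A ⊗[k] A :=
  crossingTensor Q.G (Q.ρ : A ⊗[k] A) ((Q.ρ⁻¹ : (A ⊗[k] A)ˣ) : A ⊗[k] A)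

/-- The expansions of the tensors of the crossings that result from the decorations. -/
noncomputable def crossingExpansions (E : Q.Expansions) : CrossingExpansions Q.crossing :=
  fun s x y =>
  { n := (E (Piece.crossing s x y).sign).n
    fst := fun i => (Q.td ^ x.exponent)
      (if s then Q.overTwist (.crossing s x y) ((E (Piece.crossing s x y).sign).fst i)
        else Q.underTwist (.crossing s x y) ((E (Piece.crossing s x y).sign).snd i))
    snd := fun i => (Q.td ^ y.exponent)
      (if !s then Q.overTwist (.crossing s x y) ((E (Piece.crossing s x y).sign).fst i)
        else Q.underTwist (.crossing s x y) ((E (Piece.crossing s x y).sign).snd i))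
    sum_eq := by
      have htd := Q.map_td
      have htd' := map_inv_of_map Q.td Q.ρ Q.map_td
      have hc : (Q.td.toLinearMap ∘ₗ Q.tu.toLinearMap) = conjLinear k Q.G := by
        ext a
        exact (Q.conj_G a).trans (mul_assoc _ _ _)
      have c1 := (E true).sum_map Q.td.toLinearMap Q.td.toLinearMap
      have c2 := (E false).sum_map Q.td.toLinearMap Q.td.toLinearMap
      have c3 := (E true).sum_map_comm Q.td.toLinearMap Q.td.toLinearMap
      have c4 := (E false).sum_map_comm Q.td.toLinearMap Q.td.toLinearMap
      have c5 := ((E false).sum_map (Q.td.toLinearMap ∘ₗ Q.tu.toLinearMap) .id).trans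
        (congrArg (fun f => TensorProduct.map f LinearMap.id _) hc)
      have c6 := ((E true).sum_map_comm (Q.td.toLinearMap ∘ₗ Q.tu.toLinearMap) .id).trans
        (congrArg (fun f => TensorProduct.map f LinearMap.id _) hc)
      have c7 := (E true).sum_map .id .id
      have c8 := (E false).sum_map_comm .id .id
      rw [← comm_map_both] at c3 c4
      rw [TensorProduct.map_id] at c7 c8
      simp only [rhoPow] at c1 c2 c3 c4 c5 c6 c7 c8
      rw [htd] at c1 c3
      rw [htd'] at c2 c4
      -- For strands both up, and for those directed to the left, `t_d` acts on both factors and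
      -- leaves ρ and ρ⁻¹ fixed. For those directed to the right, t_d t_u acts on one factor as
      -- conjugation; for both down nothing acts.
      cases s <;> cases x <;> cases y
      · exact c4.symm
      · exact c6.symm
      · exact c3.symm
      · exact c8.symm
      · exact c1.symm
      · exact c5.symm
      · exact c2.symm
      · exact c7.symm }

/-- The bead that belongs to what is met by a strand of direction `x`, where `b` gives the
decorations of the crossing lines. -/
noncomputable def eventBead (b : ℕ → Bool → A) (x : Dir) : Event → A
  | .line i isOver => (Q.td ^ x.exponent) (b i isOver)
  | .uPlus => ((Q.G⁻¹ : Aˣ) : A)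
  | .uMinus => Q.G
  | .vertical => 1
  | .dPlus => 1
  | .dMinus => 1

theorem td_mul_tu_zpow (n : ℤ) (a : A) :
    ((Q.td * Q.tu) ^ n) a = ((Q.G ^ n : Aˣ) : A) * a * ((Q.G ^ (-n) : Aˣ) : A) := by
  have h : ∀ a, (Q.td * Q.tu) a = (Q.G : A) * a * ((Q.G⁻¹ : Aˣ) : A) := Q.conj_G
  have h' : ∀ a, (Q.td * Q.tu)⁻¹ a = ((Q.G⁻¹ : Aˣ) : A) * a * (Q.G : A) := by
    intro a
    refine (AlgEquiv.symm_apply_eq _).2 ?_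
    rw [h]
    simp [mul_assoc]
  induction n generalizing a with
  | zero => simp
  | succ n ih =>
    rw [zpow_add_one, AlgEquiv.mul_apply, ih, h, zpow_add_one, neg_add_rev, zpow_add, zpow_neg_one]
    simp [mul_assoc]
  | pred n ih =>
    rw [zpow_sub_one, AlgEquiv.mul_apply, ih, h', zpow_sub_one, neg_sub, sub_eq_add_neg, zpow_add,
      zpow_one]
    simp [mul_assoc]

theorem commute_td_tu : Commute Q.td Q.tu := AlgEquiv.ext Q.comm

theorem td_zpow_G (n : ℤ) : Q.td ((Q.G ^ n : Aˣ) : A) = ((Q.G ^ n : Aˣ) : A) := by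
  have h : Units.map (Q.td : A →* A) Q.G = Q.G := Units.ext Q.td_G
  have h' := congrArg Units.val (map_zpow (Units.map (Q.td : A →* A)) Q.G n)
  rw [h] at h'
  exact h'

/-- Since `t_d` fixes `G` and the trace, the power of `t_d` that depends on the starting direction
can be discarded. -/
theorem trace_zpow_G_mul {T : A → k} (hT : ∀ a, T (Q.td a) = T a) (n : ℤ) (x : Dir) (a : A) :
    T (((Q.G ^ n : Aˣ) : A) * (Q.td ^ x.exponent) a) = T (((Q.G ^ n : Aˣ) : A) * a) := by
  cases x
  · rw [← hT (((Q.G ^ n : Aˣ) : A) * a), map_mul, td_zpow_G]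
    rfl
  · rfl

/-- The powers of the automorphisms in the word of a component are conjugations with powers of `G`,
up to a power of `t_d` that only depends on the direction. -/
theorem td_tu_zpow {d u : ℤ} {x y : Dir} (h : u - d = y.exponent - x.exponent) (a : A) :
    (Q.td ^ y.exponent) ((Q.td ^ d) ((Q.tu ^ u) a)) =
      ((Q.G ^ u : Aˣ) : A) * (Q.td ^ x.exponent) a * ((Q.G ^ (-u) : Aˣ) : A) := by
  rw [← Q.td_mul_tu_zpow, Q.commute_td_tu.mul_zpow, ← AlgEquiv.mul_apply, ← AlgEquiv.mul_apply,
    ← AlgEquiv.mul_apply]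
  congr 1
  rw [← zpow_add, mul_assoc, ← (Q.commute_td_tu.zpow_zpow x.exponent u).eq, ← mul_assoc, ← zpow_add]
  congr 2
  omega

end TwistOrientedQuantumAlgebra

/-- The change of the direction of a strand at an event. -/
def Event.turn (e : Event) : ℤ := countU [e] - countD [e]

theorem countU_cons (e : Event) (es : List Event) : countU (e :: es) = countU [e] + countU es := by
  cases e <;> simp [countU] <;> ring

theorem countD_cons (e : Event) (es : List Event) : countD (e :: es) = countD [e] + countD es := by
  cases e <;> simp [countD] <;> ring

theorem rotationCount_eq (es : List Event) : rotationCount es = -(countU es + countD es) := by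
  induction es with
  | nil => rfl
  | cons e es ih => cases e <;> simp only [rotationCount, countU, countD, ih] <;> ring

/-- This is one step of the telescoping. Of the powers of `G` around a crossing bead, the left one
cancels against the new prefix and the right one is the old prefix. An extremum of type `u` changes
the prefix by one factor, which is its bead. -/
theorem TwistOrientedQuantumAlgebra.word_cons (Q : TwistOrientedQuantumAlgebra k A)
    (b : ℕ → Bool → A) {e : Event} {es : List Event} {x y z : Dir}
    (he : e.turn = z.exponent - x.exponent)
    (hes : countU es - countD es = y.exponent - z.exponent) :
    Q.eventBead b x e * (((Q.G ^ (-countU es) : Aˣ) : A) * (Q.td ^ y.exponent) (Q.word b es)) =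
      ((Q.G ^ (-countU (e :: es)) : Aˣ) : A) * (Q.td ^ y.exponent) (Q.word b (e :: es)) := by
  cases e with
  | line i o =>
    have hx : countU es - countD es = y.exponent - x.exponent := by
      simp [Event.turn, countU, countD] at he
      omega
    simp only [eventBead, word, countU, map_mul, Q.td_tu_zpow hx]
    simp only [← mul_assoc, ← Units.val_mul, ← zpow_add, neg_add_cancel, zpow_zero, Units.val_one,
      one_mul]
  | vertical => simp only [eventBead, word, countU, one_mul]
  | dPlus => simp only [eventBead, word, countU, one_mul]
  | dMinus => simp only [eventBead, word, countU, one_mul]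
  | uPlus =>
    simp only [eventBead, word, countU]
    rw [← mul_assoc, ← Units.val_mul, ← zpow_neg_one, ← zpow_add]
    congr 4
    ring
  | uMinus =>
    simp only [eventBead, word, countU]
    rw [← mul_assoc, ← Units.val_mul, ← zpow_one_add]
    congr 4
    ring

end Reduction

/-! ### Traversal of the components and passing through slabs -/

/-- Only extrema turn a strand. The types `u₊` and `d₋` turn it from down to up and `u₋` and `d₊`
from up to down, in agreement with the signs in the two counts. -/
theorem Slice.turn_pass (x : Slice) (i : ℕ) (t : Bool) (j : ℕ) :
    (x.pass i t j).2.2.turn = (Dir.into (!(x.pass i t j).1)).exponent - (Dir.into t).exponent := by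
  obtain ⟨l, p, r⟩ := x
  rcases p with ⟨s, x, y⟩ | x | x <;> simp only [Slice.pass]
  · split_ifs <;> simp [Event.turn, countU, countD]
  all_goals
    cases t <;> simp only [Piece.dom, Piece.cod] <;> split_ifs <;> first
    | contradiction
    | (simp [Event.turn, countU, countD]; done)
    | (exfalso; simp at *; omega)
    | (cases x <;> simp [Event.turn, Piece.extremum, countU, countD, Dir.into, Dir.exponent])

section Slabs

variable {A : Type*} [Monoid A]

theorem Slice.slab_pass (g : Aˣ) (x : Slice) (a b : A) (i : ℕ) (t : Bool) (j : ℕ) :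
    (x.slab g a b).pass (t, j) = ((x.pass i t j).1, (x.pass i t j).2.1) := by
  obtain ⟨l, p, r⟩ := x
  simp only [Slice.slab, Slab.whisker, Slice.pass]
  have h1 : ((p.slab g a b).side t).length = if t then p.cod.length else p.dom.length := by
    cases t <;> rfl
  have h2 : ((p.slab g a b).side (!t)).length = if t then p.dom.length else p.cod.length := by
    cases t <;> rfl
  rw [h1, h2]
  split_ifs with ht
  any_goals rfl
  all_goals
    rcases p with ⟨s, x, y⟩ | x | x <;> simp [Piece.slab, Piece.dom, Piece.cod] at * <;> omega

theorem Slice.slab_dom (g : Aˣ) (x : Slice) (a b : A) : (x.slab g a b).dom = x.dom := rfl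

end Slabs

section Beads

variable {k A : Type*} [Field k] [Ring A] [Algebra k A]

/-- The rising line is the overcrossing one exactly when `s` is true; therefore its decoration is `b
i s` and that of the falling line is `b i !s`. -/
theorem TwistOrientedQuantumAlgebra.slab_bead (Q : TwistOrientedQuantumAlgebra k A)
    (b : ℕ → Bool → A) (x : Slice) (a a' : A) (i : ℕ) {t : Bool} {j : ℕ}
    (hE : (x.slab Q.G a a').Enters (t, j))
    (h : ∀ s y z, x.piece = .crossing s y z →
      a = (Q.td ^ y.exponent) (b i s) ∧ a' = (Q.td ^ z.exponent) (b i !s)) :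
    (x.slab Q.G a a').bead (t, j) = Q.eventBead b (Dir.into t) (x.pass i t j).2.2 := by
  obtain ⟨l, p, r⟩ := x
  rcases Slab.whisker_cases l (p.slab Q.G a a') t j with hj | ⟨j, rfl, hj⟩ | ⟨j, rfl⟩
  · refine (Slab.whisker_bead_left hj).trans ?_
    simp only [Slice.pass, if_pos hj, eventBead]
  · refine (Slab.whisker_bead_mid hj).trans ?_
    have hE' := (Slab.whisker_enters_mid hj).1 hE
    rcases p with ⟨s, y, z⟩ | y | y
    · obtain ⟨rfl, rfl⟩ := h s y z rfl
      have hj2 : j < 2 := hj.trans_le (by cases t <;> simp [Piece.slab, Piece.dom, Piece.cod])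
      have e₁ : (l.length == l.length + 1) = false := beq_false_of_ne (by omega)
      have e₂ : (l.length + 1 == l.length) = false := beq_false_of_ne (by omega)
      cases t <;> interval_cases j <;>
        simp [Slab.Enters, Piece.slab, Piece.dom, Piece.cod, Slice.pass, eventBead, e₁, e₂]
          at hE' ⊢ <;>
        rw [hE']
    · have hj2 : j < 2 := hj.trans_le (by cases t <;> simp [Piece.slab, Piece.dom, Piece.cod])
      cases t <;> interval_cases j <;> cases y <;>
        simp [Slab.Enters, Piece.slab, Piece.dom, Piece.cod, Slice.pass, eventBead,
          Piece.extremum] at hE' ⊢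
    · have hj2 : j < 2 := hj.trans_le (by cases t <;> simp [Piece.slab, Piece.dom, Piece.cod])
      cases t <;> interval_cases j <;> cases y <;>
        simp [Slab.Enters, Piece.slab, Piece.dom, Piece.cod, Slice.pass, eventBead,
          Piece.extremum] at hE' ⊢
  · refine Slab.whisker_bead_right.trans ?_
    have h1 : ((p.slab Q.G a a').side t).length = if t then p.cod.length else p.dom.length := by
      cases t <;> rfl
    simp only [Slice.pass, h1]
    rw [if_neg (by omega), if_pos (by omega)]
    rfl

end Beads

/-! ### Ports of the slabs and points of the diagram -/

section Points

variable {A : Type*} [Monoid A] {g : Aˣ} {L : LinkDiagram} {ys : List (Slab A)}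

theorem Decorates.exists_slice {xs : List Slice} (h : Decorates g xs ys) {i : ℕ} {y : Slab A}
    (hy : ys[i]? = some y) : ∃ x a b, xs[i]? = some x ∧ y = x.slab g a b := by
  obtain ⟨hi, rfl⟩ := List.getElem?_eq_some_iff.1 hy
  have hi' : i < xs.length := by rwa [h.length_eq]
  obtain ⟨a, b, hab⟩ := h.get hi' hi
  exact ⟨xs[i], a, b, by simp [hi'], hab⟩

theorem Decorates.exists_slab {xs : List Slice} (h : Decorates g xs ys) {i : ℕ} {x : Slice}
    (hx : xs[i]? = some x) : ∃ a b, ys[i]? = some (x.slab g a b) := by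
  obtain ⟨hi, rfl⟩ := List.getElem?_eq_some_iff.1 hx
  have hi' : i < ys.length := by rwa [← h.length_eq]
  obtain ⟨a, b, hab⟩ := h.get hi hi'
  exact ⟨a, b, by rw [List.getElem?_eq_getElem hi']; exact congrArg some hab⟩

namespace LinkDiagram

theorem level_eq {i : ℕ} {x : Slice} (h : L.slices[i]? = some x) : L.level i = x.dom := by
  simp [level, h]

/-- The point where a strand enters the slab with index `i` at the place `q`. -/
def entryPoint (P : ℕ × Bool × ℕ) : ℕ × ℕ := (if P.2.1 then P.1 + 1 else P.1, P.2.2)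

/-- A strand entering slab `i` through its top is met at level `i + 1`. This level belongs to the
diagram because no strand reaches the top of the last slice. -/
theorem level_entryPoint (hd : Decorates g L.slices ys) {i : ℕ} {y : Slab A} {q : Bool × ℕ}
    (hy : ys[i]? = some y) (hq : y.Enters q) :
    (L.level (entryPoint (i, q)).1)[(entryPoint (i, q)).2]? = some (Dir.into q.1) := by
  obtain ⟨t, j⟩ := q
  obtain ⟨x, a, b, hx, rfl⟩ := hd.exists_slice hy
  have hf := hd.fits L.fits
  cases t with
  | false => rw [entryPoint, if_neg (by simp), level_eq hx]; exact hq
  | true =>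
    rw [entryPoint, if_pos rfl]
    rcases hx' : L.slices[i + 1]? with _ | x'
    · exfalso
      have hi : i + 1 = ys.length := by
        have h1 := (List.getElem?_eq_some_iff.1 hx).1
        have h2 := List.getElem?_eq_none_iff.1 hx'
        rw [← hd.length_eq]
        omega
      have := hf.cod_eq hy hi
      simp [Slab.Enters, this] at hq
    · obtain ⟨a', b', hy'⟩ := hd.exists_slab hx'
      have h := hf.cod_eq_dom hy hy'
      simp only [level_eq hx']
      rw [← Slice.slab_dom g x' a' b', ← h]
      exact hq

theorem step_entryPoint (hd : Decorates g L.slices ys) {i : ℕ} {y : Slab A} {x : Slice} {q : Bool × ℕ}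
    (hy : ys[i]? = some y) (hq : y.Enters q) (hx : L.slices[i]? = some x) :
    L.step (entryPoint (i, q)) =
      ((if (x.pass i q.1 q.2).1 then i + 1 else i, (x.pass i q.1 q.2).2.1),
        (x.pass i q.1 q.2).2.2) := by
  have h := level_entryPoint hd hy hq
  obtain ⟨t, j⟩ := q
  rw [step]
  simp only [h]
  cases t <;> simp [entryPoint, Dir.into, hx]

theorem next_entryPoint (hd : Decorates g L.slices ys) {P : Port ys} :
    L.next (entryPoint P.coords) = entryPoint (portNext ys P.coords) := by
  obtain ⟨⟨i, q⟩, y, hy, hq⟩ := P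
  change L.next (entryPoint (i, q)) = entryPoint (portNext ys (i, q))
  replace hy : ys[i]? = some y := hy
  replace hq : y.Enters q := hq
  obtain ⟨x, a, b, hx, rfl⟩ := hd.exists_slice hy
  have hl := (x.slab_valid g a b).leaves q hq
  rw [next, step_entryPoint hd hy hq hx, portNext_eq hy, x.slab_pass g a b i q.1 q.2]
  rw [x.slab_pass g a b i q.1 q.2] at hl
  rcases hp : x.pass i q.1 q.2 with ⟨t, j, e⟩
  rw [hp] at hl
  cases t with
  | true => rfl
  | false =>
    have hi : i ≠ 0 := by
      rintro rfl
      have := (hd.fits L.fits).dom_eq hy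
      simp [Slab.Leaves, this] at hl
    simp [leaveSlab, entryPoint]
    omega

/-- The point with given coordinates. -/
def point {p : ℕ × ℕ} {d : Dir} (h : (L.level p.1)[p.2]? = some d) : L.Point :=
  ⟨⟨p.1, by
    by_contra hlt
    simp [level, List.getElem?_eq_none (not_lt.1 hlt)] at h⟩,
    ⟨p.2, (List.getElem?_eq_some_iff.1 h).1⟩⟩

theorem coords_injective : Function.Injective (Point.coords (L := L)) := by
  rintro ⟨⟨i, hi⟩, ⟨j, hj⟩⟩ ⟨⟨i', hi'⟩, ⟨j', hj'⟩⟩ h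
  obtain ⟨rfl, rfl⟩ := Prod.ext_iff.1 h
  rfl

theorem exists_port (hd : Decorates g L.slices ys) (P : L.Point) :
    ∃ R : Port ys, entryPoint R.coords = P.coords := by
  obtain ⟨⟨i, hi⟩, ⟨j, hj⟩⟩ := P
  have hx : L.slices[i]? = some L.slices[i] := by simp [hi]
  obtain ⟨a, b, hy⟩ := hd.exists_slab hx
  have hj' : (L.level i)[j]? = some (L.level i)[j] := List.getElem?_eq_getElem hj
  rcases hdir : (L.level i)[j] with _ | _
  · rw [hdir, level_eq hx] at hj'
    exact ⟨⟨(i, false, j), _, hy, hj'⟩, rfl⟩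
  · rw [hdir, level_eq hx] at hj'
    have hf := hd.fits L.fits
    cases i with
    | zero =>
      exfalso
      have := hf.dom_eq hy
      rw [Slice.slab_dom] at this
      simp [this] at hj'
    | succ i =>
      have hi' : i < L.slices.length := by omega
      obtain ⟨a', b', hy'⟩ := hd.exists_slab (x := L.slices[i]) (i := i) (by simp [hi'])
      have h := hf.cod_eq_dom hy' hy
      refine ⟨⟨(i, true, j), _, hy', ?_⟩, rfl⟩
      change (Slab.cod _)[j]? = _
      rw [h]
      exact hj'

/-- The entry point, as a point of the diagram. -/
def portPoint (hd : Decorates g L.slices ys) (R : Port ys) : L.Point :=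
  point (p := entryPoint R.coords) (d := Dir.into R.coords.2.1) (by
    obtain ⟨⟨i, q⟩, y, hy, hq⟩ := R
    exact level_entryPoint hd hy hq)

theorem coords_portPoint (hd : Decorates g L.slices ys) (R : Port ys) :
    (portPoint hd R).coords = entryPoint R.coords := rfl

/-- At a point the strand is about to enter the slab above if directed up and the slab below if
directed down. The direction thus recovers the port from the point. -/
theorem portPoint_bijective (hd : Decorates g L.slices ys) :
    Function.Bijective (portPoint hd) := by
  constructor
  · rintro ⟨⟨i, t, j⟩, y, hy, hq⟩ ⟨⟨i', t', j'⟩, y', hy', hq'⟩ h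
    have hc : entryPoint (i, t, j) = entryPoint (i', t', j') := congrArg Point.coords h
    have h1 := level_entryPoint hd hy hq
    have h2 := level_entryPoint hd hy' hq'
    rw [hc, h2] at h1
    have ht : t = t' := by cases t <;> cases t' <;> simp [Dir.into] at h1 ⊢
    subst ht
    apply Subtype.ext
    cases t <;> simpa [entryPoint] using hc
  · intro P
    obtain ⟨R, hR⟩ := exists_port hd P
    exact ⟨R, coords_injective hR⟩

/-- The statement is carried over from the ports along the bijection between ports and points. -/
theorem permutes (hd : Decorates g L.slices ys) : Permutes (Point.coords (L := L)) L.next := by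
  have hP := (hd.closed L.fits).permutes
  have hbij := portPoint_bijective hd
  refine ⟨inferInstance, coords_injective, fun P => ?_, fun P P' h => ?_⟩
  · obtain ⟨R, rfl⟩ := hbij.2 P
    obtain ⟨S, hS⟩ := hP.maps R
    exact ⟨portPoint hd S, by rw [coords_portPoint, next_entryPoint hd, hS]; rfl⟩
  · obtain ⟨R, rfl⟩ := hbij.2 P
    obtain ⟨R', rfl⟩ := hbij.2 P'
    rw [coords_portPoint, coords_portPoint, next_entryPoint hd, next_entryPoint hd] at h
    obtain ⟨S, hS⟩ := hP.maps R
    obtain ⟨S', hS'⟩ := hP.maps R'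
    rw [hS, hS'] at h
    have : S = S' := hbij.1 (coords_injective h)
    rw [hP.inj_map R R' (by rw [hS, hS', this])]

/-- The direction of the strand at a point. -/
def dirAt (L : LinkDiagram) (p : ℕ × ℕ) : Dir := ((L.level p.1)[p.2]?).getD .up

theorem dirAt_entryPoint (hd : Decorates g L.slices ys) (R : Port ys) :
    L.dirAt (entryPoint R.coords) = Dir.into R.coords.2.1 := by
  obtain ⟨⟨i, q⟩, y, hy, hq⟩ := R
  exact congrArg (fun d => d.getD Dir.up) (level_entryPoint hd hy hq)

theorem turn_step (hd : Decorates g L.slices ys) (P : L.Point) :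
    (L.step P.coords).2.turn =
      (L.dirAt (L.next P.coords)).exponent - (L.dirAt P.coords).exponent := by
  obtain ⟨R, rfl⟩ := (portPoint_bijective hd).2 P
  obtain ⟨S, hS⟩ := (hd.closed L.fits).permutes.maps R
  rw [coords_portPoint, next_entryPoint hd, hS, dirAt_entryPoint hd, dirAt_entryPoint hd, ← hS]
  obtain ⟨⟨i, q⟩, y, hy, hq⟩ := R
  obtain ⟨x, a, b, hx, rfl⟩ := hd.exists_slice hy
  change (L.step (entryPoint (i, q))).2.turn = (Dir.into (portNext ys (i, q)).2.1).exponent - _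
  rw [step_entryPoint hd hy hq hx, portNext_eq hy, x.slab_pass g a b i q.1 q.2, Slice.turn_pass]
  rfl

end LinkDiagram

end Points

/-! ### The bead sum as a sum over the decorated diagrams -/

section StateList

variable {k A : Type*} [Field k] [Ring A] [Algebra k A] {c : Bool → Dir → Dir → A ⊗[k] A}

/-- The slabs that belong to a choice of a summand for every slice. -/
def CrossingExpansions.decorate (D : CrossingExpansions c) (g : Aˣ) :
    (xs : List Slice) → ((i : Fin xs.length) → Fin (D.count (xs.get i).piece)) → List (Slab A)
  | [], _ => []
  | x :: xs, σ => x.slab g (D.beads x.piece (σ 0)).1 (D.beads x.piece (σ 0)).2 ::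
      D.decorate g xs fun i => σ i.succ

variable (D : CrossingExpansions c) (g : Aˣ)

theorem decorates_decorate (xs : List Slice)
    (σ : (i : Fin xs.length) → Fin (D.count (xs.get i).piece)) :
    Decorates g xs (D.decorate g xs σ) := by
  induction xs with
  | nil => exact .nil
  | cons x xs ih => exact .cons ⟨_, _, rfl⟩ (ih _)

theorem getElem?_decorate (xs : List Slice)
    (σ : (i : Fin xs.length) → Fin (D.count (xs.get i).piece)) (i : Fin xs.length) :
    (D.decorate g xs σ)[(i : ℕ)]? =
      some ((xs.get i).slab g (D.beads _ (σ i)).1 (D.beads _ (σ i)).2) := by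
  induction xs with
  | nil => exact i.elim0
  | cons x xs ih =>
    cases i using Fin.cases with
    | zero => rfl
    | succ i => exact ih (fun i => σ i.succ) i

theorem stateSum_eq_sum (xs : List Slice) (F : List (Slab A) → k) :
    stateSum D g xs F = ∑ σ, F (D.decorate g xs σ) := by
  induction xs generalizing F with
  | nil =>
    refine Eq.trans ?_ (Fintype.sum_unique (ι := (i : Fin 0) →
      Fin (D.count (([] : List Slice).get i).piece)) _).symm
    rfl
  | cons x xs ih =>
    refine Eq.trans ?_ ((Fin.consEquiv fun i : Fin (xs.length + 1) =>
      Fin (D.count ((x :: xs).get i).piece)).sum_comp fun σ => F (D.decorate g (x :: xs) σ))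
    rw [Fintype.sum_prod_type]
    exact Finset.sum_congr rfl fun j _ => ih _

end StateList

/-! ### The bead sum as a state sum of local beads -/

section BeadSum

variable {k A : Type*} [Field k] [Ring A] [Algebra k A] (Q : TwistOrientedQuantumAlgebra k A)
  {L : LinkDiagram} {ys : List (Slab A)}

namespace LinkDiagram

/-- The two claims are proved together because the telescoping step needs the count of turns of the
remaining segment. The induction removes the first event, so the starting point varies. -/
theorem segmentWord_eventBead (hd : Decorates Q.G L.slices ys) (b : ℕ → Bool → A) (n : ℕ)
    (P : L.Point) :
    countU ((List.range n).map fun m => (L.step (L.next^[m] P.coords)).2) -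
        countD ((List.range n).map fun m => (L.step (L.next^[m] P.coords)).2) =
      (L.dirAt (L.next^[n] P.coords)).exponent - (L.dirAt P.coords).exponent ∧
    segmentWord L.next (fun p => Q.eventBead b (L.dirAt p) (L.step p).2) P.coords n =
      ((Q.G ^ (-countU ((List.range n).map fun m => (L.step (L.next^[m] P.coords)).2)) : Aˣ) : A) *
        (Q.td ^ (L.dirAt (L.next^[n] P.coords)).exponent)
          (Q.word b ((List.range n).map fun m => (L.step (L.next^[m] P.coords)).2)) := by
  induction n generalizing P with
  | zero => simp [countU, countD, segmentWord_zero, TwistOrientedQuantumAlgebra.word]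
  | succ n ih =>
    obtain ⟨P', hP'⟩ := (permutes hd).maps P
    obtain ⟨h1, h2⟩ := ih P'
    have ht := turn_step hd P
    have hl : (List.range (n + 1)).map (fun m => (L.step (L.next^[m] P.coords)).2) =
        (L.step P.coords).2 ::
          (List.range n).map fun m => (L.step (L.next^[m] P'.coords)).2 := by
      rw [List.range_succ_eq_map, List.map_cons, List.map_map]
      simp only [Function.comp_def, Nat.succ_eq_add_one, Function.iterate_succ_apply, hP']
      rfl
    rw [hP'] at ht
    have hn : L.next^[n + 1] P.coords = L.next^[n] P'.coords := by
      rw [Function.iterate_succ_apply, hP']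
    rw [hl, hn]
    refine ⟨?_, ?_⟩
    · rw [countU_cons, countD_cons]
      rw [Event.turn] at ht
      linarith
    · rw [segmentWord_succ', hP', h2]
      exact Q.word_cons b ht h1

theorem trace_traversal {tr : A →ₗ[k] k} (htd : ∀ a, tr (Q.td a) = tr a)
    (hd : Decorates Q.G L.slices ys) (b : ℕ → Bool → A) (P : L.Point) :
    tr (((Q.G ^ L.whitneyDegree P : Aˣ) : A) * Q.word b (L.traversal P)) =
      tr (cycleWord L.next (fun p => Q.eventBead b (L.dirAt p) (L.step p).2) P.coords) := by
  obtain ⟨h1, h2⟩ := segmentWord_eventBead Q hd b (L.period P) P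
  have hp : L.next^[L.period P] P.coords = P.coords := Function.iterate_minimalPeriod
  rw [hp] at h1 h2
  change countU (L.traversal P) - countD (L.traversal P) = _ at h1
  -- After a full turn the direction is the initial one, so both counts agree and the halved
  -- rotation count is `-countU`.
  have hw : L.whitneyDegree P = -countU (L.traversal P) := by
    rw [whitneyDegree, rotationCount_eq]
    omega
  rw [hw]
  exact (Q.trace_zpow_G_mul htd _ _ _).symm.trans (congrArg tr h2.symm)

/-- The product over the components of a diagram with beads. -/
theorem prod_component {tr : A →ₗ[k] k} (htr : ∀ a b, tr (a * b) = tr (b * a))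
    (htd : ∀ a, tr (Q.td a) = tr a) (hd : Decorates Q.G L.slices ys) (b : ℕ → Bool → A)
    (hb : ∀ (i : ℕ) (x : Slice) (y : Slab A), L.slices[i]? = some x → ys[i]? = some y →
      ∃ a a', y = x.slab Q.G a a' ∧ ∀ s u v, x.piece = .crossing s u v →
        a = (Q.td ^ u.exponent) (b i s) ∧ a' = (Q.td ^ v.exponent) (b i !s))
    (P : L.StartingPoints) :
    ∏ c : L.Component, tr (((Q.G ^ L.whitneyDegree (P.1 c) : Aˣ) : A) *
      Q.word b (L.traversal (P.1 c))) = slabValue tr ys := by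
  have hX := permutes hd
  have h1 : slabValue tr ys = cycleProd tr (Point.coords (L := L)) L.next
      (fun p => Q.eventBead b (L.dirAt p) (L.step p).2) := by
    refine (cycleProd_congr htr hX (hd.closed L.fits).permutes (portPoint hd)
      (portPoint_bijective hd) ?_ ?_).symm
    · intro R S hRS
      rw [coords_portPoint, next_entryPoint hd, hRS]
      rfl
    · intro R
      rw [coords_portPoint, dirAt_entryPoint hd]
      obtain ⟨⟨i, q⟩, y, hy, hq⟩ := R
      replace hy : ys[i]? = some y := hy
      obtain ⟨x, -, -, hx, -⟩ := hd.exists_slice hy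
      obtain ⟨a, a', rfl, hab⟩ := hb i x y hx hy
      change Q.eventBead b (Dir.into q.1) (L.step (entryPoint (i, q))).2 = portBead ys (i, q)
      rw [step_entryPoint hd hy hq hx, portBead_eq hy]
      exact (Q.slab_bead b x a a' i hq hab).symm
  rw [h1, cycleProd]
  refine Eq.trans ?_ (finprod_eq_prod_of_fintype (α := L.Component) _).symm
  refine Finset.prod_congr rfl fun c _ => ?_
  rw [trace_traversal Q htd hd]
  -- The given starting point and the chosen representative lie on the same cycle, and the cyclic
  -- trace does not distinguish them.
  exact hX.trace_cycleWord_of_rel htr _ (Quotient.exact ((P.2 c).trans (Quotient.out_eq c).symm))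

end LinkDiagram

namespace TwistOrientedQuantumAlgebra

theorem count_crossingExpansions (E : Q.Expansions) {p : Piece}
    (hp : ∃ s x y, p = .crossing s x y) :
    (Q.crossingExpansions E).count p = (E p.sign).n := by
  obtain ⟨s, x, y, rfl⟩ := hp
  rfl

theorem count_eq_one (E : Q.Expansions) {p : Piece}
    (hp : ¬ ∃ s x y, p = .crossing s x y) : (Q.crossingExpansions E).count p = 1 := by
  rcases p with ⟨s, x, y⟩ | x | x
  · exact absurd ⟨s, x, y, rfl⟩ hp
  · rfl
  · rfl

theorem beads_crossingExpansions (E : Q.Expansions) {p : Piece} {s : Bool} {x y : Dir}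
    (hp : p = .crossing s x y) (j : Fin ((Q.crossingExpansions E).count p))
    (h : (Q.crossingExpansions E).count p = (E p.sign).n) :
    (Q.crossingExpansions E).beads p j =
      ((Q.td ^ x.exponent) (if s then Q.overTwist p ((E p.sign).fst (Fin.cast h j))
        else Q.underTwist p ((E p.sign).snd (Fin.cast h j))),
      (Q.td ^ y.exponent) (if !s then Q.overTwist p ((E p.sign).fst (Fin.cast h j))
        else Q.underTwist p ((E p.sign).snd (Fin.cast h j)))) := by
  subst hp
  rfl

/-- The choices of the summands at the crossings. -/
noncomputable def restrictState (E : Q.Expansions) (L : LinkDiagram)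
    (σ : (i : Fin L.slices.length) → Fin ((Q.crossingExpansions E).count (L.slices.get i).piece)) :
    Q.State E L :=
  fun c => Fin.cast (Q.count_crossingExpansions E c.2) (σ c.1)

/-- Slices with an extremum have exactly one summand, so only the choices at the crossings count. -/
theorem restrictState_bijective (E : Q.Expansions) (L : LinkDiagram) :
    Function.Bijective (Q.restrictState E L) := by
  classical
  constructor
  · intro σ σ' h
    funext i
    by_cases hi : ∃ s x y, L.piece i = .crossing s x y
    · exact Fin.cast_injective _ (congrFun h ⟨i, hi⟩)
    · have h1 : (Q.crossingExpansions E).count (L.slices.get i).piece = 1 := Q.count_eq_one E hi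
      have := Fin.isLt (σ i)
      have := Fin.isLt (σ' i)
      exact Fin.ext (by omega)
  · intro τ
    refine ⟨fun i => if hi : ∃ s x y, L.piece i = .crossing s x y then
      Fin.cast (Q.count_crossingExpansions E hi).symm (τ ⟨i, hi⟩)
      else Fin.cast (Q.count_eq_one E hi).symm 0, ?_⟩
    funext c
    simp only [restrictState, dif_pos c.2]
    rfl

/-- The right-hand side no longer mentions starting points, nor `t_d` and `t_u` except through the
expansions. -/
theorem beadSum_eq_diagramValue {tr : A →ₗ[k] k} (htr : ∀ a b, tr (a * b) = tr (b * a))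
    (htd : ∀ a, tr (Q.td a) = tr a) (L : LinkDiagram) (P : L.StartingPoints) (E : Q.Expansions) :
    Q.beadSum tr L P E = diagramValue (Q.crossingExpansions E) Q.G tr L.slices := by
  rw [diagramValue, stateSum_eq_sum, beadSum]
  refine ((Q.restrictState_bijective E L).sum_comp _).symm.trans ?_
  refine Finset.sum_congr rfl fun σ _ => ?_
  refine LinkDiagram.prod_component Q htr htd (decorates_decorate _ _ _ σ) _ ?_ P
  intro i x y hx hy
  obtain ⟨hi, rfl⟩ := List.getElem?_eq_some_iff.1 hx
  rw [getElem?_decorate _ _ _ σ ⟨i, hi⟩] at hy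
  refine ⟨_, _, (Option.some.inj hy).symm, fun s u v hp => ?_⟩
  have hp' : L.piece ⟨i, hi⟩ = .crossing s u v := hp
  have hc : ∃ s x y, L.piece ⟨i, hi⟩ = .crossing s x y := ⟨s, u, v, hp'⟩
  have h := Q.beads_crossingExpansions E hp' (σ ⟨i, hi⟩) (Q.count_crossingExpansions E hc)
  have hdec : ∀ o, Q.decoration E L (Q.restrictState E L σ) i o =
      if o then Q.overTwist (L.piece ⟨i, hi⟩) ((E (L.piece ⟨i, hi⟩).sign).fst
          (Q.restrictState E L σ ⟨⟨i, hi⟩, hc⟩))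
        else Q.underTwist (L.piece ⟨i, hi⟩) ((E (L.piece ⟨i, hi⟩).sign).snd
          (Q.restrictState E L σ ⟨⟨i, hi⟩, hc⟩)) := fun o => by
    rw [decoration, dif_pos ⟨hi, hc⟩]
  rw [hdec, hdec]
  exact ⟨congrArg Prod.fst h, congrArg Prod.snd h⟩

end TwistOrientedQuantumAlgebra

end BeadSum

/-! ### The theorem -/

theorem theorem3p3 {k A : Type*} [Field k] [Ring A] [Algebra k A]
    (Q : TwistOrientedQuantumAlgebra k A) (tr : A →ₗ[k] k)
    (htr : ∀ a b, tr (a * b) = tr (b * a))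
    (htd : ∀ a, tr (Q.td a) = tr a) (htu : ∀ a, tr (Q.tu a) = tr a) :
    (∀ (L : LinkDiagram) (P : L.StartingPoints) (E : Q.Expansions),
      Q.Inv tr L = Q.beadSum tr L P E) ∧
    (∀ L L' : LinkDiagram, L.RegularlyIsotopic L' → Q.Inv tr L = Q.Inv tr L') ∧
    (∀ L : LinkDiagram, Q.standard.Inv tr L = Q.Inv tr L) := by
  have key : ∀ L : LinkDiagram, Q.Inv tr L =
      diagramValue (Q.crossingExpansions Q.nonempty_expansions.some) Q.G tr L.slices :=
    fun L => Q.beadSum_eq_diagramValue htr htd L _ _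
  refine ⟨fun L P E => ?_, fun L L' h => ?_, fun L => ?_⟩
  · rw [key, Q.beadSum_eq_diagramValue htr htd]
    exact diagramValue_expansions _ _ _ htr L.fits
  · rw [key, key]
    exact h.diagramValue_eq Q.braidTensor _ htr
  · rw [key]
    refine (Q.standard.beadSum_eq_diagramValue htr (fun _ => rfl) L _ _).trans ?_
    -- The crossing tensors of both algebras are the same by definition, being built from ρ and `G`
    -- alone; only their expansions differ.
    exact diagramValue_expansions (c := Q.crossing) _ _ Q.G htr L.fits
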